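/- Let $I=(-1,1)$. For real $r\ge 0$ let $H^r(I)$ be the usual Sobolev space of real-valued functions: with $m=\lfloor r\rfloor$ and $\sigma=r-m$, $$\|u\|_{H^r(I)}^2=\sum_{k=0}^{m}\|u^{(k)}\|_{L^2(I)}^2+|u^{(m)}|_\sigma^2,\qquad |w|_\sigma^2=\int_I\!\int_I\frac{|w(x)-w(y)|^2}{|x-y|^{1+2\sigma}}\,dy\,dx ,$$ where derivatives are weak and the term $|u^{(m)}|_\sigma^2$ is omitted if $\sigma=0$. For $0<t\le 1$ let $H^t_0(I)$ be the closure of $C_0^\infty(I)$ in $H^t(I)$. For $\tfrac12<t\le 1$ and $0<s<t$ let $\tilde H^{s}(I)=(L^2(I),H^t_0(I))_{s/t,2}$ be defined by the real $K$-method, with norm $$\|u\|_{\tilde H^{s}(I)}=\Big(\int_0^\infty \big(\tau^{-s/t}K(\tau,u)\big)^2\,\frac{d\tau}{\tau}\Big)^{1/2},\qquad K(\tau,u)=\inf_{\substack{u=u_0+u_1\\ u_0\in L^2(I),\ u_1\in H^t_0(I)}}\big(\|u_0\|_{L^2(I)}+\tau\|u_1\|_{H^t(I)}\big)$$ (the spaces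 obtained from different $t$ coincide, with equivalent norms). **Lemma 2.1.** Let $r>\tfrac12$ and $\tfrac12<t\le 1$. There is a constant $C>0$, depending only on $r$ and $t$, such that the following holds. Every $f\in H^r(I)$ has a representative that is continuous on $[-1,1]$, and, with $f(\pm1)$ denoting the values of that representative, for every integer $p\ge 1$ there is a polynomial $f_p$ of degree at most $p$ such that $f_p(-1)=f(-1)$, $f_p(1)=f(1)$ and $$\|f-f_p\|_{\tilde H^{1/2}(I)}\le C\,p^{-(r-1/2)}\,\|f\|_{H^r(I)},$$ where $\tilde H^{1/2}(I)=(L^2(I),H^t_0(I))_{1/(2t),2}$ carries the norm above; in particular $f-f_p\in\tilde H^{1/2}(I)$. -/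

import Mathlib

open MeasureTheory Set
open scoped ENNReal ContDiff

namespace PApprox

noncomputable section

/-- The open interval `I = (-1, 1)`. -/
def I : Set ℝ := Ioo (-1) 1

/-- Lebesgue measure on `I`. Functions on `I` are represented by functions `ℝ → ℝ`, of which only
the almost everywhere class on `I` is ever used. -/
def μI : Measure ℝ := volume.restrict I

/-- The test functions, i.e. the elements of `C_0^∞(I)`. -/
def IsTestFunction (φ : ℝ → ℝ) : Prop :=
  ContDiff ℝ ∞ φ ∧ HasCompactSupport φ ∧ tsupport φ ⊆ I

/-- `v` is the `k`-th weak derivative of `u` on `I`. -/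
def HasWeakDeriv (k : ℕ) (u v : ℝ → ℝ) : Prop :=
  LocallyIntegrableOn u I volume ∧ LocallyIntegrableOn v I volume ∧
    ∀ φ : ℝ → ℝ, IsTestFunction φ →
      ∫ x in I, u x * iteratedDeriv k φ x = (-1) ^ k * ∫ x in I, v x * φ x

/-- The square of the Gagliardo (Slobodeckij) seminorm of order `σ ∈ (0, 1)`:
`∫_I ∫_I |w(x) - w(y)|² / |x - y|^(1 + 2σ) dy dx`. -/
def gagliardoSq (σ : ℝ) (w : ℝ → ℝ) : ℝ≥0∞ :=
  ∫⁻ x in I, ∫⁻ y in I, ‖w x - w y‖ₑ ^ 2 / ENNReal.ofReal (|x - y| ^ (1 + 2 * σ))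

/-- The norm of the Sobolev space `H^r(I)`, `r ≥ 0`. With `m = ⌊r⌋` and `σ = r - m` its square is
`∑_{k ≤ m} ‖u^(k)‖²_{L²(I)}`, plus the squared Gagliardo seminorm of order `σ` of `u^(m)` if
`σ > 0`. Weak derivatives are unique almost everywhere, so the infimum is over a single value; it
is `∞` if some weak derivative of order at most `m` does not exist. -/
def sobolevNorm (r : ℝ) (u : ℝ → ℝ) : ℝ≥0∞ :=
  ⨅ (v : ℕ → ℝ → ℝ) (_ : ∀ k ≤ ⌊r⌋₊, HasWeakDeriv k u (v k)),
    ((∑ k ∈ Finset.range (⌊r⌋₊ + 1), eLpNorm (v k) 2 μI ^ 2) +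
      (if Int.fract r = 0 then 0 else gagliardoSq (Int.fract r) (v ⌊r⌋₊))) ^ (1 / 2 : ℝ)

/-- `u ∈ H^r(I)`. -/
def MemSobolev (r : ℝ) (u : ℝ → ℝ) : Prop :=
  sobolevNorm r u < ⊤

/-- `u ∈ H_0^t(I)`, the closure of `C_0^∞(I)` in `H^t(I)`. -/
def MemSobolevZero (t : ℝ) (u : ℝ → ℝ) : Prop :=
  MemSobolev t u ∧
    ∀ ε : ℝ≥0∞, 0 < ε → ∃ φ : ℝ → ℝ, IsTestFunction φ ∧ sobolevNorm t (u - φ) < ε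

/-- The K-functional of the couple `(L²(I), H_0^t(I))`. -/
def kFunctional (t τ : ℝ) (u : ℝ → ℝ) : ℝ≥0∞ :=
  ⨅ (u₀ : ℝ → ℝ) (u₁ : ℝ → ℝ) (_ : MemLp u₀ 2 μI) (_ : MemSobolevZero t u₁)
    (_ : u =ᵐ[μI] u₀ + u₁),
    eLpNorm u₀ 2 μI + ENNReal.ofReal τ * sobolevNorm t u₁

/-- The norm of `H̃^s(I) = (L²(I), H_0^t(I))_{s/t, 2}` given by the real K-method:
`(∫_0^∞ (τ^(-s/t) K(τ, u))² dτ/τ)^(1/2)`. It is finite exactly for `u ∈ H̃^s(I)`. -/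
def tildeNorm (t s : ℝ) (u : ℝ → ℝ) : ℝ≥0∞ :=
  (∫⁻ τ in Ioi (0 : ℝ),
    (ENNReal.ofReal (τ ^ (-(s / t))) * kFunctional t τ u) ^ 2 * ENNReal.ofReal τ⁻¹) ^ (1 / 2 : ℝ)

end

end PApprox

/-!
The function `f` is compared with polynomials in two steps, after which only the K-functional has
to be estimated.

**Polynomial approximation of absolutely continuous functions.** The Legendre polynomials are
eigenfunctions of `q ↦ -((1 - x²) q')'` for the eigenvalues `k (k + 1)`. Hence a polynomial `Z` has
distance at most `‖Z'‖ / n` to the polynomials of degree less than `n`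
(`mul_l2Norm_sub_projection_le`). By duality, `‖e‖ ≤ ‖e'‖ / n` whenever `e (-1) = 0` and `e'` is
orthogonal to the polynomials of degree less than `n` (`HasL2Deriv.mul_l2Norm_le`). If `w` is
absolutely continuous with `w' ∈ L²(I)`, then integrating the projection of `w'` to the polynomials
of degree less than `n` gives a polynomial `q` of degree at most `n` which agrees with `w` at both
endpoints, and `w - q` is small both in `L²` and in `H¹` (`HasL2Deriv.exists_interpolant`).

**The case `r ≥ 1`.** Here `f` itself is absolutely continuous. Its derivative of order `⌊r⌋` is
smoothed at scale `1 / n` (`exists_smoothing`) and is therefore approximated by polynomials at the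
rate `n^(-σ)`, `σ = r - ⌊r⌋`. Each integration gains one order (`HasL2Deriv.polyApprox_rpow`), so
the interpolant `q` of degree `p` satisfies `‖f - q‖ ≤ C p^(-r)` and `‖(f - q)'‖ ≤ C p^(1 - r)`. As
`f - q` lies in `H^t_0(I)`, this gives `K(τ, f - q) ≤ C p^(-r) min(1, τ p^t)`, and `tildeNorm_le`
integrates this bound.

**The case `1/2 < r < 1`.** The smoothings of `f` at the scales `2^(-j)` converge uniformly, at the
rate `2^(-j (r - 1/2))`, to a continuous representative `g`. Adding suitable multiples of the
polynomials `((1 ± x) / 2)^(2^j)` makes them agree with `g` at the endpoints without spoiling their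
norms, as these polynomials have `L²` norm of order `2^(-j/2)` and their derivatives have norm of
order `2^(j/2)` (`exists_dyadic_approximation`). Let `F j` be the functions so obtained. The
polynomial is the interpolant of `F J` with `2^J ≤ p < 2^(J + 1)`, and the K-functional is bounded
by splitting `f - q = (f - F j) + (F j - q)` with `2^(-j)` of the order of `τ^(1/t)`
(`exists_approximation_of_gagliardo`). No extension of `f` beyond `I` is needed: the smoothing
averages `f` around `(1 - h) x` instead of `x`.
-/

namespace PApprox

/-! ### Square integrable functions and absolutely continuous functions on `I` -/

lemma measurableSet_I : MeasurableSet I := measurableSet_Ioo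

instance : IsFiniteMeasure μI := by
  unfold μI I; infer_instance

lemma integral_μI (h : ℝ → ℝ) : ∫ x, h x ∂μI = ∫ x in (-1 : ℝ)..1, h x := by
  rw [intervalIntegral.integral_of_le (by norm_num), integral_Ioc_eq_integral_Ioo]; rfl

lemma integrable_μI_iff {h : ℝ → ℝ} : Integrable h μI ↔ IntervalIntegrable h volume (-1) 1 := by
  rw [intervalIntegrable_iff_integrableOn_Ioo_of_le (by norm_num)]; rfl

lemma ae_μI_mem : ∀ᵐ x ∂μI, x ∈ Ioo (-1 : ℝ) 1 := ae_restrict_mem measurableSet_Ioo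

/-- The norm of `L²(I)`, as a real number. -/
noncomputable def l2Norm (h : ℝ → ℝ) : ℝ := (eLpNorm h 2 μI).toReal

lemma l2Norm_nonneg (h : ℝ → ℝ) : 0 ≤ l2Norm h := ENNReal.toReal_nonneg

lemma ofReal_l2Norm {h : ℝ → ℝ} (hh : MemLp h 2 μI) :
    ENNReal.ofReal (l2Norm h) = eLpNorm h 2 μI := ENNReal.ofReal_toReal hh.2.ne

lemma l2Norm_sq {h : ℝ → ℝ} (hh : MemLp h 2 μI) : l2Norm h ^ 2 = ∫ x, h x ^ 2 ∂μI := by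
  have h0 : 0 ≤ ∫ x, h x ^ 2 ∂μI := integral_nonneg fun x => sq_nonneg _
  rw [l2Norm, hh.eLpNorm_eq_integral_rpow_norm (by norm_num) (by norm_num)]
  simp only [ENNReal.toReal_ofNat, Real.norm_eq_abs, Real.rpow_ofNat, sq_abs]
  rw [ENNReal.toReal_ofReal (by positivity), ← Real.rpow_natCast, ← Real.rpow_mul h0]
  norm_num

lemma l2Norm_congr {f g : ℝ → ℝ} (h : f =ᵐ[μI] g) : l2Norm f = l2Norm g := by
  rw [l2Norm, l2Norm, eLpNorm_congr_ae h]

lemma l2Norm_add_le {f g : ℝ → ℝ} (hf : MemLp f 2 μI) (hg : MemLp g 2 μI) :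
    l2Norm (f + g) ≤ l2Norm f + l2Norm g := by
  rw [l2Norm, l2Norm, l2Norm, ← ENNReal.toReal_add hf.2.ne hg.2.ne]
  exact ENNReal.toReal_mono (ENNReal.add_ne_top.2 ⟨hf.2.ne, hg.2.ne⟩)
    (eLpNorm_add_le hf.1 hg.1 (by norm_num))

lemma l2Norm_sub_le {f g : ℝ → ℝ} (hf : MemLp f 2 μI) (hg : MemLp g 2 μI) :
    l2Norm (f - g) ≤ l2Norm f + l2Norm g := by
  rw [l2Norm, l2Norm, l2Norm, ← ENNReal.toReal_add hf.2.ne hg.2.ne]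
  exact ENNReal.toReal_mono (ENNReal.add_ne_top.2 ⟨hf.2.ne, hg.2.ne⟩)
    (eLpNorm_sub_le hf.1 hg.1 (by norm_num))

lemma l2Norm_const_smul (c : ℝ) (f : ℝ → ℝ) : l2Norm (c • f) = |c| * l2Norm f := by
  rw [l2Norm, l2Norm, eLpNorm_const_smul, ENNReal.toReal_mul]; simp

lemma integrable_mul_of_memLp {f g : ℝ → ℝ} (hf : MemLp f 2 μI) (hg : MemLp g 2 μI) :
    Integrable (fun x => f x * g x) μI := hf.integrable_mul hg

lemma abs_integral_mul_le {f g : ℝ → ℝ} (hf : MemLp f 2 μI) (hg : MemLp g 2 μI) :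
    |∫ x, f x * g x ∂μI| ≤ l2Norm f * l2Norm g := by
  have h := abs_real_inner_le_norm (hf.toLp f) (hg.toLp g)
  rw [L2.inner_def, Lp.norm_toLp, Lp.norm_toLp] at h
  refine le_trans (le_of_eq ?_) h
  congr 1
  refine integral_congr_ae ?_
  filter_upwards [hf.coeFn_toLp, hg.coeFn_toLp] with x h1 h2
  simp [h1, h2, mul_comm]

lemma integrable_of_memLp {f : ℝ → ℝ} (hf : MemLp f 2 μI) : Integrable f μI :=
  hf.integrable (by norm_num)

lemma memLp_of_continuousOn {f : ℝ → ℝ} (hf : ContinuousOn f (Icc (-1) 1)) : MemLp f 2 μI := by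
  obtain ⟨M, hM⟩ := isCompact_Icc.exists_bound_of_continuousOn hf
  refine MemLp.of_bound ((hf.mono Ioo_subset_Icc_self).aestronglyMeasurable measurableSet_Ioo) M ?_
  filter_upwards [ae_μI_mem] with x hx using hM x (Ioo_subset_Icc_self hx)

lemma memLp_polynomial (q : Polynomial ℝ) : MemLp (fun x => q.eval x) 2 μI :=
  memLp_of_continuousOn q.continuous.continuousOn

lemma measureReal_μI : μI.real univ = 2 := by
  simp [μI, I, Measure.real]; norm_num

lemma l2Norm_le_of_bound {f : ℝ → ℝ} {M : ℝ} (hM : 0 ≤ M)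
    (h : ∀ x ∈ Ioo (-1 : ℝ) 1, |f x| ≤ M) : l2Norm f ≤ 2 * M := by
  have h1 := eLpNorm_le_of_ae_bound (p := 2) (f := f) (μ := μI) (C := M)
    (by filter_upwards [ae_μI_mem] with x hx using h x hx)
  have h3 : μI univ = 2 := by
    have := measureReal_μI
    rw [Measure.real] at this
    rw [← ENNReal.ofReal_toReal (measure_ne_top μI univ), this]; simp
  rw [h3] at h1
  have h2 : (2 : ℝ≥0∞) ^ ((2 : ℝ≥0∞).toReal)⁻¹ ≤ 2 := by
    conv_rhs => rw [← ENNReal.rpow_one 2]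
    exact ENNReal.rpow_le_rpow_of_exponent_le (by norm_num) (by norm_num)
  have h4 : eLpNorm f 2 μI ≤ 2 * ENNReal.ofReal M := h1.trans (by gcongr)
  have := ENNReal.toReal_mono (by finiteness) h4
  rwa [ENNReal.toReal_mul, ENNReal.toReal_ofReal hM] at this

/-- `w` is, on `[-1, 1]`, absolutely continuous with derivative `v ∈ L²(I)`: it is a primitive
of `v`. Unlike a statement about weak derivatives, this fixes the values of `w` on `[-1, 1]`. -/
structure HasL2Deriv (w v : ℝ → ℝ) : Prop where
  memLp : MemLp v 2 μI
  eq : ∀ x ∈ Icc (-1 : ℝ) 1, w x = w (-1) + ∫ y in (-1)..x, v y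

namespace HasL2Deriv
variable {w v z u : ℝ → ℝ}

lemma intervalIntegrable (h : HasL2Deriv w v) : IntervalIntegrable v volume (-1) 1 :=
  integrable_μI_iff.1 (integrable_of_memLp h.memLp)

lemma intervalIntegrable_sub (h : HasL2Deriv w v) {x y : ℝ} (hx : x ∈ Icc (-1 : ℝ) 1)
    (hy : y ∈ Icc (-1 : ℝ) 1) : IntervalIntegrable v volume x y := by
  refine h.intervalIntegrable.mono_set ?_
  rw [uIcc_of_le (show (-1 : ℝ) ≤ 1 by norm_num)]
  exact uIcc_subset_Icc hx hy

lemma sub_eq (h : HasL2Deriv w v) {x y : ℝ} (hx : x ∈ Icc (-1 : ℝ) 1)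
    (hy : y ∈ Icc (-1 : ℝ) 1) : w y - w x = ∫ s in x..y, v s := by
  have hm : (-1 : ℝ) ∈ Icc (-1 : ℝ) 1 := by simp
  rw [h.eq x hx, h.eq y hy, ← intervalIntegral.integral_interval_sub_left
    (h.intervalIntegrable_sub hm hy) (h.intervalIntegrable_sub hm hx)]
  ring

lemma absolutelyContinuous_primitive (h : HasL2Deriv w v) :
    AbsolutelyContinuousOnInterval (fun x => ∫ y in (-1)..x, v y) (-1) 1 :=
  h.intervalIntegrable.absolutelyContinuousOnInterval_intervalIntegral (by simp)

lemma continuousOn (h : HasL2Deriv w v) : ContinuousOn w (Icc (-1) 1) := by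
  have h1 := h.absolutelyContinuous_primitive.continuousOn
  rw [uIcc_of_le (by norm_num)] at h1
  exact (continuousOn_const.add h1).congr h.eq

lemma memLp_left (h : HasL2Deriv w v) : MemLp w 2 μI := memLp_of_continuousOn h.continuousOn

lemma add (h : HasL2Deriv w v) (h' : HasL2Deriv z u) : HasL2Deriv (w + z) (v + u) := by
  refine ⟨h.memLp.add h'.memLp, fun x hx => ?_⟩
  have hm : (-1 : ℝ) ∈ Icc (-1 : ℝ) 1 := by simp
  simp only [Pi.add_apply]
  rw [intervalIntegral.integral_add (h.intervalIntegrable_sub hm hx)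
    (h'.intervalIntegrable_sub hm hx), h.eq x hx, h'.eq x hx]
  ring

lemma const_smul (c : ℝ) (h : HasL2Deriv w v) : HasL2Deriv (c • w) (c • v) := by
  refine ⟨h.memLp.const_smul c, fun x hx => ?_⟩
  simp only [Pi.smul_apply, smul_eq_mul]
  rw [intervalIntegral.integral_const_mul, h.eq x hx]
  ring

lemma sub (h : HasL2Deriv w v) (h' : HasL2Deriv z u) : HasL2Deriv (w - z) (v - u) := by
  have := h.add (h'.const_smul (-1))
  simpa [sub_eq_add_neg] using this

lemma of_contDiff (h : ContDiff ℝ 1 w) : HasL2Deriv w (deriv w) := by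
  refine ⟨memLp_of_continuousOn (h.continuous_deriv le_rfl).continuousOn, fun x hx => ?_⟩
  rw [intervalIntegral.integral_deriv_eq_sub
    (fun y _ => (h.differentiable one_ne_zero).differentiableAt)
    ((h.continuous_deriv le_rfl).intervalIntegrable _ _)]
  ring

lemma of_polynomial (q : Polynomial ℝ) :
    HasL2Deriv (fun x => q.eval x) (fun x => q.derivative.eval x) := by
  have := of_contDiff (w := fun x => q.eval x) (by simpa using q.contDiff_aeval (𝕜 := ℝ) 1)
  convert this using 1
  ext x; simp

/-- Integration by parts for absolutely continuous functions with square integrable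
derivatives. -/
lemma integral_mul (h : HasL2Deriv w v) (h' : HasL2Deriv z u) :
    ∫ x, w x * u x ∂μI = w 1 * z 1 - w (-1) * z (-1) - ∫ x, v x * z x ∂μI := by
  have key : ∀ {w v : ℝ → ℝ}, HasL2Deriv w v →
      AbsolutelyContinuousOnInterval (fun x => w (-1) + ∫ y in (-1)..x, v y) (-1) 1 ∧
      ∀ᵐ x, x ∈ uIcc (-1 : ℝ) 1 → deriv (fun x => w (-1) + ∫ y in (-1)..x, v y) x = v x := by
    intro w v h
    refine ⟨?_, ?_⟩
    · have h1 : AbsolutelyContinuousOnInterval (fun _ : ℝ => w (-1)) (-1) 1 :=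
        (contDiff_const (n := 1)).contDiffOn.absolutelyContinuousOnInterval
      exact h1.fun_add h.absolutelyContinuous_primitive
    · filter_upwards [h.intervalIntegrable.ae_hasDerivAt_integral] with x hx hx1
      exact ((hx hx1 (-1) (by simp)).const_add _).deriv
  obtain ⟨a1, d1⟩ := key h
  obtain ⟨a2, d2⟩ := key h'
  have h1 := a1.integral_mul_deriv_eq_deriv_mul a2
  rw [integral_μI, integral_μI]
  have hsub : uIoc (-1 : ℝ) 1 ⊆ uIcc (-1) 1 := uIoc_subset_uIcc
  have hI : uIcc (-1 : ℝ) 1 = Icc (-1) 1 := uIcc_of_le (by norm_num)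
  rw [intervalIntegral.integral_congr_ae (g := fun x => w x * u x) (by
      filter_upwards [d2] with x hx hx1
      rw [hx (hsub hx1), ← h.eq x (hI ▸ hsub hx1)]),
    intervalIntegral.integral_congr_ae (f := fun x => deriv _ x * _) (g := fun x => v x * z x) (by
      filter_upwards [d1] with x hx hx1
      rw [hx (hsub hx1), ← h'.eq x (hI ▸ hsub hx1)])] at h1
  rw [← h.eq 1 (by simp), ← h'.eq 1 (by simp)] at h1
  simpa using h1

end HasL2Deriv

/-! ### Legendre polynomials -/

section
open Polynomial

/-- Polynomials as elements of `L²(I)`. -/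
noncomputable def polynomialToLp : ℝ[X] →ₗ[ℝ] Lp ℝ 2 μI where
  toFun q := (memLp_polynomial q).toLp
  map_add' p q := by
    rw [← MemLp.toLp_add]
    exact MemLp.toLp_congr _ _ (by simp [Pi.add_def])
  map_smul' c q := by
    rw [RingHom.id_apply, ← MemLp.toLp_const_smul]
    exact MemLp.toLp_congr _ _ (by simp [Pi.smul_def])

/-- Existence of the `L²(I)`-orthogonal projection onto the polynomials of degree less
than `n`. -/
lemma exists_orthogonal_projection {h : ℝ → ℝ} (hh : MemLp h 2 μI) (n : ℕ) :
    ∃ q : ℝ[X], q.degree < n ∧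
      ∀ z : ℝ[X], z.degree < n → ∫ x, (h x - q.eval x) * z.eval x ∂μI = 0 := by
  let V : Submodule ℝ (Lp ℝ 2 μI) := (degreeLT ℝ n).map polynomialToLp
  have : Module.Finite ℝ (degreeLT ℝ n) := Module.Finite.equiv (degreeLTEquiv ℝ n).symm
  have : FiniteDimensional ℝ V := inferInstance
  obtain ⟨q, hq, hqe⟩ := (V.starProjection_apply_mem (hh.toLp))
  refine ⟨q, mem_degreeLT.1 hq, fun z hz => ?_⟩
  have h1 : inner ℝ (hh.toLp - V.starProjection (hh.toLp)) (polynomialToLp z) = 0 :=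
    V.starProjection_inner_eq_zero _ _ ⟨z, mem_degreeLT.2 hz, rfl⟩
  rw [← hqe, L2.inner_def] at h1
  rw [← h1]
  refine integral_congr_ae ?_
  have e1 : (polynomialToLp q : ℝ → ℝ) =ᵐ[μI] fun x => q.eval x :=
    (memLp_polynomial q).coeFn_toLp
  have e2 : (polynomialToLp z : ℝ → ℝ) =ᵐ[μI] fun x => z.eval x :=
    (memLp_polynomial z).coeFn_toLp
  filter_upwards [e1, e2, hh.coeFn_toLp, Lp.coeFn_sub (hh.toLp) (polynomialToLp q)]
    with x h1 h2 h3 h4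
  rw [h4, h2, Pi.sub_apply, h3, h1]
  simp [mul_comm]

/-- Any polynomial `q₀` of degree less than `n` does no better than the projection `q`. -/
lemma l2Norm_sub_projection_le {h : ℝ → ℝ} (hh : MemLp h 2 μI) {n : ℕ} {q : ℝ[X]}
    (hq : q.degree < n)
    (hor : ∀ z : ℝ[X], z.degree < n → ∫ x, (h x - q.eval x) * z.eval x ∂μI = 0)
    {q₀ : ℝ[X]} (hq₀ : q₀.degree < n) :
    l2Norm (fun x => h x - q.eval x) ≤ l2Norm (fun x => h x - q₀.eval x) := by
  have m1 : MemLp (fun x => h x - q.eval x) 2 μI := hh.sub (memLp_polynomial q)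
  have m2 : MemLp (fun x => h x - q₀.eval x) 2 μI := hh.sub (memLp_polynomial q₀)
  have h1 := hor (q - q₀) ((degree_sub_le _ _).trans_lt (max_lt hq hq₀))
  have h2 := abs_integral_mul_le m1 m2
  have h3 : ∫ x, (h x - q.eval x) * (h x - q₀.eval x) ∂μI
      = l2Norm (fun x => h x - q.eval x) ^ 2 := by
    rw [l2Norm_sq m1, ← sub_eq_zero, ← integral_sub (integrable_mul_of_memLp m1 m2)
      m1.integrable_sq, ← h1]
    refine integral_congr_ae (.of_forall fun x => ?_)
    simp only [eval_sub]; ring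
  rw [h3, abs_of_nonneg (sq_nonneg _)] at h2
  by_contra hlt
  push Not at hlt
  nlinarith [l2Norm_nonneg (fun x => h x - q.eval x), l2Norm_nonneg (fun x => h x - q₀.eval x)]

/-- The inner product of `L²(I)` on polynomials. -/
noncomputable def polyInner (p q : ℝ[X]) : ℝ := ∫ x, (p * q).eval x ∂μI

lemma integrable_polynomial (p : ℝ[X]) : Integrable (fun x => p.eval x) μI :=
  integrable_of_memLp (memLp_polynomial p)

lemma polyInner_comm (p q : ℝ[X]) : polyInner p q = polyInner q p := by
  rw [polyInner, mul_comm]; rfl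

lemma polyInner_add_left (p q z : ℝ[X]) :
    polyInner (p + q) z = polyInner p z + polyInner q z := by
  simp only [polyInner, add_mul, eval_add]
  exact integral_add (integrable_polynomial _) (integrable_polynomial _)

lemma polyInner_C_mul_left (c : ℝ) (p z : ℝ[X]) :
    polyInner (C c * p) z = c * polyInner p z := by
  simp only [polyInner, mul_assoc, eval_C_mul]
  exact integral_const_mul _ _

lemma polyInner_add_right (p q z : ℝ[X]) :
    polyInner z (p + q) = polyInner z p + polyInner z q := by
  simp only [polyInner_comm z, polyInner_add_left]

lemma polyInner_C_mul_right (c : ℝ) (p z : ℝ[X]) :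
    polyInner z (C c * p) = c * polyInner z p := by
  simp only [polyInner_comm z, polyInner_C_mul_left]

lemma polyInner_self_nonneg (p : ℝ[X]) : 0 ≤ polyInner p p :=
  integral_nonneg fun x => by simpa using mul_self_nonneg (p.eval x)

lemma polyInner_self (p : ℝ[X]) : polyInner p p = l2Norm (fun x => p.eval x) ^ 2 := by
  rw [l2Norm_sq (memLp_polynomial p), polyInner]
  simp [sq]

/-- The Dirichlet form of the Legendre operator, `∫_I (1 - x²) p' q'`. -/
noncomputable def legendreForm (p q : ℝ[X]) : ℝ :=
  ∫ x, ((1 - X ^ 2) * (derivative p * derivative q)).eval x ∂μI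

/-- The Legendre operator `q ↦ -((1 - x²) q')'`. -/
noncomputable def legendreOp (q : ℝ[X]) : ℝ[X] := derivative ((X ^ 2 - 1) * derivative q)

lemma legendreForm_comm (p q : ℝ[X]) : legendreForm p q = legendreForm q p := by
  rw [legendreForm, mul_comm (derivative p)]; rfl

lemma legendreForm_add_left (p q z : ℝ[X]) :
    legendreForm (p + q) z = legendreForm p z + legendreForm q z := by
  simp only [legendreForm, derivative_add, add_mul, mul_add, eval_add]
  exact integral_add (integrable_polynomial _) (integrable_polynomial _)

lemma legendreForm_C_mul_left (c : ℝ) (p z : ℝ[X]) :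
    legendreForm (C c * p) z = c * legendreForm p z := by
  simp only [legendreForm, derivative_C_mul, mul_assoc, mul_left_comm _ (C c), eval_C_mul]
  exact integral_const_mul _ _

lemma legendreForm_self_nonneg (p : ℝ[X]) : 0 ≤ legendreForm p p := by
  refine integral_nonneg_of_ae ?_
  filter_upwards [ae_μI_mem] with x hx
  simp only [Pi.zero_apply, eval_mul, eval_sub, eval_one, eval_pow, eval_X]
  have : 0 ≤ 1 - x ^ 2 := by nlinarith [hx.1, hx.2]
  exact mul_nonneg this (mul_self_nonneg _)

lemma legendreForm_self_le (p : ℝ[X]) :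
    legendreForm p p ≤ polyInner (derivative p) (derivative p) := by
  refine integral_mono_ae (integrable_polynomial _) (integrable_polynomial _) ?_
  filter_upwards with x
  simp only [eval_mul, eval_sub, eval_one, eval_pow, eval_X]
  nlinarith [mul_nonneg (sq_nonneg x) (mul_self_nonneg ((derivative p).eval x))]

lemma legendreForm_eq_polyInner (p q : ℝ[X]) :
    legendreForm p q = polyInner p (legendreOp q) := by
  have h := (HasL2Deriv.of_polynomial p).integral_mul
    (HasL2Deriv.of_polynomial ((X ^ 2 - 1) * derivative q))
  rw [polyInner, legendreOp]
  simp only [eval_mul] at h ⊢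
  rw [h, legendreForm]
  simp only [eval_mul, eval_sub, eval_one, eval_pow, eval_X]
  norm_num
  rw [← integral_neg]
  congr 1
  ext x
  ring

lemma coeff_legendreOp (q : ℝ[X]) (k : ℕ) :
    (legendreOp q).coeff k
      = (k : ℝ) * (k + 1) * q.coeff k - (k + 1) * (k + 2) * q.coeff (k + 2) := by
  rw [legendreOp, coeff_derivative, sub_mul, one_mul, coeff_sub, coeff_X_pow_mul',
    coeff_derivative]
  rcases k with _ | k
  · rw [if_neg (by omega), coeff_derivative]
    push_cast
    ring
  · rw [if_pos (by omega), show k + 1 + 1 - 2 = k by omega, coeff_derivative]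
    push_cast
    ring

lemma degree_legendreOp_lt {q : ℝ[X]} {N : ℕ} (hq : q.degree < N) :
    (legendreOp q).degree < N := by
  rw [degree_lt_iff_coeff_zero] at hq ⊢
  intro k hk
  rw [coeff_legendreOp, hq k hk, hq (k + 2) (by omega)]
  ring

/-- The Legendre polynomials, normalized to be monic. -/
lemma exists_legendre (N : ℕ) : ∃ P : ℝ[X], P.coeff N = 1 ∧ P.degree < (N + 1 : ℕ) ∧
    ∀ z : ℝ[X], z.degree < N → polyInner P z = 0 := by
  obtain ⟨q, hq, hor⟩ := exists_orthogonal_projection (memLp_polynomial (X ^ N)) N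
  refine ⟨X ^ N - q, ?_, ?_, fun z hz => ?_⟩
  · rw [coeff_sub, coeff_X_pow_self, degree_lt_iff_coeff_zero _ _ |>.1 hq N le_rfl, sub_zero]
  · refine (degree_sub_le _ _).trans_lt (max_lt ?_ (hq.trans ?_))
    · rw [degree_X_pow]; exact_mod_cast N.lt_succ_self
    · exact_mod_cast N.lt_succ_self
  · rw [← hor z hz, polyInner]
    simp only [eval_mul, eval_sub]

/-- A polynomial orthogonal to all polynomials of degree less than `n` only involves Legendre
polynomials of degree at least `n`, which are eigenfunctions of the Legendre operator for
eigenvalues at least `n (n + 1)`. -/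
lemma mul_polyInner_le_legendreForm (n : ℕ) : ∀ (N : ℕ) (q : ℝ[X]), q.degree < N →
    (∀ z : ℝ[X], z.degree < n → polyInner q z = 0) →
    (n : ℝ) * (n + 1) * polyInner q q ≤ legendreForm q q := by
  intro N
  induction N with
  | zero =>
    intro q hq _
    have : q = 0 := by simpa using hq
    subst this
    simp [polyInner, legendreForm]
  | succ N ih =>
    intro q hq hor
    rcases lt_or_ge N n with hN | hN
    · rw [hor q (hq.trans_le (by exact_mod_cast hN)), mul_zero]
      exact legendreForm_self_nonneg q
    · obtain ⟨P, hP1, hPd, hPo⟩ := exists_legendre N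
      obtain ⟨a, ha⟩ : ∃ a, a = q.coeff N := ⟨_, rfl⟩
      obtain ⟨q₁, hq₁⟩ : ∃ q₁, q₁ = q - C a * P := ⟨_, rfl⟩
      have hqe : q = C a * P + q₁ := by rw [hq₁]; ring
      have hd : q₁.degree < N := by
        rw [degree_lt_iff_coeff_zero] at hq hPd ⊢
        intro k hk
        rw [hq₁, coeff_sub, coeff_C_mul]
        rcases hk.eq_or_lt with rfl | hk
        · rw [hP1, ha]; ring
        · rw [hq k hk, hPd k hk]; ring
      have hor₁ : ∀ z : ℝ[X], z.degree < n → polyInner q₁ z = 0 := by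
        intro z hz
        have h1 := hor z hz
        rw [hqe, polyInner_add_left, polyInner_C_mul_left,
          hPo z (hz.trans_le (by exact_mod_cast hN))] at h1
        linarith
      have hb1 : legendreForm P q₁ = 0 := by
        rw [legendreForm_eq_polyInner, hPo _ (degree_legendreOp_lt hd)]
      have hb2 : legendreForm P P = (N : ℝ) * (N + 1) * polyInner P P := by
        have hlt : (legendreOp P - C ((N : ℝ) * (N + 1)) * P).degree < N := by
          rw [degree_lt_iff_coeff_zero] at hPd ⊢
          intro k hk
          rw [coeff_sub, coeff_C_mul, coeff_legendreOp, hPd (k + 2) (by omega)]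
          rcases hk.eq_or_lt with rfl | hk
          · ring
          · rw [hPd k hk]; ring
        have h1 := hPo _ hlt
        rw [sub_eq_add_neg, ← neg_mul, ← C_neg, polyInner_add_right, polyInner_C_mul_right] at h1
        rw [legendreForm_eq_polyInner]
        linarith
      have e1 : polyInner q q = a ^ 2 * polyInner P P + polyInner q₁ q₁ := by
        rw [hqe]
        simp only [polyInner_add_left, polyInner_add_right, polyInner_C_mul_left,
          polyInner_C_mul_right, polyInner_comm q₁ P, hPo _ hd]
        ring
      have e2 : legendreForm q q = a ^ 2 * legendreForm P P + legendreForm q₁ q₁ := by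
        rw [hqe, legendreForm_add_left, legendreForm_C_mul_left, legendreForm_comm P,
          legendreForm_comm q₁, legendreForm_add_left, legendreForm_add_left,
          legendreForm_C_mul_left, legendreForm_C_mul_left, legendreForm_comm q₁ P, hb1]
        ring
      have h2 := ih q₁ hd hor₁
      rw [e1, e2, hb2]
      have h3 : (n : ℝ) * (n + 1) ≤ (N : ℝ) * (N + 1) := by
        have : (n : ℝ) ≤ N := by exact_mod_cast hN
        gcongr
      have h4 := mul_nonneg (sq_nonneg a) (polyInner_self_nonneg P)
      nlinarith [mul_le_mul_of_nonneg_right h3 h4]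

/-- The Jackson estimate in `L²(I)` for polynomials: the distance of `Z` to the polynomials of
degree less than `n` is at most `‖Z'‖ / n`. -/
lemma mul_l2Norm_sub_projection_le (n : ℕ) (Z q : ℝ[X]) (hq : q.degree < n)
    (hor : ∀ z : ℝ[X], z.degree < n → polyInner (Z - q) z = 0) :
    n * l2Norm (fun x => (Z - q).eval x) ≤ l2Norm (fun x => (derivative Z).eval x) := by
  have h1 := mul_polyInner_le_legendreForm n _ (Z - q)
    (degree_lt_iff_coeff_zero _ _ |>.2 fun k hk => coeff_eq_zero_of_natDegree_lt hk) hor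
  have h2 : legendreForm (Z - q) q = 0 := by
    rw [legendreForm_eq_polyInner, hor _ (degree_legendreOp_lt hq)]
  have h3 : legendreForm Z Z = legendreForm (Z - q) (Z - q) + legendreForm q q := by
    obtain ⟨R, hR⟩ : ∃ R, R = Z - q := ⟨_, rfl⟩
    have hZ : Z = R + q := by rw [hR]; ring
    rw [← hR] at h2 ⊢
    rw [hZ, legendreForm_add_left, legendreForm_comm R, legendreForm_comm q,
      legendreForm_add_left, legendreForm_add_left, legendreForm_comm q R, h2]
    ring
  have h4 := legendreForm_self_nonneg q
  have h5 := legendreForm_self_le Z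
  rw [polyInner_self] at h1 h5
  have h6 : (n * l2Norm (fun x => (Z - q).eval x)) ^ 2
      ≤ l2Norm (fun x => (derivative Z).eval x) ^ 2 := by
    have h7 : (0 : ℝ) ≤ n * l2Norm (fun x => (Z - q).eval x) ^ 2 := by positivity
    nlinarith
  exact abs_le_of_sq_le_sq' h6 (l2Norm_nonneg _) |>.2

end

/-! ### Interpolation of absolutely continuous functions -/

section
open Polynomial

lemma exists_antiderivative (z : ℝ[X]) : ∃ Z : ℝ[X], derivative Z = z := by
  induction z using Polynomial.induction_on' with
  | add p q hp hq =>
    obtain ⟨P, rfl⟩ := hp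
    obtain ⟨Q, rfl⟩ := hq
    exact ⟨P + Q, derivative_add⟩
  | monomial n a =>
    refine ⟨monomial (n + 1) (a / (n + 1)), ?_⟩
    rw [derivative_monomial]
    congr 1
    push_cast
    field_simp

lemma natDegree_le_of_degree_derivative_lt {Z : ℝ[X]} {n : ℕ} (h : (derivative Z).degree < n) :
    Z.natDegree ≤ n := by
  rw [natDegree_le_iff_coeff_eq_zero]
  rw [degree_lt_iff_coeff_zero] at h
  intro k hk
  have h1 := h (k - 1) (by omega)
  rw [coeff_derivative, show k - 1 + 1 = k by omega] at h1
  rcases mul_eq_zero.1 h1 with h2 | h2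
  · exact h2
  · exact absurd h2 (by positivity)

/-- The dual form of the Jackson estimate: if the derivative of `e` is orthogonal to the
polynomials of degree less than `n`, where `n ≥ 1`, and `e (-1) = 0`, then `‖e‖ ≤ ‖e'‖ / n`. -/
lemma HasL2Deriv.mul_l2Norm_le {e v : ℝ → ℝ} (h : HasL2Deriv e v) (h0 : e (-1) = 0) {n : ℕ}
    (hn : 1 ≤ n) (hor : ∀ z : ℝ[X], z.degree < n → ∫ x, v x * z.eval x ∂μI = 0) :
    n * l2Norm e ≤ l2Norm v := by
  have h1 : e 1 = 0 := by
    have h2 := h.eq 1 (by simp)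
    have h3 := hor 1 (by rw [degree_one]; exact_mod_cast hn)
    rw [integral_μI] at h3
    rw [h2, h0]
    simpa using h3
  have hn' : (0 : ℝ) < n := by exact_mod_cast hn
  -- testing against polynomials
  have key : ∀ z : ℝ[X], n * |∫ x, e x * z.eval x ∂μI| ≤ l2Norm v * l2Norm (fun x => z.eval x) := by
    intro z
    obtain ⟨Z, rfl⟩ := exists_antiderivative z
    obtain ⟨q, hq, hqo⟩ := exists_orthogonal_projection (memLp_polynomial Z) n
    have j1 := mul_l2Norm_sub_projection_le n Z q hq (by
      intro w hw
      rw [← hqo w hw, polyInner]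
      simp only [eval_mul, eval_sub])
    have j2 := h.integral_mul (HasL2Deriv.of_polynomial Z)
    rw [h0, h1, zero_mul, zero_mul, sub_zero, zero_sub] at j2
    have j3 : ∫ x, v x * Z.eval x ∂μI = ∫ x, v x * (Z - q).eval x ∂μI := by
      rw [← sub_eq_zero, ← integral_sub (integrable_mul_of_memLp h.memLp (memLp_polynomial Z))
        (integrable_mul_of_memLp h.memLp (memLp_polynomial (Z - q))), ← hor q hq]
      congr 1
      ext x
      rw [eval_sub]; ring
    rw [j2, abs_neg, j3]
    calc n * |∫ x, v x * (Z - q).eval x ∂μI|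
        ≤ n * (l2Norm v * l2Norm (fun x => (Z - q).eval x)) := by
          gcongr; exact abs_integral_mul_le h.memLp (memLp_polynomial _)
      _ = l2Norm v * (n * l2Norm (fun x => (Z - q).eval x)) := by ring
      _ ≤ _ := by gcongr; exact l2Norm_nonneg v
  -- by density, `e` itself may be used as a test function
  have hm := h.memLp_left
  have key2 : ∀ ε > 0, n * l2Norm e ^ 2 ≤ l2Norm v * (l2Norm e + 2 * ε)
      + n * (l2Norm e * (2 * ε)) := by
    intro ε hε
    obtain ⟨z, hz⟩ := exists_polynomial_near_of_continuousOn (-1) 1 e h.continuousOn ε hε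
    have m1 : MemLp (fun x => z.eval x - e x) 2 μI := (memLp_polynomial z).sub hm
    have hd : l2Norm (fun x => z.eval x - e x) ≤ 2 * ε :=
      l2Norm_le_of_bound hε.le fun x hx => (hz x (Ioo_subset_Icc_self hx)).le
    have j1 : l2Norm e ^ 2 = ∫ x, e x * z.eval x ∂μI - ∫ x, e x * (z.eval x - e x) ∂μI := by
      rw [l2Norm_sq hm, ← integral_sub (integrable_mul_of_memLp hm (memLp_polynomial z))
        (integrable_mul_of_memLp hm m1)]
      congr 1
      ext x; ring
    have j2 : l2Norm (fun x => z.eval x) ≤ l2Norm e + 2 * ε := by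
      have := l2Norm_add_le hm m1
      have e1 : e + (fun x => z.eval x - e x) = fun x => z.eval x := by
        ext x; simp
      rw [e1] at this
      linarith
    have j3 := abs_integral_mul_le hm m1
    have j4 := key z
    have j5 : l2Norm e ^ 2 ≤ |∫ x, e x * z.eval x ∂μI| + l2Norm e * (2 * ε) := by
      have a1 := le_abs_self (∫ x, e x * z.eval x ∂μI)
      have a2 := neg_abs_le (∫ x, e x * (z.eval x - e x) ∂μI)
      have a3 := mul_le_mul_of_nonneg_left hd (l2Norm_nonneg e)
      linarith
    have j6 := mul_le_mul_of_nonneg_left j5 hn'.le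
    have j7 := mul_le_mul_of_nonneg_left j2 (l2Norm_nonneg v)
    linarith
  have key3 : n * l2Norm e ^ 2 ≤ l2Norm v * l2Norm e := by
    refine le_of_forall_pos_le_add fun δ hδ => ?_
    have hv := l2Norm_nonneg v
    have he := l2Norm_nonneg e
    have hc : 0 < 2 * (l2Norm v + n * l2Norm e) + 1 := by positivity
    have := key2 (δ / (2 * (l2Norm v + n * l2Norm e) + 1)) (by positivity)
    have h5 : δ / (2 * (l2Norm v + n * l2Norm e) + 1) * (2 * (l2Norm v + n * l2Norm e)) ≤ δ := by
      rw [div_mul_eq_mul_div, div_le_iff₀ hc]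
      nlinarith
    linarith
  rcases (l2Norm_nonneg e).eq_or_lt with h6 | h6
  · rw [← h6, mul_zero]; exact l2Norm_nonneg v
  · nlinarith

/-- Integrating the projection of the derivative onto the polynomials of degree less than `n`
gives an interpolant of degree at most `n`, which at the endpoints agrees with the function, and
which is nearly optimal both in `L²` and in `H¹`. -/
lemma HasL2Deriv.exists_interpolant {w v : ℝ → ℝ} (h : HasL2Deriv w v) {n : ℕ} (hn : 1 ≤ n) :
    ∃ q : ℝ[X], q.natDegree ≤ n ∧ q.eval (-1) = w (-1) ∧ q.eval 1 = w 1 ∧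
      (derivative q).degree < n ∧
      (∀ q₀ : ℝ[X], q₀.degree < n →
        l2Norm (fun x => v x - (derivative q).eval x) ≤ l2Norm (fun x => v x - q₀.eval x)) ∧
      n * l2Norm (fun x => w x - q.eval x) ≤ l2Norm (fun x => v x - (derivative q).eval x) := by
  obtain ⟨d, hd, hor⟩ := exists_orthogonal_projection h.memLp n
  obtain ⟨Q, hQ⟩ := exists_antiderivative d
  have hder : derivative (Q + C (w (-1) - Q.eval (-1))) = d := by simp [hQ]
  have hP := h.sub (HasL2Deriv.of_polynomial (Q + C (w (-1) - Q.eval (-1))))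
  rw [hder] at hP
  have h0 : w (-1) - (Q + C (w (-1) - Q.eval (-1))).eval (-1) = 0 := by simp
  have hor1 := hor 1 (by rw [degree_one]; exact_mod_cast hn)
  refine ⟨Q + C (w (-1) - Q.eval (-1)), natDegree_le_of_degree_derivative_lt (hder ▸ hd), by simp, ?_,
    hder ▸ hd, fun q₀ hq₀ => hder ▸ l2Norm_sub_projection_le h.memLp hd hor hq₀, ?_⟩
  · have h2 := hP.eq 1 (by simp)
    rw [integral_μI] at hor1
    simp only [Pi.sub_apply] at h2
    rw [h0] at h2
    simp only [eval_one, mul_one] at hor1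
    rw [hor1] at h2
    linarith
  · rw [hder]
    exact hP.mul_l2Norm_le h0 hn hor

end

/-! ### Test functions and the lemma of du Bois-Reymond -/

namespace IsTestFunction
variable {φ ψ : ℝ → ℝ}

lemma apply_eq_zero (h : IsTestFunction φ) {x : ℝ} (hx : x ∉ Ioo (-1 : ℝ) 1) : φ x = 0 :=
  image_eq_zero_of_notMem_tsupport fun hx' => hx (h.2.2 hx')

lemma contDiff_deriv (h : IsTestFunction φ) : ContDiff ℝ ∞ (deriv φ) :=
  (contDiff_infty_iff_deriv.1 h.1).2

lemma deriv (h : IsTestFunction φ) : IsTestFunction (deriv φ) :=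
  ⟨h.contDiff_deriv, h.2.1.deriv, (tsupport_deriv_subset).trans h.2.2⟩

lemma hasL2Deriv (h : IsTestFunction φ) : HasL2Deriv φ (_root_.deriv φ) :=
  HasL2Deriv.of_contDiff (h.1.of_le (by exact_mod_cast le_top))

lemma memLp (h : IsTestFunction φ) : MemLp φ 2 μI := h.hasL2Deriv.memLp_left

lemma add (h : IsTestFunction φ) (h' : IsTestFunction ψ) : IsTestFunction (φ + ψ) :=
  ⟨h.1.add h'.1, h.2.1.add h'.2.1, (tsupport_add φ ψ).trans (union_subset h.2.2 h'.2.2)⟩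

lemma const_smul (h : IsTestFunction φ) (c : ℝ) : IsTestFunction (c • φ) := by
  refine ⟨h.1.const_smul c, h.2.1.smul_left (f := fun _ => c), ?_⟩
  refine (closure_mono ?_).trans h.2.2
  exact Function.support_const_smul_subset c φ

lemma zero : IsTestFunction (0 : ℝ → ℝ) :=
  ⟨contDiff_const, HasCompactSupport.zero, by simp⟩

/-- The support stays away from the endpoints. -/
lemma exists_radius (h : IsTestFunction φ) :
    ∃ a ∈ Ioo (0 : ℝ) 1, ∀ x, φ x ≠ 0 → x ∈ Icc (-a) a := by
  rcases (tsupport φ).eq_empty_or_nonempty with h0 | h0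
  · refine ⟨1 / 2, by norm_num, fun x hx => ?_⟩
    have := subset_tsupport φ hx
    simp [h0] at this
  · obtain ⟨y, hy, hmax⟩ := h.2.1.isCompact.exists_isMaxOn h0 (f := fun x => |x|)
      continuous_abs.continuousOn
    have hy1 : |y| < 1 := abs_lt.2 (h.2.2 hy)
    refine ⟨(|y| + 1) / 2, ⟨by positivity, by linarith⟩, fun x hx => ?_⟩
    have h2 : |x| ≤ |y| := hmax (subset_tsupport φ hx)
    exact abs_le.1 (by linarith)

/-- A test function of mean zero has a primitive which is a test function. -/
lemma exists_primitive (h : IsTestFunction ψ) (h0 : ∫ x, ψ x ∂μI = 0) :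
    ∃ φ, IsTestFunction φ ∧ _root_.deriv φ = ψ := by
  obtain ⟨a, ⟨ha0, ha1⟩, hs⟩ := h.exists_radius
  have hc := h.1.continuous
  have hd : ∀ x, HasDerivAt (fun x => ∫ y in (-1)..x, ψ y) (ψ x) x := fun x =>
    intervalIntegral.integral_hasDerivAt_right (hc.intervalIntegrable _ _)
      (hc.stronglyMeasurableAtFilter _ _) hc.continuousAt
  have hder : _root_.deriv (fun x => ∫ y in (-1)..x, ψ y) = ψ := funext fun x => (hd x).deriv
  have hz : ∀ x, x ∉ Icc (-a) a → ψ x = 0 := fun x hx => by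
    by_contra h1
    exact hx (hs x h1)
  have hsupp : Function.support (fun x => ∫ y in (-1)..x, ψ y) ⊆ Icc (-a) a := by
    intro x hx
    by_contra hxa
    apply hx
    rw [mem_Icc, not_and_or, not_le, not_le] at hxa
    rcases hxa with h1 | h1
    · refine (intervalIntegral.integral_congr (g := fun _ => 0) fun y hy => ?_).trans (by simp)
      refine hz y fun hy' => ?_
      have := hy.2
      have h3 : max (-1) x < -a := max_lt (by linarith) h1
      linarith [hy'.1]
    · have h2 : ∫ y in (1 : ℝ)..x, ψ y = 0 := by
        refine (intervalIntegral.integral_congr (g := fun _ => 0) fun y hy => ?_).trans (by simp)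
        refine hz y fun hy' => ?_
        have := hy.1
        have h3 : a < min 1 x := lt_min (by linarith) h1
        linarith [hy'.2]
      simp only
      rw [integral_μI] at h0
      rw [← intervalIntegral.integral_add_adjacent_intervals (hc.intervalIntegrable _ _)
        (hc.intervalIntegrable 1 x), h0, h2, add_zero]
  have hts : tsupport (fun x => ∫ y in (-1)..x, ψ y) ⊆ Icc (-a) a :=
    closure_minimal hsupp isClosed_Icc
  refine ⟨fun x => ∫ y in (-1)..x, ψ y, ⟨?_, ?_, ?_⟩, hder⟩
  · rw [contDiff_infty_iff_deriv, hder]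
    exact ⟨fun x => (hd x).differentiableAt, h.1⟩
  · exact isCompact_Icc.of_isClosed_subset (isClosed_tsupport _) hts
  · exact hts.trans (Icc_subset_Ioo (by linarith) ha1)

end IsTestFunction

lemma exists_testFunction_integral_eq_one : ∃ ρ, IsTestFunction ρ ∧ ∫ x, ρ x ∂μI = 1 := by
  let b : ContDiffBump (0 : ℝ) := ⟨1 / 4, 1 / 2, by norm_num, by norm_num⟩
  have ht : IsTestFunction (b.normed volume) := by
    refine ⟨b.contDiff_normed, b.hasCompactSupport_normed, ?_⟩
    rw [b.tsupport_normed_eq, Real.closedBall_eq_Icc]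
    exact Icc_subset_Ioo (by norm_num [b]) (by norm_num [b])
  refine ⟨b.normed volume, ht, ?_⟩
  rw [← b.integral_normed (μ := volume)]
  exact setIntegral_eq_integral_of_forall_compl_eq_zero fun x hx => ht.apply_eq_zero hx

/-- The fundamental lemma of the calculus of variations on `I`. -/
lemma ae_eq_zero_of_forall_testFunction {z : ℝ → ℝ} (hz : LocallyIntegrableOn z I volume)
    (h : ∀ φ, IsTestFunction φ → ∫ x, z x * φ x ∂μI = 0) : z =ᵐ[μI] 0 := by
  refine (ae_restrict_iff' measurableSet_I).2 ?_
  refine IsOpen.ae_eq_zero_of_integral_contDiff_smul_eq_zero isOpen_Ioo hz fun g h1 h2 h3 => ?_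
  have ht : IsTestFunction g := ⟨h1, h2, h3⟩
  rw [← h g ht]
  simp only [smul_eq_mul, mul_comm (g _)]
  exact (setIntegral_eq_integral_of_forall_compl_eq_zero fun x hx => by
    rw [ht.apply_eq_zero hx, mul_zero]).symm

/-- The lemma of du Bois-Reymond: a function whose weak derivative vanishes is constant. -/
lemma exists_ae_eq_const {z : ℝ → ℝ} (hz : MemLp z 2 μI)
    (h : ∀ φ, IsTestFunction φ → ∫ x, z x * deriv φ x ∂μI = 0) :
    ∃ c : ℝ, z =ᵐ[μI] fun _ => c := by
  obtain ⟨ρ, hρ, hρ1⟩ := exists_testFunction_integral_eq_one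
  refine ⟨∫ x, z x * ρ x ∂μI, ?_⟩
  set c := ∫ x, z x * ρ x ∂μI with hc
  have hzc : MemLp (z - fun _ => c) 2 μI := hz.sub (memLp_const c)
  have h1 : z - (fun _ => c) =ᵐ[μI] 0 := by
    refine ae_eq_zero_of_forall_testFunction
      (IntegrableOn.locallyIntegrableOn (integrable_of_memLp hzc)) fun ψ hψ => ?_
    have i1 := integrable_of_memLp hψ.memLp
    have i2 := integrable_of_memLp hρ.memLp
    obtain ⟨φ, hφ, hφd⟩ := (hψ.add (hρ.const_smul (-∫ x, ψ x ∂μI))).exists_primitive (by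
      simp only [Pi.add_apply, Pi.smul_apply, smul_eq_mul]
      rw [integral_add i1 (i2.const_mul _), integral_const_mul, hρ1]
      ring)
    have h2 := h φ hφ
    rw [hφd] at h2
    have e1 : (fun x => z x * (ψ + (-∫ x, ψ x ∂μI) • ρ) x)
        = fun x => z x * ψ x + (-∫ x, ψ x ∂μI) * (z x * ρ x) := by
      ext x; simp only [Pi.add_apply, Pi.smul_apply, smul_eq_mul]; ring
    rw [e1, integral_add (integrable_mul_of_memLp hz hψ.memLp)
      ((integrable_mul_of_memLp hz hρ.memLp).const_mul _), integral_const_mul, ← hc] at h2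
    have e2 : (fun x => (z - (fun _ => c : ℝ → ℝ)) x * ψ x) = fun x => z x * ψ x - c * ψ x := by
      ext x; simp only [Pi.sub_apply]; ring
    rw [e2, integral_sub (integrable_mul_of_memLp hz hψ.memLp) (i1.const_mul _),
      integral_const_mul]
    linarith
  filter_upwards [h1] with x hx
  simpa [sub_eq_zero] using hx

/-- The derivatives of test functions are dense in the functions of mean zero in `L²(I)`. -/
lemma exists_testFunction_deriv_near {v : ℝ → ℝ} (hv : MemLp v 2 μI) (h0 : ∫ x, v x ∂μI = 0)
    {ε : ℝ} (hε : 0 < ε) : ∃ φ, IsTestFunction φ ∧ l2Norm (v - deriv φ) < ε := by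
  let K : Submodule ℝ (Lp ℝ 2 μI) :=
    { carrier := {g | ∃ φ, IsTestFunction φ ∧ g =ᵐ[μI] deriv φ}
      zero_mem' := ⟨0, IsTestFunction.zero, by
        rw [deriv_zero]; exact Lp.coeFn_zero ℝ 2 μI⟩
      add_mem' := by
        rintro a b ⟨φ, hφ, ha⟩ ⟨ψ, hψ, hb⟩
        refine ⟨φ + ψ, hφ.add hψ, ?_⟩
        filter_upwards [ha, hb, Lp.coeFn_add a b] with x h1 h2 h3
        rw [h3, Pi.add_apply, h1, h2, deriv_add (hφ.1.differentiable (by simp) x)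
          (hψ.1.differentiable (by simp) x)]
      smul_mem' := by
        rintro c a ⟨φ, hφ, ha⟩
        refine ⟨c • φ, hφ.const_smul c, ?_⟩
        filter_upwards [ha, Lp.coeFn_smul c a] with x h1 h2
        rw [h2, Pi.smul_apply, h1, deriv_const_smul c (hφ.1.differentiable (by simp) x)] }
  have hmem : hv.toLp ∈ Kᗮᗮ := by
    intro y hy
    obtain ⟨c, hc⟩ := exists_ae_eq_const (Lp.memLp y) fun φ hφ => by
      have h1 := hy (hφ.deriv.memLp.toLp) ⟨φ, hφ, hφ.deriv.memLp.coeFn_toLp⟩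
      rw [L2.inner_def] at h1
      rw [← h1]
      refine integral_congr_ae ?_
      filter_upwards [hφ.deriv.memLp.coeFn_toLp] with x hx
      rw [hx]; simp
    rw [L2.inner_def]
    have : ∫ x, c * v x ∂μI = 0 := by rw [integral_const_mul, h0, mul_zero]
    rw [← this]
    refine integral_congr_ae ?_
    filter_upwards [hv.coeFn_toLp, hc] with x h1 h2
    rw [h1, h2]; simp [mul_comm]
  rw [Submodule.orthogonal_orthogonal_eq_closure] at hmem
  obtain ⟨g, ⟨φ, hφ, hg⟩, hd⟩ := Metric.mem_closure_iff.1 hmem ε hε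
  refine ⟨φ, hφ, ?_⟩
  have e : g = hφ.deriv.memLp.toLp := Lp.ext (hg.trans hφ.deriv.memLp.coeFn_toLp.symm)
  rwa [e, dist_eq_norm, ← MemLp.toLp_sub, Lp.norm_toLp] at hd

/-! ### Weak derivatives -/

lemma HasWeakDeriv.unique {k : ℕ} {u v v' : ℝ → ℝ} (h : HasWeakDeriv k u v)
    (h' : HasWeakDeriv k u v') : v =ᵐ[μI] v' := by
  have hz : v - v' =ᵐ[μI] 0 := by
    refine ae_eq_zero_of_forall_testFunction (h.2.1.sub h'.2.1) fun φ hφ => ?_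
    have hint : ∀ {w}, LocallyIntegrableOn w I volume → Integrable (fun x => w x * φ x) μI := by
      intro w hw
      have h1 : IntegrableOn w (tsupport φ) :=
        hw.integrableOn_compact_subset hφ.2.2 hφ.2.1.isCompact
      obtain ⟨M, hM⟩ := hφ.2.1.exists_bound_of_continuous hφ.1.continuous
      have h2 : IntegrableOn (fun x => φ x * w x) (tsupport φ) :=
        Integrable.bdd_mul h1 hφ.1.continuous.aestronglyMeasurable (.of_forall hM)
      have h3 : IntegrableOn (fun x => φ x * w x) univ :=
        h2.of_forall_sdiff_eq_zero MeasurableSet.univ fun x hx => by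
          rw [image_eq_zero_of_notMem_tsupport hx.2, zero_mul]
      have h4 := h3.mono_set (subset_univ I)
      simp only [mul_comm (φ _)] at h4
      exact h4
    have h1 := h.2.2 φ hφ
    have h2 := h'.2.2 φ hφ
    rw [h1] at h2
    have h3 : ∫ x, v x * φ x ∂μI = ∫ x, v' x * φ x ∂μI :=
      mul_left_cancel₀ (pow_ne_zero k (by norm_num : (-1 : ℝ) ≠ 0)) h2
    have e : (fun x => (v - v') x * φ x) = fun x => v x * φ x - v' x * φ x := by
      ext x; simp only [Pi.sub_apply]; ring
    rw [e, integral_sub (hint h.2.1) (hint h'.2.1), h3, sub_self]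
  filter_upwards [hz] with x hx
  simpa [sub_eq_zero] using hx

lemma hasWeakDeriv_zero {u : ℝ → ℝ} (hu : LocallyIntegrableOn u I volume) :
    HasWeakDeriv 0 u u := ⟨hu, hu, fun φ _ => by simp⟩

/-- If `v` and `w` are consecutive weak derivatives of one function and both are square
integrable, then `v` has a representative which is a primitive of `w`. -/
lemma HasWeakDeriv.exists_hasL2Deriv {k : ℕ} {u v w : ℝ → ℝ} (h : HasWeakDeriv k u v)
    (h' : HasWeakDeriv (k + 1) u w) (hv : MemLp v 2 μI) (hw : MemLp w 2 μI) :
    ∃ g, v =ᵐ[μI] g ∧ HasL2Deriv g w := by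
  have hW : HasL2Deriv (fun x => ∫ y in (-1)..x, w y) w := ⟨hw, fun x hx => by simp⟩
  obtain ⟨c, hc⟩ := exists_ae_eq_const (hv.sub hW.memLp_left) fun φ hφ => by
    have h1 := h.2.2 _ hφ.deriv
    have h2 := h'.2.2 φ hφ
    rw [iteratedDeriv_succ', h1, pow_succ, mul_assoc] at h2
    have h3 := mul_left_cancel₀ (pow_ne_zero k (by norm_num : (-1 : ℝ) ≠ 0)) h2
    have h4 := hW.integral_mul hφ.hasL2Deriv
    rw [hφ.apply_eq_zero (by simp), hφ.apply_eq_zero (by simp)] at h4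
    have e : (fun x => (v - fun x => ∫ y in (-1)..x, w y) x * deriv φ x)
        = fun x => v x * deriv φ x - (∫ y in (-1)..x, w y) * deriv φ x := by
      ext x; simp only [Pi.sub_apply]; ring
    rw [e, integral_sub (integrable_mul_of_memLp hv hφ.deriv.memLp)
      (integrable_mul_of_memLp hW.memLp_left hφ.deriv.memLp), h4]
    change ∫ x, v x * deriv φ x ∂μI = _ at h3
    rw [h3]
    change -1 * ∫ x, w x * φ x ∂μI - _ = 0
    ring
  refine ⟨fun x => c + ∫ y in (-1)..x, w y, ?_, hw, fun x hx => by simp⟩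
  filter_upwards [hc] with x hx
  simp only [Pi.sub_apply] at hx
  linarith

/-! ### Estimates for lower integrals -/

lemma sq_lintegral_mul_le {α : Type*} [MeasurableSpace α] (μ : Measure α) {f g : α → ℝ≥0∞}
    (hf : AEMeasurable f μ) (hg : AEMeasurable g μ) :
    (∫⁻ x, f x * g x ∂μ) ^ 2 ≤ (∫⁻ x, f x ^ 2 ∂μ) * ∫⁻ x, g x ^ 2 ∂μ := by
  have h := ENNReal.lintegral_mul_le_Lp_mul_Lq μ Real.HolderConjugate.two_two hf hg
  simp only [Pi.mul_apply, ENNReal.rpow_ofNat] at h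
  calc (∫⁻ x, f x * g x ∂μ) ^ 2
      ≤ ((∫⁻ x, f x ^ 2 ∂μ) ^ (1 / 2 : ℝ) * (∫⁻ x, g x ^ 2 ∂μ) ^ (1 / 2 : ℝ)) ^ 2 := by gcongr
    _ = _ := by
      rw [mul_pow, ← ENNReal.rpow_natCast, ← ENNReal.rpow_natCast, ← ENNReal.rpow_mul,
        ← ENNReal.rpow_mul]
      norm_num

lemma sq_setLIntegral_le {f : ℝ → ℝ≥0∞} (s : Set ℝ) (hf : AEMeasurable f (volume.restrict s)) :
    (∫⁻ x in s, f x) ^ 2 ≤ volume s * ∫⁻ x in s, f x ^ 2 := by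
  have h := sq_lintegral_mul_le (volume.restrict s) (f := fun _ => 1) aemeasurable_const hf
  simpa using h

lemma lintegral_comp_abs_eq (F : ℝ → ℝ≥0∞) :
    ∫⁻ z : ℝ, F |z| = 2 * ∫⁻ z in Ioi (0 : ℝ), F z := by
  have h1 : ∫⁻ z in Ioi (0 : ℝ), F |z| = ∫⁻ z in Ioi (0 : ℝ), F z :=
    setLIntegral_congr_fun measurableSet_Ioi fun z hz => by rw [abs_of_pos hz]
  have h2 : ∫⁻ z in Iic (0 : ℝ), F |z| = ∫⁻ z in Ioi (0 : ℝ), F z := by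
    rw [setLIntegral_congr Iio_ae_eq_Iic.symm, ← h1, ← lintegral_indicator measurableSet_Iio,
      ← lintegral_indicator measurableSet_Ioi, ← lintegral_neg_eq_self]
    congr 1
    ext z
    by_cases hz : 0 < z
    · rw [indicator_of_mem (by simpa using hz), indicator_of_mem (by simpa using hz), abs_neg]
    · rw [indicator_of_notMem (by simpa using hz), indicator_of_notMem (by simpa using hz)]
  rw [← lintegral_add_compl (fun z => F |z|) measurableSet_Ioi, compl_Ioi, h1, h2, two_mul]

/-- Young's inequality for an integral operator with kernel `m (x - y)`. -/
lemma lintegral_lintegral_mul_sub_le {s : Set ℝ} {F m : ℝ → ℝ≥0∞}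
    (hF : AEMeasurable F (volume.restrict s)) (hm : Measurable m) :
    ∫⁻ x in s, ∫⁻ y in s, F x * m (x - y) ≤ (∫⁻ z, m z) * ∫⁻ x in s, F x := by
  rw [← lintegral_const_mul'' _ hF]
  refine lintegral_mono fun x => ?_
  have h1 : ∫⁻ y in s, m (x - y) ≤ ∫⁻ z, m z :=
    (setLIntegral_le_lintegral _ _).trans_eq (lintegral_sub_left_eq_self m x)
  rw [lintegral_const_mul _ (by fun_prop), mul_comm]
  gcongr

lemma lintegral_lintegral_mul_sub_le' {s : Set ℝ} {F m : ℝ → ℝ≥0∞}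
    (hF : AEMeasurable F (volume.restrict s)) (hm : Measurable m) :
    ∫⁻ x in s, ∫⁻ y in s, F y * m (x - y) ≤ (∫⁻ z, m z) * ∫⁻ x in s, F x := by
  rw [lintegral_lintegral_swap]
  · have := lintegral_lintegral_mul_sub_le hF (hm.comp measurable_neg)
    simp only [Function.comp_def, neg_sub] at this
    rwa [lintegral_neg_eq_self] at this
  · exact (hF.comp_snd).mul (hm.comp (measurable_fst.sub measurable_snd)).aemeasurable

/-- The kernel `|z|^(-t)`, cut off at distance `h`. -/
noncomputable def nearKernel (h t z : ℝ) : ℝ≥0∞ :=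
  if |z| < h then ENNReal.ofReal |z| ^ (-t) else 0

/-- The kernel `|z|^(-(1 + 2 t))`, away from the diagonal. -/
noncomputable def farKernel (h t z : ℝ) : ℝ≥0∞ :=
  if h ≤ |z| then ENNReal.ofReal (|z| ^ (-(1 + 2 * t))) else 0

lemma measurable_nearKernel (h t : ℝ) : Measurable (nearKernel h t) :=
  Measurable.ite (measurableSet_lt (by fun_prop) (by fun_prop)) (by fun_prop) (by fun_prop)

lemma measurable_farKernel (h t : ℝ) : Measurable (farKernel h t) :=
  Measurable.ite (measurableSet_le (by fun_prop) (by fun_prop)) (by fun_prop) (by fun_prop)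

lemma setLIntegral_Ioo_rpow {h a : ℝ} (hh : 0 < h) (ha : -1 < a) :
    ∫⁻ z in Ioo 0 h, ENNReal.ofReal (z ^ a) = ENNReal.ofReal (h ^ (a + 1) / (a + 1)) := by
  have hint : IntegrableOn (fun z : ℝ => z ^ a) (Ioo 0 h) :=
    (intervalIntegrable_iff_integrableOn_Ioo_of_le hh.le).1
      (intervalIntegral.intervalIntegrable_rpow' ha)
  rw [← ofReal_integral_eq_lintegral_ofReal hint, ← integral_Ioc_eq_integral_Ioo,
    ← intervalIntegral.integral_of_le hh.le, integral_rpow (.inl ha), Real.zero_rpow (by linarith),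
    sub_zero]
  filter_upwards [ae_restrict_mem measurableSet_Ioo] with z hz
  exact Real.rpow_nonneg hz.1.le a

lemma setLIntegral_Ioi_rpow {h a : ℝ} (hh : 0 < h) (ha : a < -1) :
    ∫⁻ z in Ioi h, ENNReal.ofReal (z ^ a) = ENNReal.ofReal (-h ^ (a + 1) / (a + 1)) := by
  rw [← ofReal_integral_eq_lintegral_ofReal (integrableOn_Ioi_rpow_of_lt ha hh),
    integral_Ioi_rpow_of_lt ha hh]
  filter_upwards [ae_restrict_mem measurableSet_Ioi] with z hz
  exact Real.rpow_nonneg (hh.trans hz).le a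

lemma lintegral_nearKernel {h t : ℝ} (hh : 0 < h) (ht : t < 1) :
    ∫⁻ z, nearKernel h t z = ENNReal.ofReal (2 * (h ^ (1 - t) / (1 - t))) := by
  have h1 := lintegral_comp_abs_eq (fun a => if a < h then ENNReal.ofReal a ^ (-t) else 0)
  unfold nearKernel
  rw [h1, ENNReal.ofReal_mul (by norm_num), ENNReal.ofReal_ofNat,
    show 1 - t = -t + 1 by ring, ← setLIntegral_Ioo_rpow hh (by linarith),
    ← lintegral_indicator measurableSet_Ioi, ← lintegral_indicator measurableSet_Ioo]
  congr 2
  ext z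
  by_cases h0 : 0 < z
  · by_cases h2 : z < h
    · rw [indicator_of_mem (show z ∈ Ioi (0 : ℝ) from h0),
        indicator_of_mem (show z ∈ Ioo 0 h from ⟨h0, h2⟩), if_pos h2, ENNReal.ofReal_rpow_of_pos h0]
    · rw [indicator_of_mem (show z ∈ Ioi (0 : ℝ) from h0),
        indicator_of_notMem (fun hz : z ∈ Ioo 0 h => h2 hz.2), if_neg h2]
  · rw [indicator_of_notMem (show z ∉ Ioi (0 : ℝ) from h0),
      indicator_of_notMem (fun hz : z ∈ Ioo 0 h => h0 hz.1)]

lemma lintegral_farKernel {h t : ℝ} (hh : 0 < h) (ht : 0 < t) :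
    ∫⁻ z, farKernel h t z = ENNReal.ofReal (h ^ (-2 * t) / t) := by
  have h1 := lintegral_comp_abs_eq
    (fun a => if h ≤ a then ENNReal.ofReal (a ^ (-(1 + 2 * t))) else 0)
  unfold farKernel
  have e : h ^ (-2 * t) / t = 2 * (-h ^ (-(1 + 2 * t) + 1) / (-(1 + 2 * t) + 1)) := by
    rw [show -(1 + 2 * t) + 1 = -2 * t by ring]
    field_simp
  rw [h1, e, ENNReal.ofReal_mul (by norm_num), ENNReal.ofReal_ofNat,
    ← setLIntegral_Ioi_rpow hh (by linarith), setLIntegral_congr (Ioi_ae_eq_Ici (a := h)),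
    ← lintegral_indicator measurableSet_Ioi, ← lintegral_indicator measurableSet_Ici]
  congr 2
  ext z
  by_cases h2 : h ≤ z
  · rw [indicator_of_mem (show z ∈ Ioi 0 from hh.trans_le h2),
      indicator_of_mem (show z ∈ Ici h from h2), if_pos h2]
  · rw [indicator_of_notMem (show z ∉ Ici h from h2)]
    by_cases h0 : 0 < z
    · rw [indicator_of_mem (show z ∈ Ioi (0 : ℝ) from h0), if_neg h2]
    · rw [indicator_of_notMem (show z ∉ Ioi (0 : ℝ) from h0)]

/-! ### The Slobodeckij seminorm of an absolutely continuous function -/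

lemma eLpNorm_two_sq (f : ℝ → ℝ) {μ : Measure ℝ} : eLpNorm f 2 μ ^ 2 = ∫⁻ x, ‖f x‖ₑ ^ 2 ∂μ := by
  rw [eLpNorm_eq_lintegral_rpow_enorm_toReal (by norm_num) (by norm_num), ← ENNReal.rpow_natCast,
    ← ENNReal.rpow_mul]
  simp

lemma HasL2Deriv.enorm_sub_sq_le {w v : ℝ → ℝ} (hw : HasL2Deriv w v) {x y : ℝ}
    (hx' : x ∈ Icc (-1 : ℝ) 1) (hy' : y ∈ Icc (-1 : ℝ) 1) :
    ‖w x - w y‖ₑ ^ 2 ≤ ENNReal.ofReal |x - y| * ∫⁻ s in uIoc x y, ‖v s‖ₑ ^ 2 := by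
  have hint := hw.intervalIntegrable_sub hy' hx'
  rw [hw.sub_eq hy' hx', ← enorm_norm, intervalIntegral.norm_integral_eq_norm_integral_uIoc,
    enorm_norm, uIoc_comm]
  calc ‖∫ s in uIoc x y, v s‖ₑ ^ 2 ≤ (∫⁻ s in uIoc x y, ‖v s‖ₑ) ^ 2 := by
        gcongr; exact enorm_integral_le_lintegral_enorm _
    _ ≤ volume (uIoc x y) * ∫⁻ s in uIoc x y, ‖v s‖ₑ ^ 2 := by
        refine sq_setLIntegral_le _ ?_
        rw [uIoc_comm]
        exact hint.def'.aestronglyMeasurable.enorm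
    _ = _ := by
        rw [uIoc, Real.volume_Ioc, max_sub_min_eq_abs, abs_sub_comm]

/-- Pointwise bound of the Slobodeckij integrand, from the two sides of `|x - y| < h`. Near the
diagonal, `|x - y|^(-2t) ≤ |x - s|^(-t) |y - s|^(-t)` for `s` between `x` and `y` separates the
variables. -/
lemma HasL2Deriv.gagliardo_integrand_le {w v : ℝ → ℝ} (hw : HasL2Deriv w v) {h t : ℝ}
    (ht : 0 < t) {x y : ℝ} (hx : x ∈ I) (hy : y ∈ I) :
    ‖w x - w y‖ₑ ^ 2 / ENNReal.ofReal (|x - y| ^ (1 + 2 * t)) ≤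
      (2 * ‖w x‖ₑ ^ 2 * farKernel h t (x - y) + 2 * ‖w y‖ₑ ^ 2 * farKernel h t (x - y)) +
        ∫⁻ s in I, ‖v s‖ₑ ^ 2 * (nearKernel h t (x - s) * nearKernel h t (y - s)) := by
  rcases eq_or_ne x y with rfl | hne
  · simp
  have hpos : 0 < |x - y| := abs_pos.2 (sub_ne_zero.2 hne)
  rcases le_or_gt h |x - y| with hh | hh
  · refine le_add_right ?_
    rw [farKernel, if_pos hh, ← add_mul, ENNReal.div_eq_inv_mul, mul_comm,
      Real.rpow_neg hpos.le, ENNReal.ofReal_inv_of_pos (by positivity)]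
    gcongr
    calc ‖w x - w y‖ₑ ^ 2 ≤ (‖w x‖ₑ + ‖w y‖ₑ) ^ 2 := by gcongr; exact enorm_sub_le
      _ ≤ 2 * ‖w x‖ₑ ^ 2 + 2 * ‖w y‖ₑ ^ 2 := by
        have := ENNReal.rpow_add_le_mul_rpow_add_rpow ‖w x‖ₑ ‖w y‖ₑ (one_le_two (α := ℝ))
        rw [← mul_add]
        norm_num at this
        exact this
  · refine le_add_left ?_
    have hA : ENNReal.ofReal |x - y| ≠ 0 := by simpa using hpos
    have hsub : uIoc x y ⊆ I := fun s hs => by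
      have := uIoc_subset_uIcc hs
      exact (convex_Ioo (-1 : ℝ) 1).ordConnected.uIcc_subset hx hy this
    calc ‖w x - w y‖ₑ ^ 2 / ENNReal.ofReal (|x - y| ^ (1 + 2 * t))
        ≤ (ENNReal.ofReal |x - y| * ∫⁻ s in uIoc x y, ‖v s‖ₑ ^ 2)
            / ENNReal.ofReal (|x - y| ^ (1 + 2 * t)) := by
          gcongr; exact hw.enorm_sub_sq_le (Ioo_subset_Icc_self hx) (Ioo_subset_Icc_self hy)
      _ = ∫⁻ s in uIoc x y, ‖v s‖ₑ ^ 2 * ENNReal.ofReal |x - y| ^ (-2 * t) := by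
          rw [lintegral_mul_const' _ _ (by
            rw [ENNReal.ofReal_rpow_of_pos hpos]; exact ENNReal.ofReal_ne_top),
            ENNReal.div_eq_inv_mul, ← mul_assoc, mul_comm (∫⁻ s in _, _)]
          congr 1
          rw [← ENNReal.ofReal_inv_of_pos (by positivity), ← Real.rpow_neg hpos.le,
            ENNReal.ofReal_rpow_of_pos hpos, ← ENNReal.ofReal_mul (by positivity)]
          congr 1
          nth_rewrite 2 [← Real.rpow_one |x - y|]
          rw [← Real.rpow_add hpos]
          congr 1
          ring
      _ ≤ ∫⁻ s in uIoc x y, ‖v s‖ₑ ^ 2 * (nearKernel h t (x - s) * nearKernel h t (y - s)) := by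
          refine setLIntegral_mono' measurableSet_uIoc fun s hs => ?_
          have hs' := uIoc_subset_uIcc hs
          have h1 : |x - s| ≤ |x - y| := by
            rw [abs_sub_comm x s, abs_sub_comm x y]; exact abs_sub_left_of_mem_uIcc hs'
          have h2 : |y - s| ≤ |x - y| := by
            rw [abs_sub_comm x y]; exact abs_sub_right_of_mem_uIcc hs'
          rw [nearKernel, nearKernel, if_pos (h1.trans_lt hh), if_pos (h2.trans_lt hh)]
          gcongr
          rw [show -2 * t = -t + -t by ring, ENNReal.rpow_add _ _ hA ENNReal.ofReal_ne_top]
          simp only [ENNReal.rpow_neg]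
          gcongr
      _ ≤ _ := lintegral_mono_set hsub

/-- The Slobodeckij seminorm at any scale `h` is controlled by the `L²` norms of the function
and of its derivative. -/
lemma HasL2Deriv.gagliardoSq_le {w v : ℝ → ℝ} (hw : HasL2Deriv w v) {h t : ℝ} (hh : 0 < h)
    (ht : 0 < t) (ht1 : t < 1) :
    gagliardoSq t w ≤ ENNReal.ofReal (4 * (h ^ (-2 * t) / t)) * eLpNorm w 2 μI ^ 2 +
      ENNReal.ofReal ((2 * (h ^ (1 - t) / (1 - t))) ^ 2) * eLpNorm v 2 μI ^ 2 := by
  have mw : AEMeasurable (fun x => 2 * ‖w x‖ₑ ^ 2) (volume.restrict I) :=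
    (hw.memLp_left.1.enorm.pow_const 2).const_mul 2
  have mv : AEMeasurable (fun x => ‖v x‖ₑ ^ 2) (volume.restrict I) :=
    hw.memLp.1.enorm.pow_const 2
  have mf := measurable_farKernel h t
  have mn := measurable_nearKernel h t
  have A1 := lintegral_lintegral_mul_sub_le mw mf
  have A2 := lintegral_lintegral_mul_sub_le' mw mf
  have A3 : ∫⁻ x in I, ∫⁻ y in I, ∫⁻ s in I,
        ‖v s‖ₑ ^ 2 * (nearKernel h t (x - s) * nearKernel h t (y - s)) ≤
      (∫⁻ z, nearKernel h t z) ^ 2 * ∫⁻ s in I, ‖v s‖ₑ ^ 2 := by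
    have B1 : ∀ x, ∫⁻ y in I, ∫⁻ s in I,
        ‖v s‖ₑ ^ 2 * (nearKernel h t (x - s) * nearKernel h t (y - s)) ≤
        ∫⁻ s in I, (∫⁻ z, nearKernel h t z) * ‖v s‖ₑ ^ 2 * nearKernel h t (x - s) := by
      intro x
      rw [lintegral_lintegral_swap]
      · refine lintegral_mono fun s => ?_
        have h1 : ∫⁻ y in I, nearKernel h t (y - s) ≤ ∫⁻ z, nearKernel h t z :=
          (setLIntegral_le_lintegral _ _).trans_eq (lintegral_sub_right_eq_self _ s)
        simp only [← mul_assoc]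
        rw [lintegral_const_mul _ (by fun_prop), mul_comm, ← mul_assoc]
        gcongr
      · exact mv.comp_snd.mul ((mn.comp (measurable_const.sub measurable_snd)).mul
          (mn.comp (measurable_fst.sub measurable_snd))).aemeasurable
    refine (lintegral_mono B1).trans ?_
    have := lintegral_lintegral_mul_sub_le' (s := I) (F := fun s =>
      (∫⁻ z, nearKernel h t z) * ‖v s‖ₑ ^ 2) (mv.const_mul _) mn
    rwa [lintegral_const_mul'' _ mv, ← mul_assoc, ← sq] at this
  calc gagliardoSq t w
      ≤ ∫⁻ x in I, ∫⁻ y in I, ((2 * ‖w x‖ₑ ^ 2 * farKernel h t (x - y) +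
          2 * ‖w y‖ₑ ^ 2 * farKernel h t (x - y)) +
        ∫⁻ s in I, ‖v s‖ₑ ^ 2 * (nearKernel h t (x - s) * nearKernel h t (y - s))) :=
        setLIntegral_mono' measurableSet_I fun x hx =>
          setLIntegral_mono' measurableSet_I fun y hy => hw.gagliardo_integrand_le ht hx hy
    _ = (∫⁻ x in I, ∫⁻ y in I, 2 * ‖w x‖ₑ ^ 2 * farKernel h t (x - y)) +
        (∫⁻ x in I, ∫⁻ y in I, 2 * ‖w y‖ₑ ^ 2 * farKernel h t (x - y)) +
        ∫⁻ x in I, ∫⁻ y in I, ∫⁻ s in I,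
          ‖v s‖ₑ ^ 2 * (nearKernel h t (x - s) * nearKernel h t (y - s)) := by
        have m1 : AEMeasurable (Function.uncurry fun x y => 2 * ‖w x‖ₑ ^ 2 * farKernel h t (x - y))
            ((volume.restrict I).prod (volume.restrict I)) :=
          mw.comp_fst.mul (mf.comp (measurable_fst.sub measurable_snd)).aemeasurable
        have m2 : AEMeasurable (Function.uncurry fun x y => 2 * ‖w y‖ₑ ^ 2 * farKernel h t (x - y))
            ((volume.restrict I).prod (volume.restrict I)) :=
          mw.comp_snd.mul (mf.comp (measurable_fst.sub measurable_snd)).aemeasurable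
        have m1' : ∀ x, AEMeasurable (fun y => 2 * ‖w x‖ₑ ^ 2 * farKernel h t (x - y))
            (volume.restrict I) := fun x => by fun_prop
        have m2' : ∀ x, AEMeasurable (fun y => 2 * ‖w y‖ₑ ^ 2 * farKernel h t (x - y))
            (volume.restrict I) := fun x => mw.mul (by fun_prop)
        rw [← lintegral_add_left' (by exact m1.lintegral_prod_right'),
          ← lintegral_add_left' (by
            exact (m1.lintegral_prod_right').add (m2.lintegral_prod_right'))]
        refine lintegral_congr fun x => ?_
        rw [← lintegral_add_left' (m1' x)]
        exact lintegral_add_left' ((m1' x).add (m2' x)) _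
    _ ≤ (∫⁻ z, farKernel h t z) * (∫⁻ x in I, 2 * ‖w x‖ₑ ^ 2) +
        (∫⁻ z, farKernel h t z) * (∫⁻ x in I, 2 * ‖w x‖ₑ ^ 2) +
        (∫⁻ z, nearKernel h t z) ^ 2 * ∫⁻ s in I, ‖v s‖ₑ ^ 2 := by gcongr
    _ = _ := by
        have e1 : ∫⁻ x in I, 2 * ‖w x‖ₑ ^ 2 = 2 * ∫⁻ x in I, ‖w x‖ₑ ^ 2 :=
          lintegral_const_mul'' _ (hw.memLp_left.1.enorm.pow_const 2)
        rw [e1, lintegral_nearKernel hh ht1,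
          lintegral_farKernel hh ht, eLpNorm_two_sq, eLpNorm_two_sq,
          ENNReal.ofReal_mul (p := 4) (by norm_num),
          ENNReal.ofReal_pow (by have := sub_pos.2 ht1; positivity),
          ENNReal.ofReal_mul (p := 2) (by norm_num)]
        simp only [μI, ENNReal.ofReal_ofNat]
        ring

/-! ### Norms in `H^t` and membership in `H^t_0` -/

/-- A norm equivalent to that of `H^t(I)`, `t ≤ 1`, for a function `w` with derivative `v`. -/
noncomputable def energyNorm (t : ℝ) (w v : ℝ → ℝ) : ℝ≥0∞ :=
  eLpNorm w 2 μI + if t = 1 then eLpNorm v 2 μI else gagliardoSq t w ^ (1 / 2 : ℝ)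

lemma HasL2Deriv.hasWeakDeriv_zero {w v : ℝ → ℝ} (hw : HasL2Deriv w v) : HasWeakDeriv 0 w w :=
  PApprox.hasWeakDeriv_zero (IntegrableOn.locallyIntegrableOn (integrable_of_memLp hw.memLp_left))

lemma HasL2Deriv.hasWeakDeriv_one {w v : ℝ → ℝ} (hw : HasL2Deriv w v) : HasWeakDeriv 1 w v := by
  refine ⟨IntegrableOn.locallyIntegrableOn (integrable_of_memLp hw.memLp_left),
    IntegrableOn.locallyIntegrableOn (integrable_of_memLp hw.memLp), fun φ hφ => ?_⟩
  have h := hw.integral_mul hφ.hasL2Deriv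
  rw [hφ.apply_eq_zero (by simp), hφ.apply_eq_zero (by simp)] at h
  rw [iteratedDeriv_one, pow_one, neg_one_mul]
  change ∫ x, w x * deriv φ x ∂μI = -∫ x, v x * φ x ∂μI
  simpa using h

lemma sq_add_sq_rpow_half_le (a b : ℝ≥0∞) : (a ^ 2 + b) ^ (1 / 2 : ℝ) ≤ a + b ^ (1 / 2 : ℝ) := by
  refine (ENNReal.rpow_add_le_add_rpow _ _ (by norm_num) (by norm_num)).trans_eq ?_
  rw [← ENNReal.rpow_natCast, ← ENNReal.rpow_mul]
  norm_num

lemma sobolevNorm_le_energyNorm {w v : ℝ → ℝ} (hw : HasL2Deriv w v) {t : ℝ} (ht : 0 < t)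
    (ht1 : t ≤ 1) : sobolevNorm t w ≤ energyNorm t w v := by
  rcases ht1.eq_or_lt with rfl | ht1
  · refine (iInf₂_le (fun k => if k = 0 then w else v) ?_).trans ?_
    · intro k hk
      simp only [Nat.floor_one] at hk
      interval_cases k
      · simpa using hw.hasWeakDeriv_zero
      · simpa using hw.hasWeakDeriv_one
    · simp only [Nat.floor_one, Finset.sum_range_succ, Finset.sum_range_zero, Int.fract_one]
      simp only [if_true, one_ne_zero, if_false, zero_add, add_zero, energyNorm]
      refine (sq_add_sq_rpow_half_le _ _).trans_eq ?_
      rw [← ENNReal.rpow_natCast, ← ENNReal.rpow_mul]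
      norm_num
  · have hfl : ⌊t⌋₊ = 0 := Nat.floor_eq_zero.2 ht1
    have hfr : Int.fract t = t := Int.fract_eq_self.2 ⟨ht.le, ht1⟩
    refine (iInf₂_le (fun _ => w) ?_).trans ?_
    · intro k hk
      rw [hfl] at hk
      interval_cases k
      exact hw.hasWeakDeriv_zero
    · simp only [hfl, hfr, Finset.sum_range_succ, Finset.sum_range_zero, zero_add, energyNorm,
        if_neg ht.ne', if_neg ht1.ne]
      exact sq_add_sq_rpow_half_le _ _

/-- The Slobodeckij seminorm is an `L²` norm on the square, which yields the triangle
inequality. -/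
lemma gagliardoSq_rpow_half {w : ℝ → ℝ} (hw : AEStronglyMeasurable w μI) (t : ℝ) :
    gagliardoSq t w ^ (1 / 2 : ℝ) =
      eLpNorm (fun z : ℝ × ℝ => (w z.1 - w z.2) * |z.1 - z.2| ^ (-(1 / 2 + t))) 2
        (μI.prod μI) := by
  have m1 : Measurable fun z : ℝ × ℝ => |z.1 - z.2| ^ (-(1 / 2 + t)) := by fun_prop
  have hm : AEStronglyMeasurable
      (fun z : ℝ × ℝ => (w z.1 - w z.2) * |z.1 - z.2| ^ (-(1 / 2 + t))) (μI.prod μI) :=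
    (hw.comp_fst.sub hw.comp_snd).mul m1.aestronglyMeasurable
  rw [eLpNorm_eq_lintegral_rpow_enorm_toReal (by norm_num) (by norm_num)]
  simp only [ENNReal.toReal_ofNat, ENNReal.rpow_ofNat]
  rw [lintegral_prod _ (hm.enorm.pow_const 2)]
  congr 1
  refine lintegral_congr fun x => lintegral_congr fun y => ?_
  rcases eq_or_ne x y with rfl | hne
  · simp
  have hpos : 0 < |x - y| := abs_pos.2 (sub_ne_zero.2 hne)
  have e : ‖|x - y| ^ (-(1 / 2 + t))‖ₑ ^ 2 = ENNReal.ofReal (|x - y| ^ (-(1 + 2 * t))) := by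
    rw [Real.enorm_of_nonneg (by positivity), ← ENNReal.ofReal_pow (by positivity),
      ← Real.rpow_natCast, ← Real.rpow_mul hpos.le]
    congr 2
    push_cast
    ring
  rw [enorm_mul, mul_pow, e, ENNReal.div_eq_inv_mul, mul_comm,
    ← ENNReal.ofReal_inv_of_pos (by positivity), ← Real.rpow_neg hpos.le]

lemma energyNorm_add_le {t : ℝ} {w v w' v' : ℝ → ℝ} (h : HasL2Deriv w v)
    (h' : HasL2Deriv w' v') :
    energyNorm t (w + w') (v + v') ≤ energyNorm t w v + energyNorm t w' v' := by
  have h1 := eLpNorm_add_le h.memLp_left.1 h'.memLp_left.1 (p := 2) (by norm_num)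
  have h2 := eLpNorm_add_le h.memLp.1 h'.memLp.1 (p := 2) (by norm_num)
  unfold energyNorm
  split_ifs
  · calc _ ≤ _ := add_le_add h1 h2
      _ = _ := by ring
  · have m0 : Measurable fun z : ℝ × ℝ => |z.1 - z.2| ^ (-(1 / 2 + t)) := by fun_prop
    have hm : ∀ {u : ℝ → ℝ}, AEStronglyMeasurable u μI → AEStronglyMeasurable
        (fun z : ℝ × ℝ => (u z.1 - u z.2) * |z.1 - z.2| ^ (-(1 / 2 + t))) (μI.prod μI) :=
      fun hu => (hu.comp_fst.sub hu.comp_snd).mul m0.aestronglyMeasurable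
    have h3 := eLpNorm_add_le (hm h.memLp_left.1) (hm h'.memLp_left.1) (p := 2) (by norm_num)
    rw [gagliardoSq_rpow_half h.memLp_left.1, gagliardoSq_rpow_half h'.memLp_left.1,
      gagliardoSq_rpow_half (h.memLp_left.1.add h'.memLp_left.1)]
    have e : (fun z : ℝ × ℝ => ((w + w') z.1 - (w + w') z.2) * |z.1 - z.2| ^ (-(1 / 2 + t)))
        = (fun z : ℝ × ℝ => (w z.1 - w z.2) * |z.1 - z.2| ^ (-(1 / 2 + t))) +
          fun z : ℝ × ℝ => (w' z.1 - w' z.2) * |z.1 - z.2| ^ (-(1 / 2 + t)) := by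
      ext z; simp only [Pi.add_apply]; ring
    rw [e]
    calc _ ≤ _ := add_le_add h1 h3
      _ = _ := by ring

/-- At every scale `h ≤ 1`, the norm of `H^t` is at most of the order of
`h^(-t) ‖w‖ + h^(1-t) ‖w'‖`. -/
lemma exists_energyNorm_le {t : ℝ} (ht : 0 < t) (ht1 : t ≤ 1) :
    ∃ A : ℝ, 0 < A ∧ ∀ (w v : ℝ → ℝ), HasL2Deriv w v → ∀ h : ℝ, 0 < h → h ≤ 1 →
      energyNorm t w v ≤
        ENNReal.ofReal (A * (h ^ (-t) * l2Norm w + h ^ (1 - t) * l2Norm v)) := by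
  rcases ht1.eq_or_lt with rfl | ht1
  · refine ⟨1, one_pos, fun w v hw h hh hh1 => ?_⟩
    have h1 : 1 ≤ h ^ (-1 : ℝ) := Real.one_le_rpow_of_pos_of_le_one_of_nonpos hh hh1 (by norm_num)
    have h2 := l2Norm_nonneg w
    have h3 := l2Norm_nonneg v
    rw [energyNorm, if_pos rfl, ← ofReal_l2Norm hw.memLp_left, ← ofReal_l2Norm hw.memLp,
      ← ENNReal.ofReal_add h2 h3]
    refine ENNReal.ofReal_le_ofReal ?_
    simp only [sub_self, Real.rpow_zero]
    nlinarith
  · have ht' : 0 < 1 - t := by linarith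
    refine ⟨1 + √(4 / t) + 2 / (1 - t), by positivity, fun w v hw h hh hh1 => ?_⟩
    have h2 := l2Norm_nonneg w
    have h3 := l2Norm_nonneg v
    have hg := hw.gagliardoSq_le hh ht ht1
    have h1 : 1 ≤ h ^ (-t) := Real.one_le_rpow_of_pos_of_le_one_of_nonpos hh hh1 (by linarith)
    have h1' : 0 < h ^ (1 - t) := by positivity
    have hs : gagliardoSq t w ^ (1 / 2 : ℝ) ≤ ENNReal.ofReal
        (√(4 / t) * (h ^ (-t) * l2Norm w) + 2 / (1 - t) * (h ^ (1 - t) * l2Norm v)) := by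
      have key : gagliardoSq t w ≤ ENNReal.ofReal
          (√(4 / t) * (h ^ (-t) * l2Norm w) + 2 / (1 - t) * (h ^ (1 - t) * l2Norm v)) ^ 2 := by
        refine hg.trans ?_
        rw [← ofReal_l2Norm hw.memLp_left, ← ofReal_l2Norm hw.memLp, ← ENNReal.ofReal_pow h2,
          ← ENNReal.ofReal_pow h3, ← ENNReal.ofReal_mul (by positivity),
          ← ENNReal.ofReal_mul (by positivity), ← ENNReal.ofReal_add (by positivity)
            (by positivity), ← ENNReal.ofReal_pow (by positivity)]
        refine ENNReal.ofReal_le_ofReal ?_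
        have e1 : h ^ (-2 * t) = (h ^ (-t)) ^ 2 := by
          rw [← Real.rpow_natCast, ← Real.rpow_mul hh.le]; congr 1; push_cast; ring
        have e2 : √(4 / t) ^ 2 = 4 / t := Real.sq_sqrt (by positivity)
        have e3 : 4 * (h ^ (-2 * t) / t) * l2Norm w ^ 2 =
            (√(4 / t) * (h ^ (-t) * l2Norm w)) ^ 2 := by
          rw [mul_pow, e2, e1]; ring
        have e4 : (2 * (h ^ (1 - t) / (1 - t))) ^ 2 * l2Norm v ^ 2
            = (2 / (1 - t) * (h ^ (1 - t) * l2Norm v)) ^ 2 := by ring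
        rw [e3, e4, add_sq]
        have : 0 ≤ 2 * (√(4 / t) * (h ^ (-t) * l2Norm w)) *
          (2 / (1 - t) * (h ^ (1 - t) * l2Norm v)) := by positivity
        linarith
      calc gagliardoSq t w ^ (1 / 2 : ℝ) ≤ _ := ENNReal.rpow_le_rpow key (by norm_num)
        _ = _ := by rw [← ENNReal.rpow_natCast, ← ENNReal.rpow_mul]; norm_num
    rw [energyNorm, if_neg ht1.ne]
    calc _ ≤ ENNReal.ofReal (l2Norm w) + ENNReal.ofReal
            (√(4 / t) * (h ^ (-t) * l2Norm w) + 2 / (1 - t) * (h ^ (1 - t) * l2Norm v)) := by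
          rw [ofReal_l2Norm hw.memLp_left]; gcongr
      _ = ENNReal.ofReal (l2Norm w + (√(4 / t) * (h ^ (-t) * l2Norm w)
          + 2 / (1 - t) * (h ^ (1 - t) * l2Norm v))) := by
          rw [← ENNReal.ofReal_add h2 (by positivity)]
      _ ≤ _ := by
          refine ENNReal.ofReal_le_ofReal ?_
          have a1 : l2Norm w ≤ h ^ (-t) * l2Norm w := le_mul_of_one_le_left h2 h1
          have a2 : 0 ≤ h ^ (-t) * l2Norm w := by positivity
          have a3 : 0 ≤ h ^ (1 - t) * l2Norm v := by positivity
          have a4 : 0 ≤ √(4 / t) * (h ^ (1 - t) * l2Norm v) := by positivity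
          have a5 : 0 ≤ 2 / (1 - t) * (h ^ (-t) * l2Norm w) := by positivity
          linarith

/-- An absolutely continuous function with square integrable derivative which vanishes at the
endpoints belongs to `H^t_0(I)`. -/
lemma HasL2Deriv.memSobolevZero {w v : ℝ → ℝ} (hw : HasL2Deriv w v) (h0 : w (-1) = 0)
    (h1 : w 1 = 0) {t : ℝ} (ht : 0 < t) (ht1 : t ≤ 1) : MemSobolevZero t w := by
  obtain ⟨A, hA, hN⟩ := exists_energyNorm_le ht ht1
  refine ⟨?_, fun ε hε => ?_⟩
  · refine ((sobolevNorm_le_energyNorm hw ht ht1).trans (hN w v hw 1 one_pos le_rfl)).trans_lt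
      ENNReal.ofReal_lt_top
  · have hv0 : ∫ x, v x ∂μI = 0 := by
      have := hw.eq 1 (by simp)
      rw [integral_μI]
      linarith
    obtain ⟨δ, hδ, hδε⟩ : ∃ δ : ℝ, 0 < δ ∧ ENNReal.ofReal δ < ε := by
      rcases eq_or_ne ε ⊤ with rfl | hε'
      · exact ⟨1, one_pos, by simp⟩
      · have hp := ENNReal.toReal_pos hε.ne' hε'
        refine ⟨ε.toReal / 2, by positivity, ?_⟩
        rw [ENNReal.ofReal_lt_iff_lt_toReal (by positivity) hε']
        linarith
    obtain ⟨φ, hφ, hn⟩ := exists_testFunction_deriv_near hw.memLp hv0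
      (show 0 < δ / (2 * A) by positivity)
    refine ⟨φ, hφ, lt_of_le_of_lt ?_ hδε⟩
    have hd := hw.sub hφ.hasL2Deriv
    refine ((sobolevNorm_le_energyNorm hd ht ht1).trans (hN _ _ hd 1 one_pos le_rfl)).trans ?_
    refine ENNReal.ofReal_le_ofReal ?_
    -- the Poincaré inequality
    have hP := hd.mul_l2Norm_le (by simp [h0, hφ.apply_eq_zero]) le_rfl (by
      intro z hz
      have hz0 : z.natDegree = 0 := by
        by_contra hne
        have := Polynomial.degree_eq_natDegree (p := z) (by rintro rfl; simp at hne)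
        rw [this] at hz
        have : z.natDegree < 1 := by exact_mod_cast hz
        omega
      rw [Polynomial.eq_C_of_natDegree_eq_zero hz0]
      simp only [Polynomial.eval_C]
      have h2 := hd.eq 1 (by simp)
      rw [integral_mul_const, integral_μI]
      simp only [Pi.sub_apply, h0, h1, hφ.apply_eq_zero (x := 1) (by simp),
        hφ.apply_eq_zero (x := -1) (by simp)] at h2
      simp only [Pi.sub_apply]
      rw [show ∫ x in (-1 : ℝ)..1, (v x - deriv φ x) = 0 by linarith, zero_mul])
    rw [Nat.cast_one, one_mul] at hP
    rw [Real.one_rpow, Real.one_rpow, one_mul, one_mul]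
    calc A * (l2Norm (w - φ) + l2Norm (v - deriv φ)) ≤ A * (δ / (2 * A) + δ / (2 * A)) := by
          gcongr
          exact hP.trans hn.le
      _ = δ := by field_simp; ring

/-- The splitting `u = (u - w) + w` in the K-functional. -/
lemma kFunctional_le {t τ : ℝ} (ht : 0 < t) (ht1 : t ≤ 1) {u w v : ℝ → ℝ}
    (hu : MemLp u 2 μI) (hw : HasL2Deriv w v) (h0 : w (-1) = 0) (h1 : w 1 = 0) :
    kFunctional t τ u ≤ eLpNorm (u - w) 2 μI + ENNReal.ofReal τ * energyNorm t w v := by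
  refine le_trans (b := eLpNorm (u - w) 2 μI + ENNReal.ofReal τ * sobolevNorm t w) ?_ ?_
  · exact iInf_le_of_le (u - w) (iInf_le_of_le w (iInf_le_of_le (hu.sub hw.memLp_left)
      (iInf_le_of_le (hw.memSobolevZero h0 h1 ht ht1)
        (iInf_le_of_le (by simp) le_rfl))))
  · gcongr
    exact sobolevNorm_le_energyNorm hw ht ht1

lemma kFunctional_le_eLpNorm {t τ : ℝ} (ht : 0 < t) (ht1 : t ≤ 1) {u : ℝ → ℝ}
    (hu : MemLp u 2 μI) : kFunctional t τ u ≤ eLpNorm u 2 μI := by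
  have h0 : HasL2Deriv 0 0 := by
    have := HasL2Deriv.of_polynomial 0
    simpa [Pi.zero_def] using this
  have h2 := exists_energyNorm_le ht ht1
  obtain ⟨A, hA, hN⟩ := h2
  have h3 := hN 0 0 h0 1 one_pos le_rfl
  have h4 : l2Norm (0 : ℝ → ℝ) = 0 := by simp [l2Norm]
  rw [h4] at h3
  simp only [mul_zero, add_zero, ENNReal.ofReal_zero, nonpos_iff_eq_zero] at h3
  have := kFunctional_le (τ := τ) ht ht1 hu h0 rfl rfl
  simpa [h3] using this

/-! ### The interpolation norm -/

/-- The interpolation norm, from a bound of the K-functional which is constant for `τ ≥ 1 / P` and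
for smaller `τ` decays faster than `τ^(1/(2t))`. -/
lemma tildeNorm_le {t θ B P : ℝ} (ht : 0 < t) (hθ : 1 / (2 * t) < θ) (hB : 0 ≤ B) (hP : 0 < P)
    {u : ℝ → ℝ} (h1 : ∀ τ, 0 < τ → kFunctional t τ u ≤ ENNReal.ofReal B)
    (h2 : ∀ τ, 0 < τ → τ * P < 1 →
      kFunctional t τ u ≤ ENNReal.ofReal (B * (τ * P) ^ θ)) :
    tildeNorm t (1 / 2) u ≤
      ENNReal.ofReal (√(1 / (2 * θ - 1 / t) + t) * (B * P ^ (1 / (2 * t)))) := by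
  have hθ' : 0 < 2 * θ - 1 / t := by
    have : 1 / (2 * t) = 1 / t / 2 := by field_simp
    rw [this] at hθ
    linarith
  have ht' : 0 < 1 / t := by positivity
  have hP' : 0 < P⁻¹ := inv_pos.2 hP
  have hw : ∀ τ : ℝ, 0 < τ → (ENNReal.ofReal (τ ^ (-(1 / 2 / t)))) ^ 2 * ENNReal.ofReal τ⁻¹
      = ENNReal.ofReal (τ ^ (-(1 / t) - 1)) := by
    intro τ hτ
    rw [← ENNReal.ofReal_pow (by positivity), ← ENNReal.ofReal_mul (by positivity),
      ← Real.rpow_natCast, ← Real.rpow_mul hτ.le, ← Real.rpow_neg_one, ← Real.rpow_add hτ]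
    congr 2
    push_cast
    field_simp
    ring
  have e1 : ∫⁻ τ in Ioo 0 P⁻¹,
      (ENNReal.ofReal (τ ^ (-(1 / 2 / t))) * kFunctional t τ u) ^ 2 * ENNReal.ofReal τ⁻¹
      ≤ ENNReal.ofReal (B ^ 2 * P ^ (1 / t) * (1 / (2 * θ - 1 / t))) := by
    calc _ ≤ ∫⁻ τ in Ioo 0 P⁻¹, ENNReal.ofReal (B ^ 2 * P ^ (2 * θ)) *
          ENNReal.ofReal (τ ^ (2 * θ - 1 / t - 1)) := by
          refine setLIntegral_mono' measurableSet_Ioo fun τ hτ => ?_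
          have hτ0 := hτ.1
          have hτP : τ * P < 1 := by
            have := mul_lt_mul_of_pos_right hτ.2 hP
            rwa [inv_mul_cancel₀ hP.ne'] at this
          calc _ ≤ (ENNReal.ofReal (τ ^ (-(1 / 2 / t))) *
                ENNReal.ofReal (B * (τ * P) ^ θ)) ^ 2 * ENNReal.ofReal τ⁻¹ := by
                gcongr; exact h2 τ hτ0 hτP
            _ = ENNReal.ofReal (B * (τ * P) ^ θ) ^ 2 * ENNReal.ofReal (τ ^ (-(1 / t) - 1)) := by
                rw [← hw τ hτ0]; ring
            _ = _ := by
                rw [← ENNReal.ofReal_pow (by positivity), ← ENNReal.ofReal_mul (by positivity),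
                  ← ENNReal.ofReal_mul (by positivity)]
                congr 1
                rw [mul_pow, ← Real.rpow_natCast ((τ * P) ^ θ), ← Real.rpow_mul (by positivity),
                  Real.mul_rpow hτ0.le hP.le,
                  show 2 * θ - 1 / t - 1 = 2 * θ + (-(1 / t) - 1) by ring,
                  Real.rpow_add hτ0, Nat.cast_ofNat, mul_comm θ 2]
                ring
      _ = _ := by
          rw [lintegral_const_mul' _ _ ENNReal.ofReal_ne_top,
            setLIntegral_Ioo_rpow hP' (by linarith),
            ← ENNReal.ofReal_mul (by positivity)]
          congr 1
          rw [show 2 * θ - 1 / t - 1 + 1 = 2 * θ - 1 / t by ring, Real.inv_rpow hP.le,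
            ← Real.rpow_neg hP.le, show 1 / t = 2 * θ + -(2 * θ - 1 / t) by ring, Real.rpow_add hP]
          ring_nf
  have e2 : ∫⁻ τ in Ici P⁻¹,
      (ENNReal.ofReal (τ ^ (-(1 / 2 / t))) * kFunctional t τ u) ^ 2 * ENNReal.ofReal τ⁻¹
      ≤ ENNReal.ofReal (B ^ 2 * P ^ (1 / t) * t) := by
    calc _ ≤ ∫⁻ τ in Ici P⁻¹, ENNReal.ofReal (B ^ 2) * ENNReal.ofReal (τ ^ (-(1 / t) - 1)) := by
          refine setLIntegral_mono' measurableSet_Ici fun τ hτ => ?_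
          have hτ0 : 0 < τ := hP'.trans_le hτ
          calc _ ≤ (ENNReal.ofReal (τ ^ (-(1 / 2 / t))) * ENNReal.ofReal B) ^ 2 *
                ENNReal.ofReal τ⁻¹ := by gcongr; exact h1 τ hτ0
            _ = ENNReal.ofReal (B ^ 2) * ENNReal.ofReal (τ ^ (-(1 / t) - 1)) := by
                rw [← hw τ hτ0, ENNReal.ofReal_pow hB]; ring
      _ = _ := by
          rw [lintegral_const_mul' _ _ ENNReal.ofReal_ne_top,
            ← setLIntegral_congr (Ioi_ae_eq_Ici (a := P⁻¹)),
            setLIntegral_Ioi_rpow hP' (by linarith),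
            ← ENNReal.ofReal_mul (by positivity)]
          congr 1
          rw [show -(1 / t) - 1 + 1 = -(1 / t) by ring, Real.inv_rpow hP.le,
            ← Real.rpow_neg hP.le, neg_neg]
          field_simp
  have e3 : ∫⁻ τ in Ioi (0 : ℝ),
      (ENNReal.ofReal (τ ^ (-(1 / 2 / t))) * kFunctional t τ u) ^ 2 * ENNReal.ofReal τ⁻¹
      ≤ ENNReal.ofReal (√(1 / (2 * θ - 1 / t) + t) * (B * P ^ (1 / (2 * t)))) ^ 2 := by
    rw [← Ioo_union_Ici_eq_Ioi hP', lintegral_union measurableSet_Ici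
      (disjoint_left.2 fun x hx hx' => (not_lt.2 hx' hx.2))]
    refine (add_le_add e1 e2).trans_eq ?_
    rw [← ENNReal.ofReal_add (by positivity) (by positivity), ← ENNReal.ofReal_pow (by positivity),
      mul_pow, Real.sq_sqrt (by positivity), mul_pow, ← Real.rpow_natCast (P ^ _),
      ← Real.rpow_mul hP.le]
    congr 1
    rw [show 1 / (2 * t) * ((2 : ℕ) : ℝ) = 1 / t by push_cast; field_simp]
    ring
  calc tildeNorm t (1 / 2) u ≤ _ := ENNReal.rpow_le_rpow e3 (by norm_num)
    _ = _ := by rw [← ENNReal.rpow_natCast, ← ENNReal.rpow_mul]; norm_num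

/-! ### Smoothing of functions with finite Slobodeckij seminorm -/

/-- The Slobodeckij seminorm as a real number. -/
noncomputable def gagliardo (σ : ℝ) (f : ℝ → ℝ) : ℝ := (gagliardoSq σ f ^ (1 / 2 : ℝ)).toReal

lemma gagliardo_nonneg (σ : ℝ) (f : ℝ → ℝ) : 0 ≤ gagliardo σ f := ENNReal.toReal_nonneg

lemma ofReal_gagliardo_sq {σ : ℝ} {f : ℝ → ℝ} (h : gagliardoSq σ f ≠ ⊤) :
    ENNReal.ofReal (gagliardo σ f ^ 2) = gagliardoSq σ f := by
  rw [ENNReal.ofReal_pow (gagliardo_nonneg _ _), gagliardo, ENNReal.ofReal_toReal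
    (ENNReal.rpow_ne_top_of_nonneg (by norm_num) h), ← ENNReal.rpow_natCast, ← ENNReal.rpow_mul]
  norm_num

/-- Averages of `f y - f x` over `y` at distance of order `h` from `x`. The centre `(1 - h) x` of
the averaging keeps `y` inside `I`. -/
noncomputable def localAverage (κ : ℝ → ℝ) (h : ℝ) (f : ℝ → ℝ) (x : ℝ) : ℝ :=
  ∫ y, (f y - f x) * κ (((1 - h) * x - y) / h) ∂μI

lemma enorm_localAverage_sq_le {κ : ℝ → ℝ} {M h σ : ℝ} (hM : ∀ z, |κ z| ≤ M)
    (hκ0 : ∀ z, 1 ≤ |z| → κ z = 0) (hh : 0 < h) (hσ : 0 ≤ σ)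
    {f : ℝ → ℝ} (hf : MemLp f 2 μI) {x : ℝ} (hx : x ∈ I) :
    ‖localAverage κ h f x‖ₑ ^ 2 ≤ ENNReal.ofReal (M ^ 2 * (4 * h) * (2 * h) ^ (1 + 2 * σ)) *
      ∫⁻ y in I, ‖f x - f y‖ₑ ^ 2 / ENNReal.ofReal (|x - y| ^ (1 + 2 * σ)) := by
  have hM0 : 0 ≤ M := (abs_nonneg _).trans (hM 0)
  have hx1 : |x| < 1 := abs_lt.2 hx
  set S : Set ℝ := I ∩ Ioo (x - 2 * h) (x + 2 * h) with hS
  have mS : MeasurableSet S := measurableSet_I.inter measurableSet_Ioo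
  have hvol : volume S ≤ ENNReal.ofReal (4 * h) := by
    refine (measure_mono inter_subset_right).trans ?_
    rw [Real.volume_Ioo]
    exact ENNReal.ofReal_le_ofReal (by linarith)
  have mf : AEMeasurable (fun y => ENNReal.ofReal M * ‖f x - f y‖ₑ) (volume.restrict S) := by
    have h1 : AEStronglyMeasurable f (volume.restrict S) := hf.1.mono_set inter_subset_left
    exact ((aestronglyMeasurable_const.sub h1).enorm).const_mul _
  calc ‖localAverage κ h f x‖ₑ ^ 2
      ≤ (∫⁻ y in I, ‖(f y - f x) * κ (((1 - h) * x - y) / h)‖ₑ) ^ 2 := by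
        gcongr; exact enorm_integral_le_lintegral_enorm _
    _ ≤ (∫⁻ y in S, ENNReal.ofReal M * ‖f x - f y‖ₑ) ^ 2 := by
        gcongr ?_ ^ 2
        rw [← lintegral_indicator measurableSet_I, ← lintegral_indicator mS]
        refine lintegral_mono fun y => ?_
        by_cases hy : y ∈ I
        · rw [indicator_of_mem hy]
          by_cases hyS : y ∈ S
          · rw [indicator_of_mem hyS, enorm_mul, mul_comm, ← enorm_neg (f y - f x), neg_sub]
            gcongr
            rw [Real.enorm_eq_ofReal_abs]
            exact ENNReal.ofReal_le_ofReal (hM _)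
          · rw [hκ0, mul_zero, enorm_zero]
            · exact zero_le
            · by_contra hlt
              push Not at hlt
              rw [abs_div, abs_of_pos hh, div_lt_one hh] at hlt
              apply hyS
              refine ⟨hy, ?_⟩
              rw [abs_lt] at hlt hx1
              constructor <;> nlinarith
        · rw [indicator_of_notMem hy]
          exact zero_le
    _ ≤ volume S * ∫⁻ y in S, (ENNReal.ofReal M * ‖f x - f y‖ₑ) ^ 2 := sq_setLIntegral_le _ mf
    _ ≤ ENNReal.ofReal (4 * h) * ∫⁻ y in S, ENNReal.ofReal (M ^ 2 * (2 * h) ^ (1 + 2 * σ)) *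
          (‖f x - f y‖ₑ ^ 2 / ENNReal.ofReal (|x - y| ^ (1 + 2 * σ))) := by
        gcongr ?_ * ?_
        refine setLIntegral_mono' mS fun y hy => ?_
        rcases eq_or_ne x y with rfl | hne
        · simp
        have hpos : 0 < |x - y| := abs_pos.2 (sub_ne_zero.2 hne)
        have hlt : |x - y| ≤ 2 * h := abs_le.2 ⟨by linarith [hy.2.2], by linarith [hy.2.1]⟩
        rw [mul_pow, ← ENNReal.ofReal_pow hM0, ENNReal.ofReal_mul (by positivity), mul_assoc]
        gcongr
        rw [← mul_div_assoc, ENNReal.le_div_iff_mul_le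
          (.inl (by simpa using Real.rpow_pos_of_pos hpos _)) (.inl ENNReal.ofReal_ne_top),
          mul_comm]
        gcongr
    _ ≤ ENNReal.ofReal (4 * h) * ∫⁻ y in I, ENNReal.ofReal (M ^ 2 * (2 * h) ^ (1 + 2 * σ)) *
          (‖f x - f y‖ₑ ^ 2 / ENNReal.ofReal (|x - y| ^ (1 + 2 * σ))) := by
        gcongr; exact inter_subset_left
    _ = _ := by
        rw [lintegral_const_mul' _ _ ENNReal.ofReal_ne_top, ← mul_assoc,
          ← ENNReal.ofReal_mul (by positivity)]
        ring_nf

lemma l2Norm_localAverage_le {κ : ℝ → ℝ} {M h σ : ℝ} (hM : ∀ z, |κ z| ≤ M)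
    (hκ0 : ∀ z, 1 ≤ |z| → κ z = 0) (hh : 0 < h) (hσ : 0 ≤ σ) (hσ1 : σ ≤ 1)
    {f : ℝ → ℝ} (hf : MemLp f 2 μI) (hG : gagliardoSq σ f ≠ ⊤) :
    l2Norm (localAverage κ h f) ≤ 6 * M * h ^ (1 + σ) * gagliardo σ f := by
  have hM0 : 0 ≤ M := (abs_nonneg _).trans (hM 0)
  have hg := gagliardo_nonneg σ f
  have h1 : eLpNorm (localAverage κ h f) 2 μI ^ 2 ≤
      ENNReal.ofReal (6 * M * h ^ (1 + σ) * gagliardo σ f) ^ 2 := by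
    rw [eLpNorm_two_sq]
    calc ∫⁻ x, ‖localAverage κ h f x‖ₑ ^ 2 ∂μI
        ≤ ∫⁻ x in I, ENNReal.ofReal (M ^ 2 * (4 * h) * (2 * h) ^ (1 + 2 * σ)) *
          ∫⁻ y in I, ‖f x - f y‖ₑ ^ 2 / ENNReal.ofReal (|x - y| ^ (1 + 2 * σ)) :=
          setLIntegral_mono' measurableSet_I fun x hx =>
            enorm_localAverage_sq_le hM hκ0 hh hσ hf hx
      _ = ENNReal.ofReal (M ^ 2 * (4 * h) * (2 * h) ^ (1 + 2 * σ)) * gagliardoSq σ f :=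
          lintegral_const_mul' _ _ ENNReal.ofReal_ne_top
      _ ≤ _ := by
          rw [← ofReal_gagliardo_sq hG, ← ENNReal.ofReal_mul (by positivity),
            ← ENNReal.ofReal_pow (by positivity)]
          refine ENNReal.ofReal_le_ofReal ?_
          have e1 : (2 : ℝ) ^ (1 + 2 * σ) ≤ 8 := by
            calc (2 : ℝ) ^ (1 + 2 * σ) ≤ 2 ^ (3 : ℝ) :=
                  Real.rpow_le_rpow_of_exponent_le (by norm_num) (by linarith)
              _ = 8 := by norm_num
          have e2 : h * h ^ (1 + 2 * σ) = (h ^ (1 + σ)) ^ 2 := by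
            rw [← Real.rpow_natCast, ← Real.rpow_mul hh.le,
              ← Real.rpow_one_add' hh.le (by linarith)]
            congr 1; push_cast; ring
          rw [Real.mul_rpow (by norm_num) hh.le]
          calc M ^ 2 * (4 * h) * (2 ^ (1 + 2 * σ) * h ^ (1 + 2 * σ)) * gagliardo σ f ^ 2
              = 4 * 2 ^ (1 + 2 * σ) * (M ^ 2 * (h * h ^ (1 + 2 * σ)) * gagliardo σ f ^ 2) := by ring
            _ ≤ 36 * (M ^ 2 * (h * h ^ (1 + 2 * σ)) * gagliardo σ f ^ 2) := by gcongr; linarith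
            _ = _ := by rw [e2]; ring
  have h2 := (ENNReal.pow_right_strictMono two_ne_zero).le_iff_le.1 h1
  rw [l2Norm]
  exact ENNReal.toReal_le_of_le_ofReal (by positivity) h2

/-- A mollifier supported in `[-1, 1]`, with a bound for it and for its derivative. -/
lemma exists_mollifier : ∃ (k : ℝ → ℝ) (M : ℝ), 0 < M ∧ ContDiff ℝ ∞ k ∧ HasCompactSupport k ∧
    ∫ z, k z = 1 ∧ (∀ z, 1 ≤ |z| → k z = 0) ∧ (∀ z, 1 ≤ |z| → deriv k z = 0) ∧
    (∀ z, |k z| ≤ M) ∧ (∀ z, |deriv k z| ≤ M) ∧ ∫ z, deriv k z = 0 := by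
  let b : ContDiffBump (0 : ℝ) := ⟨1 / 4, 1 / 2, by norm_num, by norm_num⟩
  have hk : ContDiff ℝ ∞ (b.normed volume) := b.contDiff_normed
  have hc : HasCompactSupport (b.normed volume) := b.hasCompactSupport_normed
  have hk' : ContDiff ℝ ∞ (deriv (b.normed volume)) := (contDiff_infty_iff_deriv.1 hk).2
  obtain ⟨M₁, hM₁⟩ := hc.exists_bound_of_continuous hk.continuous
  obtain ⟨M₂, hM₂⟩ := hc.deriv.exists_bound_of_continuous hk'.continuous
  have hts : ∀ z : ℝ, 1 ≤ |z| → z ∉ tsupport (b.normed volume) := by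
    intro z hz hz'
    rw [b.tsupport_normed_eq, Metric.mem_closedBall, dist_zero_right, Real.norm_eq_abs] at hz'
    norm_num [b] at hz'
    linarith
  refine ⟨b.normed volume, max 1 (max M₁ M₂), by positivity, hk, hc, b.integral_normed,
    fun z hz => image_eq_zero_of_notMem_tsupport (hts z hz),
    fun z hz => image_eq_zero_of_notMem_tsupport fun h => hts z hz (tsupport_deriv_subset h),
    fun z => (hM₁ z).trans ((le_max_left _ _).trans (le_max_right _ _)),
    fun z => (hM₂ z).trans ((le_max_right _ _).trans (le_max_right _ _)), ?_⟩
  exact integral_eq_zero_of_hasDerivAt_of_integrable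
    (fun z => (hk.differentiable (by simp) z).hasDerivAt)
    (hk'.continuous.integrable_of_hasCompactSupport hc.deriv)
    (hk.continuous.integrable_of_hasCompactSupport hc)

/-- For `x ∈ I`, the mean over `I` of a kernel of width `h` about `(1 - h) x` is its mean
over `ℝ`. -/
lemma integral_kernel {κ : ℝ → ℝ} {h : ℝ} (hκ0 : ∀ z, 1 ≤ |z| → κ z = 0) (hh : 0 < h)
    (hh1 : h ≤ 1) {x : ℝ} (hx : x ∈ I) :
    ∫ y, κ (((1 - h) * x - y) / h) ∂μI = h * ∫ z, κ z := by
  have hx1 : |x| < 1 := abs_lt.2 hx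
  rw [μI, setIntegral_eq_integral_of_forall_compl_eq_zero,
    integral_sub_left_eq_self (fun z => κ (z / h)) volume ((1 - h) * x),
    Measure.integral_comp_div, abs_of_pos hh, smul_eq_mul]
  intro y hy
  refine hκ0 _ ?_
  rw [abs_div, abs_of_pos hh, one_le_div hh]
  have h1 : 1 ≤ |y| := by
    by_contra hlt
    exact hy (abs_lt.1 (not_le.1 hlt))
  have h2 : |(1 - h) * x| ≤ 1 - h := by
    rw [abs_mul, abs_of_nonneg (by linarith)]
    nlinarith
  have h3 := abs_sub_abs_le_abs_sub y ((1 - h) * x)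
  rw [abs_sub_comm] at h3
  linarith

/-- Functions with a finite Slobodeckij seminorm are approximated, at every scale `h`, by
absolutely continuous functions. -/
lemma exists_smoothing : ∃ M : ℝ, 0 < M ∧ ∀ (σ : ℝ) (f : ℝ → ℝ), 0 ≤ σ → σ ≤ 1 → MemLp f 2 μI →
    gagliardoSq σ f ≠ ⊤ → ∀ h : ℝ, 0 < h → h ≤ 1 → ∃ w v : ℝ → ℝ, HasL2Deriv w v ∧
      l2Norm (f - w) ≤ M * h ^ σ * gagliardo σ f ∧
      l2Norm v ≤ M * h ^ (σ - 1) * gagliardo σ f := by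
  obtain ⟨k, M, hM, hk, hkc, hk1, hk0, hdk0, hkM, hdkM, hdk1⟩ := exists_mollifier
  refine ⟨6 * M, by positivity, fun σ f hσ hσ1 hf hG h hh hh1 => ?_⟩
  have hfi := integrable_of_memLp hf
  have hk' : ContDiff ℝ ∞ (deriv k) := (contDiff_infty_iff_deriv.1 hk).2
  have hloc : LocallyIntegrable (I.indicator f) volume :=
    ((integrable_indicator_iff measurableSet_I).2 hfi).locallyIntegrable
  have hκ : ContDiff ℝ 1 (fun z => k (z / h)) := (hk.of_le (by exact_mod_cast le_top)).comp
    (contDiff_id.div_const h)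
  have hκc : HasCompactSupport (fun z => k (z / h)) := by
    have := hkc.comp_homeomorph (Homeomorph.mulRight₀ h⁻¹ (inv_ne_zero hh.ne'))
    simpa [Function.comp_def, div_eq_mul_inv] using this
  have hκd : deriv (fun z => k (z / h)) = fun z => deriv k (z / h) / h := by
    ext z
    have h1 : HasDerivAt (fun z => k (z / h)) _ z :=
      (hk.differentiable (by simp) (z / h)).hasDerivAt.comp z ((hasDerivAt_id z).div_const h)
    rw [h1.deriv]
    ring
  have hconv : ∀ (κ : ℝ → ℝ) (x : ℝ),
      (convolution (I.indicator f) κ (ContinuousLinearMap.mul ℝ ℝ) volume) x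
        = ∫ y, f y * κ (x - y) ∂μI := by
    intro κ x
    rw [convolution, μI, ← integral_indicator measurableSet_I]
    congr 1
    ext y
    by_cases hy : y ∈ I
    · simp [hy]
    · simp [hy]
  set W : ℝ → ℝ := fun x => h⁻¹ *
    (convolution (I.indicator f) (fun z => k (z / h)) (ContinuousLinearMap.mul ℝ ℝ) volume)
      ((1 - h) * x) with hW
  have hWc : ContDiff ℝ 1 W := contDiff_const.mul
    ((hκc.contDiff_convolution_right (n := 1) _ hloc hκ).comp (contDiff_const.mul contDiff_id))
  have hint : ∀ (κ : ℝ → ℝ) (_ : Continuous κ) (_ : ∀ z, |κ z| ≤ M) (x : ℝ),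
      localAverage κ h f x = ∫ y, f y * κ (((1 - h) * x - y) / h) ∂μI
        - f x * ∫ y, κ (((1 - h) * x - y) / h) ∂μI := by
    intro κ hκc hκM x
    have mκ : Continuous fun y => κ (((1 - h) * x - y) / h) := by fun_prop
    have i1 : Integrable (fun y => κ (((1 - h) * x - y) / h)) μI :=
      integrable_of_memLp (memLp_of_continuousOn mκ.continuousOn)
    have i2 : Integrable (fun y => f y * κ (((1 - h) * x - y) / h)) μI :=
      hfi.mul_bdd mκ.aestronglyMeasurable (.of_forall fun y => hκM _)
    rw [← integral_const_mul, ← integral_sub i2 (i1.const_mul _), localAverage]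
    congr 1
    ext y
    ring
  have hval : ∀ x ∈ I, (f - W) x = -h⁻¹ * localAverage k h f x := by
    intro x hx
    rw [hint k hk.continuous hkM, integral_kernel hk0 hh hh1 hx, hk1, Pi.sub_apply, hW]
    simp only [hconv]
    field_simp
    ring
  have hder : ∀ x ∈ I, deriv W x = (h⁻¹ * ((1 - h) * h⁻¹)) * localAverage (deriv k) h f x := by
    intro x hx
    have h1 : HasDerivAt W _ x :=
      ((hκc.hasDerivAt_convolution_right (ContinuousLinearMap.mul ℝ ℝ) hloc hκ
        ((1 - h) * x)).comp x ((hasDerivAt_id x).const_mul (1 - h))).const_mul h⁻¹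
    -- the kernel of the derivative has mean zero, so `f x` may be subtracted from `f y`
    rw [h1.deriv, hint _ hk'.continuous hdkM, integral_kernel hdk0 hh hh1 hx, hdk1,
      hconv, hκd]
    simp only [← mul_div_assoc, integral_div]
    ring
  have hg := gagliardo_nonneg σ f
  refine ⟨W, deriv W, HasL2Deriv.of_contDiff hWc, ?_, ?_⟩
  · have e : f - W =ᵐ[μI] (-h⁻¹) • localAverage k h f := by
      filter_upwards [ae_μI_mem] with x hx using hval x hx
    rw [l2Norm_congr e, l2Norm_const_smul, abs_neg, abs_of_pos (inv_pos.2 hh)]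
    calc h⁻¹ * l2Norm (localAverage k h f)
        ≤ h⁻¹ * (6 * M * h ^ (1 + σ) * gagliardo σ f) := by
          gcongr; exact l2Norm_localAverage_le hkM hk0 hh hσ hσ1 hf hG
      _ = _ := by rw [Real.rpow_add hh, Real.rpow_one]; field_simp
  · have e : deriv W =ᵐ[μI] (h⁻¹ * ((1 - h) * h⁻¹)) • localAverage (deriv k) h f := by
      filter_upwards [ae_μI_mem] with x hx using hder x hx
    have h1h : 0 ≤ 1 - h := by linarith
    rw [l2Norm_congr e, l2Norm_const_smul, abs_of_nonneg (by positivity)]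
    calc h⁻¹ * ((1 - h) * h⁻¹) * l2Norm (localAverage (deriv k) h f)
        ≤ h⁻¹ * (1 * h⁻¹) * (6 * M * h ^ (1 + σ) * gagliardo σ f) := by
          gcongr
          · exact l2Norm_nonneg _
          · linarith
          · exact l2Norm_localAverage_le hdkM hdk0 hh hσ hσ1 hf hG
      _ = _ := by
        rw [show 1 + σ = 2 + (σ - 1) by ring, Real.rpow_add hh, Real.rpow_two]
        field_simp

section
open Polynomial

/-! ### Polynomial approximation of smooth functions -/

/-- The distance in `L²(I)` of `v` to the polynomials of degree less than `n` is at most `B`. -/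
def PolyApprox (n : ℕ) (B : ℝ) (v : ℝ → ℝ) : Prop :=
  ∃ q : ℝ[X], q.degree < n ∧ l2Norm (fun x => v x - q.eval x) ≤ B

lemma PolyApprox.mono {n : ℕ} {B B' : ℝ} {v : ℝ → ℝ} (h : PolyApprox n B v) (hB : B ≤ B') :
    PolyApprox n B' v := by
  obtain ⟨q, hq, h⟩ := h
  exact ⟨q, hq, h.trans hB⟩

lemma polyApprox_l2Norm (n : ℕ) (v : ℝ → ℝ) : PolyApprox n (l2Norm v) v :=
  ⟨0, by rw [degree_zero]; exact WithBot.bot_lt_coe n, by simp⟩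

/-- The Jackson estimate in `L²(I)`: integrating the derivative gains one order. -/
lemma HasL2Deriv.polyApprox {w v : ℝ → ℝ} (hw : HasL2Deriv w v) {n : ℕ} {B : ℝ} (hn : 1 ≤ n)
    (h : PolyApprox n B v) : PolyApprox (n + 1) (B / n) w := by
  obtain ⟨q, hq, -, -, -, hopt, hle⟩ := hw.exists_interpolant hn
  obtain ⟨q₀, hq₀, hB⟩ := h
  have hn' : (0 : ℝ) < n := by exact_mod_cast hn
  refine ⟨q, ?_, ?_⟩
  · exact lt_of_le_of_lt degree_le_natDegree (by exact_mod_cast Nat.lt_succ_of_le hq)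
  · rw [le_div_iff₀ hn', mul_comm]
    exact hle.trans ((hopt q₀ hq₀).trans hB)

lemma rpow_neg_le_two_rpow_mul {n : ℕ} (hn : 1 ≤ n) {α : ℝ} (hα : 0 ≤ α) :
    (n : ℝ) ^ (-α) ≤ 2 ^ α * ((n + 1 : ℕ) : ℝ) ^ (-α) := by
  have hn' : (1 : ℝ) ≤ n := by exact_mod_cast hn
  have h0 : (0 : ℝ) < n := by linarith
  have h2 : (0 : ℝ) < ((n + 1 : ℕ) : ℝ) := by positivity
  rw [Real.rpow_neg h0.le, Real.rpow_neg h2.le, ← div_eq_mul_inv, inv_eq_one_div,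
    div_le_div_iff₀ (by positivity) (by positivity), one_mul, ← Real.mul_rpow (by norm_num) h0.le]
  refine Real.rpow_le_rpow h2.le ?_ hα
  push_cast
  linarith

/-- The effect of one derivative on rates of polynomial approximation. -/
lemma HasL2Deriv.polyApprox_rpow {w v : ℝ → ℝ} (hw : HasL2Deriv w v) {α C : ℝ} (hα : 0 ≤ α)
    (hC : 0 ≤ C) (hwC : l2Norm w ≤ C) (h : ∀ n : ℕ, 1 ≤ n → PolyApprox n (C * (n : ℝ) ^ (-α)) v)
    {n : ℕ} (hn : 1 ≤ n) : PolyApprox n (2 ^ (α + 1) * C * (n : ℝ) ^ (-(α + 1))) w := by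
  rcases hn.eq_or_lt with rfl | hn
  · refine (polyApprox_l2Norm 1 w).mono ?_
    rw [Nat.cast_one, Real.one_rpow, mul_one]
    have h1 : (1 : ℝ) ≤ 2 ^ (α + 1) := Real.one_le_rpow (by norm_num) (by linarith)
    nlinarith
  · obtain ⟨k, rfl⟩ : ∃ k, n = k + 1 := ⟨n - 1, by omega⟩
    have hk : 1 ≤ k := by omega
    have hk' : (0 : ℝ) < k := by exact_mod_cast hk
    refine (hw.polyApprox hk (h k hk)).mono ?_
    have h1 := rpow_neg_le_two_rpow_mul hk (show 0 ≤ α + 1 by linarith)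
    have h2 : C * (k : ℝ) ^ (-α) / k = C * (k : ℝ) ^ (-(α + 1)) := by
      rw [neg_add, ← sub_eq_add_neg, Real.rpow_sub hk', Real.rpow_one]
      ring
    rw [h2]
    nlinarith [mul_le_mul_of_nonneg_left h1 hC]

/-- Functions with a finite Slobodeckij seminorm of order `σ` are approximated by polynomials at
the rate `n^(-σ)`: smooth at scale `1 / n`, and approximate the smoothed function. -/
lemma exists_polyApprox_gagliardo : ∃ C : ℝ, 0 < C ∧ ∀ (σ : ℝ) (f : ℝ → ℝ), 0 ≤ σ → σ ≤ 1 →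
    MemLp f 2 μI → gagliardoSq σ f ≠ ⊤ → ∀ n : ℕ, 1 ≤ n →
      PolyApprox n (C * (l2Norm f + gagliardo σ f) * (n : ℝ) ^ (-σ)) f := by
  obtain ⟨M, hM, hS⟩ := exists_smoothing
  refine ⟨3 * M + 1, by positivity, fun σ f hσ hσ1 hf hG n hn => ?_⟩
  have hg := gagliardo_nonneg σ f
  have hl := l2Norm_nonneg f
  rcases hn.eq_or_lt with rfl | hn
  · refine (polyApprox_l2Norm 1 f).mono ?_
    rw [Nat.cast_one, Real.one_rpow, mul_one]
    have h1 : 0 ≤ 3 * M * (l2Norm f + gagliardo σ f) := by positivity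
    linarith
  · obtain ⟨k, rfl⟩ : ∃ k, n = k + 1 := ⟨n - 1, by omega⟩
    have hk : 1 ≤ k := by omega
    have hk' : (1 : ℝ) ≤ k := by exact_mod_cast hk
    have hN : (0 : ℝ) < ((k + 1 : ℕ) : ℝ) := by positivity
    obtain ⟨w, v, hw, h1, h2⟩ := hS σ f hσ hσ1 hf hG (((k + 1 : ℕ) : ℝ)⁻¹) (by positivity)
      (inv_le_one_of_one_le₀ (by push_cast; linarith))
    obtain ⟨q, hq, hle⟩ := hw.polyApprox hk (polyApprox_l2Norm k v)
    refine ⟨q, hq, ?_⟩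
    have e : (fun x => f x - q.eval x) = (f - w) + fun x => w x - q.eval x := by
      ext x; simp
    rw [e]
    refine (l2Norm_add_le (hf.sub hw.memLp_left) (hw.memLp_left.sub (memLp_polynomial q))).trans ?_
    rw [Real.inv_rpow hN.le, ← Real.rpow_neg hN.le] at h1 h2
    have h3 : l2Norm v / k ≤ 2 * (M * ((k + 1 : ℕ) : ℝ) ^ (-σ) * gagliardo σ f) := by
      rw [div_le_iff₀ (by linarith)]
      refine h2.trans ?_
      rw [neg_sub, sub_eq_add_neg, Real.rpow_add hN, Real.rpow_one]
      have h4 : ((k + 1 : ℕ) : ℝ) ≤ 2 * k := by push_cast; linarith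
      calc M * (((k + 1 : ℕ) : ℝ) * ((k + 1 : ℕ) : ℝ) ^ (-σ)) * gagliardo σ f
          = ((k + 1 : ℕ) : ℝ) * (M * ((k + 1 : ℕ) : ℝ) ^ (-σ) * gagliardo σ f) := by ring
        _ ≤ (2 * k) * (M * ((k + 1 : ℕ) : ℝ) ^ (-σ) * gagliardo σ f) := by gcongr
        _ = _ := by ring
    have h6 : l2Norm (w - fun x => q.eval x) ≤ l2Norm v / k := hle
    have h5 : 0 ≤ (3 * M * l2Norm f + (l2Norm f + gagliardo σ f)) * ((k + 1 : ℕ) : ℝ) ^ (-σ) := by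
      positivity
    linarith

/-- The data of an element `f` of `H^r(I)`: its weak derivatives `V k`, and a bound `S` for the
terms of the norm. -/
structure SobolevData (r : ℝ) (f : ℝ → ℝ) (V : ℕ → ℝ → ℝ) (S : ℝ) : Prop where
  weakDeriv : ∀ k ≤ ⌊r⌋₊, HasWeakDeriv k f (V k)
  memLp : ∀ k ≤ ⌊r⌋₊, MemLp (V k) 2 μI
  l2Norm_le : ∀ k ≤ ⌊r⌋₊, l2Norm (V k) ≤ S
  gagliardoSq_ne_top : Int.fract r ≠ 0 → gagliardoSq (Int.fract r) (V ⌊r⌋₊) ≠ ⊤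
  gagliardo_le : Int.fract r ≠ 0 → gagliardo (Int.fract r) (V ⌊r⌋₊) ≤ S

namespace SobolevData
variable {r S : ℝ} {f : ℝ → ℝ} {V : ℕ → ℝ → ℝ}

lemma nonneg (h : SobolevData r f V S) : 0 ≤ S :=
  (l2Norm_nonneg _).trans (h.l2Norm_le 0 (Nat.zero_le _))

lemma ae_eq_zero (h : SobolevData r f V S) : f =ᵐ[μI] V 0 :=
  (hasWeakDeriv_zero (h.weakDeriv 0 (Nat.zero_le _)).1).unique (h.weakDeriv 0 (Nat.zero_le _))

end SobolevData

/-- The derivatives of order `⌊r⌋ - j` are approximated at the rate `n^(-(σ + j))`, where `σ` is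
the fractional part of `r`. -/
lemma exists_polyApprox_weakDeriv (r : ℝ) (j : ℕ) : ∃ C : ℝ, 0 < C ∧
    ∀ (f : ℝ → ℝ) (V : ℕ → ℝ → ℝ) (S : ℝ), SobolevData r f V S → j ≤ ⌊r⌋₊ → ∀ n : ℕ, 1 ≤ n →
      PolyApprox n (C * S * (n : ℝ) ^ (-(Int.fract r + j))) (V (⌊r⌋₊ - j)) := by
  have hσ := Int.fract_nonneg r
  have hσ1 := (Int.fract_lt_one r).le
  induction j with
  | zero =>
    obtain ⟨C, hC, hA⟩ := exists_polyApprox_gagliardo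
    refine ⟨2 * C + 1, by positivity, fun f V S h _ n hn => ?_⟩
    have hS := h.nonneg
    rw [Nat.cast_zero, add_zero, Nat.sub_zero]
    by_cases h0 : Int.fract r = 0
    · refine (polyApprox_l2Norm n _).mono ((h.l2Norm_le _ le_rfl).trans ?_)
      rw [h0, neg_zero, Real.rpow_zero]
      nlinarith
    · refine (hA _ _ hσ hσ1 (h.memLp _ le_rfl) (h.gagliardoSq_ne_top h0) n hn).mono ?_
      have h1 := add_le_add (h.l2Norm_le _ le_rfl) (h.gagliardo_le h0)
      refine mul_le_mul_of_nonneg_right ?_ (by positivity)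
      nlinarith [mul_le_mul_of_nonneg_left h1 hC.le]
  | succ j ih =>
    obtain ⟨C, hC, hA⟩ := ih
    refine ⟨2 ^ (Int.fract r + j + 1) * (C + 1), by positivity, fun f V S h hj n hn => ?_⟩
    have hS := h.nonneg
    obtain ⟨k, hk, hk1⟩ : ∃ k, ⌊r⌋₊ - (j + 1) = k ∧ ⌊r⌋₊ - j = k + 1 := ⟨_, rfl, by omega⟩
    have hA' := hA f V S h (by omega)
    rw [hk]
    rw [hk1] at hA'
    obtain ⟨g, hg, hd⟩ := (h.weakDeriv k (by omega)).exists_hasL2Deriv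
      (h.weakDeriv (k + 1) (by omega)) (h.memLp k (by omega)) (h.memLp (k + 1) (by omega))
    have hgS : l2Norm g ≤ (C + 1) * S := by
      rw [← l2Norm_congr hg]
      have := h.l2Norm_le k (by omega)
      nlinarith
    obtain ⟨q, hq, hle⟩ := hd.polyApprox_rpow (α := Int.fract r + j) (by positivity)
      (by positivity) hgS (fun n hn => (hA' n hn).mono (by gcongr; linarith)) hn
    refine ⟨q, hq, ?_⟩
    have e : (fun x => V k x - q.eval x) =ᵐ[μI] fun x => g x - q.eval x := by
      filter_upwards [hg] with x hx
      rw [hx]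
    rw [l2Norm_congr e]
    refine hle.trans_eq ?_
    push_cast
    ring_nf

lemma rpow_mul_rpow_half {p : ℝ} (hp : 0 < p) {t : ℝ} (ht : 0 < t) (r : ℝ) :
    p ^ (-r) * (p ^ t) ^ (1 / (2 * t)) = p ^ (-(r - 1 / 2)) := by
  rw [← Real.rpow_mul hp.le, ← Real.rpow_add hp]
  congr 1
  field_simp
  ring

/-- The case `r ≥ 1`: the interpolant built from the projection of the first derivative. -/
lemma exists_approximation_of_one_le (r : ℝ) (hr : 1 ≤ r) (t : ℝ) (ht : 1 / 2 < t) (ht1 : t ≤ 1) :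
    ∃ C : ℝ, 0 < C ∧ ∀ (f : ℝ → ℝ) (V : ℕ → ℝ → ℝ) (S : ℝ), SobolevData r f V S →
      ∃ g : ℝ → ℝ, ContinuousOn g (Icc (-1) 1) ∧ f =ᵐ[μI] g ∧
        ∀ p : ℕ, 1 ≤ p → ∃ q : ℝ[X], q.natDegree ≤ p ∧ q.eval (-1) = g (-1) ∧ q.eval 1 = g 1 ∧
          tildeNorm t (1 / 2) (fun x => f x - q.eval x) ≤
            ENNReal.ofReal (C * (p : ℝ) ^ (-(r - 1 / 2)) * S) := by
  have ht0 : 0 < t := by linarith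
  have hfl : 1 ≤ ⌊r⌋₊ := Nat.one_le_floor_iff _ |>.2 hr
  obtain ⟨K, hK, hA⟩ := exists_polyApprox_weakDeriv r (⌊r⌋₊ - 1)
  obtain ⟨A, hA0, hN⟩ := exists_energyNorm_le ht0 ht1
  have hθ : 1 / (2 * t) < 1 := by rw [div_lt_one (by positivity)]; linarith
  have hθ' : 0 < 2 * 1 - 1 / t := by
    have : 1 / (2 * t) = 1 / t / 2 := by field_simp
    linarith
  refine ⟨√(1 / (2 * 1 - 1 / t) + t) * ((2 * A + 1) * K), by positivity,
    fun f V S h => ?_⟩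
  have hS := h.nonneg
  obtain ⟨g, hg, hd⟩ := (h.weakDeriv 0 (by omega)).exists_hasL2Deriv
      (h.weakDeriv 1 (by omega)) (h.memLp 0 (by omega)) (h.memLp 1 (by omega))
  have hfg : f =ᵐ[μI] g := h.ae_eq_zero.trans hg
  refine ⟨g, hd.continuousOn, hfg, fun p hp => ?_⟩
  have hp' : (1 : ℝ) ≤ p := by exact_mod_cast hp
  have hp0 : (0 : ℝ) < p := by linarith
  obtain ⟨q, hqd, hq1, hq2, -, hopt, hle⟩ := hd.exists_interpolant hp
  refine ⟨q, hqd, hq1, hq2, ?_⟩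
  have hA' := hA f V S h (by omega) p hp
  rw [show ⌊r⌋₊ - (⌊r⌋₊ - 1) = 1 by omega] at hA'
  obtain ⟨q₀, hq₀, hB⟩ := hA'
  have hrr : -(Int.fract r + ((⌊r⌋₊ - 1 : ℕ) : ℝ)) = 1 + -r := by
    rw [Nat.cast_sub hfl]
    have h1 : ((⌊r⌋₊ : ℕ) : ℝ) = ((⌊r⌋ : ℤ) : ℝ) := natCast_floor_eq_intCast_floor (by linarith)
    rw [h1, Nat.cast_one]
    have := Int.fract_add_floor r
    linarith
  rw [hrr, Real.rpow_add hp0, Real.rpow_one] at hB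
  have hv : l2Norm (fun x => V 1 x - (derivative q).eval x) ≤ p * (K * S * (p : ℝ) ^ (-r)) :=
    ((hopt q₀ hq₀).trans hB).trans_eq (by ring)
  have he : l2Norm (fun x => g x - q.eval x) ≤ K * S * (p : ℝ) ^ (-r) :=
    le_of_mul_le_mul_left (hle.trans hv) hp0
  have hE := hd.sub (HasL2Deriv.of_polynomial q)
  have hue : (fun x => f x - q.eval x) =ᵐ[μI] g - fun x => q.eval x := by
    filter_upwards [hfg] with x hx
    simp [hx]
  have hu : MemLp (fun x => f x - q.eval x) 2 μI := hE.memLp_left.ae_eq hue.symm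
  have hB0 : 0 ≤ (2 * A + 1) * K * S * (p : ℝ) ^ (-r) := by positivity
  have hfin := tildeNorm_le (u := fun x => f x - q.eval x) (P := (p : ℝ) ^ t) ht0 hθ hB0
    (by positivity) (fun τ hτ => ?_) (fun τ hτ hτP => ?_)
  · refine hfin.trans (ENNReal.ofReal_le_ofReal (le_of_eq ?_))
    rw [← rpow_mul_rpow_half hp0 ht0]
    ring
  · refine (kFunctional_le_eLpNorm ht0 ht1 hu).trans ?_
    rw [eLpNorm_congr_ae hue, ← ofReal_l2Norm hE.memLp_left]
    refine ENNReal.ofReal_le_ofReal (he.trans ?_)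
    have : 0 ≤ 2 * A * (K * S * (p : ℝ) ^ (-r)) := by positivity
    linarith
  · refine (kFunctional_le ht0 ht1 hu hE (by simp [hq1]) (by simp [hq2])).trans ?_
    have h0 : (fun x => f x - q.eval x) - (g - fun x => q.eval x) =ᵐ[μI] 0 := by
      filter_upwards [hue] with x hx
      simp only [Pi.sub_apply] at hx ⊢
      rw [hx]; simp
    rw [eLpNorm_congr_ae h0, eLpNorm_zero, zero_add, Real.rpow_one]
    have h3 := hN _ _ hE ((p : ℝ)⁻¹) (by positivity) (inv_le_one_of_one_le₀ hp')
    calc ENNReal.ofReal τ * energyNorm t _ _ ≤ ENNReal.ofReal τ * ENNReal.ofReal _ := by gcongr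
      _ = ENNReal.ofReal (τ * _) := (ENNReal.ofReal_mul hτ.le).symm
      _ ≤ _ := by
        refine ENNReal.ofReal_le_ofReal ?_
        have e1 : ((p : ℝ)⁻¹) ^ (-t) = (p : ℝ) ^ t := by
          rw [Real.inv_rpow hp0.le, Real.rpow_neg hp0.le, inv_inv]
        have e2 : ((p : ℝ)⁻¹) ^ (1 - t) * p = (p : ℝ) ^ t := by
          rw [Real.inv_rpow hp0.le, ← Real.rpow_neg hp0.le, ← Real.rpow_add_one hp0.ne']
          congr 1; ring
        rw [e1]
        have h4 : (p : ℝ) ^ t * l2Norm (g - fun x => q.eval x) ≤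
            (p : ℝ) ^ t * (K * S * (p : ℝ) ^ (-r)) := by
          gcongr
          exact he
        have h5 : ((p : ℝ)⁻¹) ^ (1 - t) * l2Norm (V 1 - fun x => (derivative q).eval x) ≤
            (p : ℝ) ^ t * (K * S * (p : ℝ) ^ (-r)) := by
          rw [← e2, mul_assoc]
          gcongr
          exact hv
        have h6 : 0 ≤ τ * ((p : ℝ) ^ t * (K * S * (p : ℝ) ^ (-r))) := by positivity
        calc _ ≤ τ * (A * ((p : ℝ) ^ t * (K * S * (p : ℝ) ^ (-r)) +
              (p : ℝ) ^ t * (K * S * (p : ℝ) ^ (-r)))) := by gcongr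
          _ ≤ _ := by linarith

end

section
open Polynomial

/-! ### Traces and continuity for `1/2 < r < 1` -/

lemma HasL2Deriv.abs_sub_le {w v : ℝ → ℝ} (hw : HasL2Deriv w v) {x y : ℝ}
    (hx : x ∈ Icc (-1 : ℝ) 1) (hy : y ∈ Icc (-1 : ℝ) 1) :
    |w x - w y| ≤ √|x - y| * l2Norm v := by
  have h1 := hw.enorm_sub_sq_le hx hy
  have h2 : ∫⁻ s in uIoc x y, ‖v s‖ₑ ^ 2 ≤ ENNReal.ofReal (l2Norm v ^ 2) := by
    rw [ENNReal.ofReal_pow (l2Norm_nonneg v), ofReal_l2Norm hw.memLp, eLpNorm_two_sq, μI, I,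
      Measure.restrict_congr_set Ioo_ae_eq_Ioc]
    refine lintegral_mono_set ?_
    exact Ioc_subset_Ioc (le_min hx.1 hy.1) (max_le hx.2 hy.2)
  have h3 : ENNReal.ofReal (|w x - w y| ^ 2) ≤ ENNReal.ofReal (|x - y| * l2Norm v ^ 2) := by
    rw [ENNReal.ofReal_mul (abs_nonneg _), ENNReal.ofReal_pow (abs_nonneg _),
      ← Real.enorm_eq_ofReal_abs]
    exact h1.trans (by gcongr)
  have h4 := (ENNReal.ofReal_le_ofReal_iff (by positivity)).1 h3
  refine abs_le_of_sq_le_sq' ?_ (by have := l2Norm_nonneg v; positivity) |>.2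
  rwa [mul_pow, Real.sq_sqrt (abs_nonneg _)]

/-- The multiplicative trace inequality, in its additive form at scale `h`. -/
lemma HasL2Deriv.abs_le {w v : ℝ → ℝ} (hw : HasL2Deriv w v) {h : ℝ} (hh : 0 < h) (hh1 : h ≤ 1)
    {x : ℝ} (hx : x ∈ Icc (-1 : ℝ) 1) :
    |w x| ≤ h ^ (-(1 / 2) : ℝ) * l2Norm w + h ^ (1 / 2 : ℝ) * l2Norm v := by
  -- an interval of length `h` in `[-1, 1]` which contains `x`
  obtain ⟨a, ha, hab, hax, hxa⟩ : ∃ a : ℝ, -1 ≤ a ∧ a + h ≤ 1 ∧ a ≤ x ∧ x ≤ a + h := by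
    rcases le_total x 0 with h0 | h0
    · exact ⟨x, hx.1, by linarith, le_rfl, by linarith⟩
    · exact ⟨x - h, by linarith, by linarith [hx.2], by linarith, by linarith⟩
  have hsub : Ioo a (a + h) ⊆ I := Ioo_subset_Ioo ha hab
  have hint : IntegrableOn (fun y => w y ^ 2) (Ioo a (a + h)) :=
    IntegrableOn.mono_set (t := I) hw.memLp_left.integrable_sq hsub
  obtain ⟨y, hy, hyw⟩ := exists_le_setAverage (μ := volume) (s := Ioo a (a + h))
    (f := fun y => w y ^ 2) (by simp [hh]) (by simp) hint
  have h1 : ⨍ z in Ioo a (a + h), w z ^ 2 ≤ h⁻¹ * l2Norm w ^ 2 := by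
    rw [setAverage_eq, smul_eq_mul, Measure.real, Real.volume_Ioo, add_sub_cancel_left,
      ENNReal.toReal_ofReal hh.le, l2Norm_sq hw.memLp_left]
    refine mul_le_mul_of_nonneg_left ?_ (inv_nonneg.2 hh.le)
    exact setIntegral_mono_set (t := I) hw.memLp_left.integrable_sq
      (.of_forall fun z => sq_nonneg _) (LE.le.eventuallyLE hsub)
  have hl := l2Norm_nonneg w
  have h2 : |w y| ≤ h ^ (-(1 / 2) : ℝ) * l2Norm w := by
    refine abs_le_of_sq_le_sq' (a := |w y|) ?_ (by positivity) |>.2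
    rw [sq_abs, mul_pow, ← Real.rpow_natCast (h ^ _), ← Real.rpow_mul hh.le]
    norm_num
    rw [Real.rpow_neg_one]
    exact hyw.trans h1
  have h3 : |w x - w y| ≤ h ^ (1 / 2 : ℝ) * l2Norm v := by
    refine (hw.abs_sub_le hx (Ioo_subset_Icc_self (hsub hy))).trans ?_
    rw [Real.sqrt_eq_rpow]
    gcongr
    · exact l2Norm_nonneg v
    · exact _root_.abs_le.2 ⟨by linarith [hy.1, hy.2], by linarith [hy.1, hy.2]⟩
  have h4 := abs_add_le (w x - w y) (w y)
  rw [sub_add_cancel] at h4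
  linarith

lemma integral_pow_half {ε : ℝ} (hε : ε * ε = 1) (m : ℕ) :
    ∫ x, ((1 + ε * x) / 2) ^ m ∂μI = 2 / (m + 1) := by
  have hm : (m : ℝ) + 1 ≠ 0 := by positivity
  rw [integral_μI, intervalIntegral.integral_eq_sub_of_hasDerivAt
    (f := fun x => 2 * ε / (m + 1) * ((1 + ε * x) / 2) ^ (m + 1))]
  · have h1 : ε = 1 ∨ ε = -1 := mul_self_eq_one_iff.1 hε
    rcases h1 with rfl | rfl
    · norm_num
    · norm_num; ring
  · intro x _
    have h1 := (((((hasDerivAt_id x).const_mul ε).const_add 1).div_const 2).pow (m + 1)).const_mul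
      (2 * ε / (m + 1))
    refine h1.congr_deriv ?_
    simp only [id, Nat.add_sub_cancel]
    push_cast
    generalize ((1 + ε * x) / 2) ^ m = Y
    have h2 : 2 * ε / (m + 1) * ((m + 1) * Y * (ε * 1 / 2)) = ε * ε * Y := by field_simp
    rw [h2, hε, one_mul]
  · exact Continuous.intervalIntegrable (by fun_prop) _ _

/-- Boundary layers: the polynomial `((1 + ε x) / 2)^n`, `ε = ± 1`, has the value `1` at one
endpoint and `0` at the other, with `L²` norm of order `n^(-1/2)` and derivative of order
`n^(1/2)`. -/
lemma boundary_layer {ε : ℝ} (hε : ε * ε = 1) {n : ℕ} (hn : 1 ≤ n) :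
    ∃ v : ℝ → ℝ, HasL2Deriv (fun x => ((1 + ε * x) / 2) ^ n) v ∧
      l2Norm (fun x => ((1 + ε * x) / 2) ^ n) ≤ ((n : ℝ)⁻¹) ^ (1 / 2 : ℝ) ∧
      l2Norm v ≤ ((n : ℝ)⁻¹) ^ (-(1 / 2) : ℝ) := by
  have hn' : (1 : ℝ) ≤ n := by exact_mod_cast hn
  have hn0 : (0 : ℝ) < n := by linarith
  have hw := HasL2Deriv.of_contDiff (w := fun x : ℝ => ((1 + ε * x) / 2) ^ n) (by fun_prop)
  have hd : deriv (fun x : ℝ => ((1 + ε * x) / 2) ^ n)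
      = fun x => (n * ε / 2) * ((1 + ε * x) / 2) ^ (n - 1) := by
    ext x
    have h1 : HasDerivAt (fun x : ℝ => ((1 + ε * x) / 2) ^ n) _ x :=
      ((((hasDerivAt_id x).const_mul ε).const_add 1).div_const 2).pow n
    rw [h1.deriv]
    simp only [id]
    ring
  refine ⟨_, hw, ?_, ?_⟩
  · refine abs_le_of_sq_le_sq' ?_ (by positivity) |>.2
    rw [l2Norm_sq hw.memLp_left]
    simp only [← pow_mul]
    rw [integral_pow_half hε, ← Real.rpow_natCast, ← Real.rpow_mul (by positivity)]
    norm_num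
    rw [inv_eq_one_div, div_le_div_iff₀ (by positivity) (by positivity)]
    linarith
  · refine abs_le_of_sq_le_sq' ?_ (by positivity) |>.2
    rw [l2Norm_sq hw.memLp, hd]
    simp only [mul_pow, ← pow_mul]
    rw [integral_const_mul, integral_pow_half hε, ← Real.rpow_natCast (_ ^ _),
      ← Real.rpow_mul (by positivity)]
    norm_num
    rw [Real.rpow_neg_one, inv_inv, Nat.cast_sub hn, Nat.cast_one, div_pow, mul_pow,
      show ε ^ 2 = 1 by rw [sq, hε], mul_one, div_mul_div_comm, div_le_iff₀ (by linarith)]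
    nlinarith

end

/-! ### Dyadic approximations with prescribed boundary values -/

section
open Polynomial Filter Topology

lemma half_pow_rpow (j : ℕ) (a : ℝ) : ((1 / 2 : ℝ) ^ j) ^ a = ((1 / 2 : ℝ) ^ a) ^ j := by
  rw [← Real.rpow_natCast, ← Real.rpow_natCast, ← Real.rpow_mul (by norm_num),
    ← Real.rpow_mul (by norm_num), mul_comm]

lemma half_pow_rpow_succ_le (j : ℕ) {a : ℝ} (ha : -1 ≤ a) :
    ((1 / 2 : ℝ) ^ (j + 1)) ^ a ≤ 2 * ((1 / 2 : ℝ) ^ j) ^ a := by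
  rw [half_pow_rpow, half_pow_rpow, pow_succ, mul_comm]
  refine mul_le_mul_of_nonneg_right ?_ (by positivity)
  calc (1 / 2 : ℝ) ^ a ≤ (1 / 2 : ℝ) ^ (-1 : ℝ) :=
        Real.rpow_le_rpow_of_exponent_ge (by norm_num) (by norm_num) ha
    _ = 2 := by rw [Real.rpow_neg_one]; norm_num

/-- For `σ > 1/2`, the dyadic smoothings of `f` converge uniformly to a continuous representative
`g`. Correcting them by boundary layers gives approximations with the boundary values of `g`. -/
lemma exists_dyadic_approximation (σ : ℝ) (hσ : 1 / 2 < σ) (hσ1 : σ ≤ 1) :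
    ∃ C : ℝ, 0 < C ∧ ∀ f : ℝ → ℝ, MemLp f 2 μI → gagliardoSq σ f ≠ ⊤ →
      ∃ g : ℝ → ℝ, ContinuousOn g (Icc (-1) 1) ∧ f =ᵐ[μI] g ∧
        ∃ F D : ℕ → ℝ → ℝ, ∀ j, HasL2Deriv (F j) (D j) ∧ F j (-1) = g (-1) ∧ F j 1 = g 1 ∧
          l2Norm (f - F j) ≤ C * gagliardo σ f * ((1 / 2 : ℝ) ^ j) ^ σ ∧
          l2Norm (D j) ≤ C * gagliardo σ f * ((1 / 2 : ℝ) ^ j) ^ (σ - 1) := by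
  obtain ⟨M, hM, hS⟩ := exists_smoothing
  have hμ0 : 0 < (1 / 2 : ℝ) ^ (σ - 1 / 2) := by positivity
  have hμ1 : (1 / 2 : ℝ) ^ (σ - 1 / 2) < 1 :=
    Real.rpow_lt_one (by norm_num) (by norm_num) (by linarith)
  obtain ⟨μ, hμ⟩ : ∃ μ, μ = (1 / 2 : ℝ) ^ (σ - 1 / 2) := ⟨_, rfl⟩
  rw [← hμ] at hμ0 hμ1
  have hμ' : 0 < 1 - μ := by linarith
  refine ⟨(1 + 2 * (5 / (1 - μ))) * M, by positivity, fun f hf hG => ?_⟩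
  have hg := gagliardo_nonneg σ f
  obtain ⟨Q, hQ⟩ : ∃ Q, Q = M * gagliardo σ f := ⟨_, rfl⟩
  have hQ0 : 0 ≤ Q := by rw [hQ]; positivity
  obtain ⟨h, hh⟩ : ∃ h : ℕ → ℝ, h = fun j => (1 / 2 : ℝ) ^ j := ⟨_, rfl⟩
  have h0 : ∀ j, 0 < h j := fun j => by rw [hh]; positivity
  have h1 : ∀ j, h j ≤ 1 := fun j => by rw [hh]; exact pow_le_one₀ (by norm_num) (by norm_num)
  have hμj : ∀ j, h j ^ (σ - 1 / 2) = μ ^ j := fun j => by rw [hh, hμ]; exact half_pow_rpow _ _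
  have hμa : ∀ j, h j ^ (-(1 / 2) : ℝ) * h j ^ σ = μ ^ j := fun j => by
    rw [← hμj, ← Real.rpow_add (h0 j)]; congr 1; ring
  have hμb : ∀ j, h j ^ (1 / 2 : ℝ) * h j ^ (σ - 1) = μ ^ j := fun j => by
    rw [← hμj, ← Real.rpow_add (h0 j)]; congr 1; ring
  have hμc : ∀ j, μ ^ j * h j ^ (1 / 2 : ℝ) = h j ^ σ := fun j => by
    rw [← hμj, ← Real.rpow_add (h0 j)]; congr 1; ring
  have hμd : ∀ j, μ ^ j * h j ^ (-(1 / 2) : ℝ) = h j ^ (σ - 1) := fun j => by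
    rw [← hμj, ← Real.rpow_add (h0 j)]; congr 1; ring
  choose w v hw hwf hv using fun j => hS σ f (by linarith) hσ1 hf hG (h j) (h0 j) (h1 j)
  have hwf' : ∀ j, l2Norm (f - w j) ≤ Q * h j ^ σ := fun j => (hwf j).trans_eq (by rw [hQ]; ring)
  have hv' : ∀ j, l2Norm (v j) ≤ Q * h j ^ (σ - 1) := fun j => (hv j).trans_eq (by rw [hQ]; ring)
  -- consecutive smoothings are uniformly close
  have hsup : ∀ x ∈ Icc (-1 : ℝ) 1, ∀ j, dist (w j x) (w (j + 1) x) ≤ 5 * Q * μ ^ j := by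
    intro x hx j
    have hd := (hw (j + 1)).sub (hw j)
    have e1 : l2Norm (w (j + 1) - w j) ≤ 2 * Q * h j ^ σ := by
      have e : w (j + 1) - w j = (f - w j) - (f - w (j + 1)) := by abel
      have e2 : h (j + 1) ^ σ ≤ h j ^ σ := by
        refine Real.rpow_le_rpow (h0 _).le ?_ (by linarith)
        rw [hh]
        exact pow_le_pow_of_le_one (by norm_num) (by norm_num) j.le_succ
      rw [e]
      refine (l2Norm_sub_le (hf.sub (hw j).memLp_left) (hf.sub (hw (j + 1)).memLp_left)).trans ?_
      have := hwf' j
      have := hwf' (j + 1)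
      nlinarith
    have e2 : l2Norm (v (j + 1) - v j) ≤ 3 * Q * h j ^ (σ - 1) := by
      refine (l2Norm_sub_le (hw (j + 1)).memLp (hw j).memLp).trans ?_
      have e3 : h (j + 1) ^ (σ - 1) ≤ 2 * h j ^ (σ - 1) := by
        rw [hh]; exact half_pow_rpow_succ_le j (by linarith)
      have := hv' j
      have := hv' (j + 1)
      nlinarith
    rw [dist_comm, Real.dist_eq]
    have ha := (h0 j).le
    calc |w (j + 1) x - w j x| ≤ _ := hd.abs_le (h0 j) (h1 j) hx
      _ ≤ h j ^ (-(1 / 2) : ℝ) * (2 * Q * h j ^ σ)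
          + h j ^ (1 / 2 : ℝ) * (3 * Q * h j ^ (σ - 1)) := by gcongr
      _ = 2 * Q * (h j ^ (-(1 / 2) : ℝ) * h j ^ σ)
          + 3 * Q * (h j ^ (1 / 2 : ℝ) * h j ^ (σ - 1)) := by ring
      _ = 5 * Q * μ ^ j := by rw [hμa, hμb]; ring
  obtain ⟨g, hgl⟩ : ∃ g : ℝ → ℝ, ∀ x ∈ Icc (-1 : ℝ) 1,
      Tendsto (fun j => w j x) atTop (𝓝 (g x)) :=
    ⟨fun x => limUnder atTop fun j => w j x, fun x hx =>
      (cauchySeq_of_le_geometric μ _ hμ1 (hsup x hx)).tendsto_limUnder⟩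
  have hgd : ∀ x ∈ Icc (-1 : ℝ) 1, ∀ j, |g x - w j x| ≤ 5 / (1 - μ) * Q * μ ^ j := by
    intro x hx j
    have := dist_le_of_le_geometric_of_tendsto μ _ hμ1 (hsup x hx) (hgl x hx) j
    rw [dist_comm, Real.dist_eq] at this
    exact this.trans_eq (by ring)
  have hlim : ∀ c : ℝ, Tendsto (fun j => c * μ ^ j) atTop (𝓝 0) := fun c => by
    simpa using (tendsto_pow_atTop_nhds_zero_of_lt_one hμ0.le hμ1).const_mul c
  have hgc : ContinuousOn g (Icc (-1) 1) := by
    have hu : TendstoUniformlyOn w g atTop (Icc (-1) 1) := by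
      rw [Metric.tendstoUniformlyOn_iff]
      intro ε hε
      filter_upwards [(hlim (5 / (1 - μ) * Q)).eventually_lt_const hε] with j hj x hx
      rw [Real.dist_eq]
      exact (hgd x hx j).trans_lt hj
    exact hu.continuousOn (Eventually.of_forall fun j => (hw j).continuousOn).frequently
  have hgm : MemLp g 2 μI := memLp_of_continuousOn hgc
  have hfg : f =ᵐ[μI] g := by
    have hle : ∀ j, l2Norm (f - g) ≤ (1 + 2 * (5 / (1 - μ))) * Q * μ ^ j := by
      intro j
      have e : f - g = (f - w j) - (g - w j) := by abel
      have e1 : l2Norm (g - w j) ≤ 2 * (5 / (1 - μ) * Q * μ ^ j) :=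
        l2Norm_le_of_bound (by positivity) fun x hx => hgd x (Ioo_subset_Icc_self hx) j
      have e2 : h j ^ σ ≤ μ ^ j := by
        rw [← hμj]
        exact Real.rpow_le_rpow_of_exponent_ge (h0 j) (h1 j) (by linarith)
      rw [e]
      refine (l2Norm_sub_le (hf.sub (hw j).memLp_left) (hgm.sub (hw j).memLp_left)).trans ?_
      have := hwf' j
      nlinarith
    have hz : l2Norm (f - g) = 0 :=
      le_antisymm (ge_of_tendsto' (hlim _) hle) (l2Norm_nonneg _)
    have hz' : eLpNorm (f - g) 2 μI = 0 := by
      rw [← ofReal_l2Norm (hf.sub hgm), hz, ENNReal.ofReal_zero]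
    rw [eLpNorm_eq_zero_iff (hf.sub hgm).1 (by norm_num)] at hz'
    filter_upwards [hz'] with x hx
    simpa [sub_eq_zero] using hx
  refine ⟨g, hgc, hfg, ?_⟩
  have hn : ∀ j : ℕ, 1 ≤ 2 ^ j := fun j => Nat.one_le_two_pow
  have hnh : ∀ j : ℕ, (((2 ^ j : ℕ) : ℝ))⁻¹ = h j := fun j => by rw [hh]; simp
  choose ep hep hep1 hep2 using fun j => boundary_layer (ε := 1) (by norm_num) (hn j)
  choose em hem hem1 hem2 using fun j => boundary_layer (ε := -1) (by norm_num) (hn j)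
  simp only [hnh] at hep1 hep2 hem1 hem2
  have hcp : ∀ j, |g 1 - w j 1| ≤ 5 / (1 - μ) * Q * μ ^ j := hgd 1 (by simp)
  have hcm : ∀ j, |g (-1) - w j (-1)| ≤ 5 / (1 - μ) * Q * μ ^ j := hgd (-1) (by simp)
  have hL : ∀ j, HasL2Deriv _ _ := fun j =>
    ((hep j).const_smul (g 1 - w j 1)).add ((hem j).const_smul (g (-1) - w j (-1)))
  refine ⟨_, _, fun j => ⟨(hw j).add (hL j), ?_, ?_, ?_, ?_⟩⟩
  · simp
  · simp
  · rw [← sub_sub, mul_assoc _ M, ← hQ]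
    refine (l2Norm_sub_le (hf.sub (hw j).memLp_left) (hL j).memLp_left).trans ?_
    have h2 := l2Norm_add_le ((hep j).const_smul (g 1 - w j 1)).memLp_left
      ((hem j).const_smul (g (-1) - w j (-1))).memLp_left
    rw [l2Norm_const_smul, l2Norm_const_smul] at h2
    have ha := (h0 j).le
    have h3 := mul_le_mul (hcp j) (hep1 j) (l2Norm_nonneg _) (by positivity)
    have h4 := mul_le_mul (hcm j) (hem1 j) (l2Norm_nonneg _) (by positivity)
    rw [mul_assoc _ (μ ^ j), hμc] at h3 h4
    have h5 := hwf' j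
    have e : (1 / 2 : ℝ) ^ j = h j := by rw [hh]
    rw [e]
    linarith
  · rw [mul_assoc _ M, ← hQ]
    refine (l2Norm_add_le (hw j).memLp (hL j).memLp).trans ?_
    have h2 := l2Norm_add_le ((hep j).const_smul (g 1 - w j 1)).memLp
      ((hem j).const_smul (g (-1) - w j (-1))).memLp
    rw [l2Norm_const_smul, l2Norm_const_smul] at h2
    have ha := (h0 j).le
    have h3 := mul_le_mul (hcp j) (hep2 j) (l2Norm_nonneg _) (by positivity)
    have h4 := mul_le_mul (hcm j) (hem2 j) (l2Norm_nonneg _) (by positivity)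
    rw [mul_assoc _ (μ ^ j), hμd] at h3 h4
    have h5 := hv' j
    have e : (1 / 2 : ℝ) ^ j = h j := by rw [hh]
    rw [e]
    linarith

end

section
open Polynomial

lemma kFunctional_congr {t τ : ℝ} {u u' : ℝ → ℝ} (h : u =ᵐ[μI] u') :
    kFunctional t τ u = kFunctional t τ u' := by
  unfold kFunctional
  refine iInf_congr fun u₀ => iInf_congr fun u₁ => iInf_congr fun _ => iInf_congr fun _ => ?_
  exact iInf_congr_Prop ⟨fun h' => h.symm.trans h', fun h' => h.trans h'⟩ fun _ => rfl

lemma tildeNorm_congr {t s : ℝ} {u u' : ℝ → ℝ} (h : u =ᵐ[μI] u') :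
    tildeNorm t s u = tildeNorm t s u' := by
  unfold tildeNorm
  simp only [kFunctional_congr h]

/-- Summing dyadic pieces `F (J + i + 1) - F (J + i)` in `H^t`. As the growth `b > 1` of the
bounds of the pieces is geometric, the last piece dominates. -/
lemma energyNorm_telescope_le {t b E : ℝ} (hb : 1 < b) (hE : 0 ≤ E) {F D : ℕ → ℝ → ℝ}
    (hF : ∀ j, HasL2Deriv (F j) (D j)) {z z' : ℝ → ℝ} (hz : HasL2Deriv z z')
    (h0 : energyNorm t (F 0 - z) (D 0 - z') ≤ ENNReal.ofReal E)
    (hs : ∀ i, energyNorm t (F (i + 1) - F i) (D (i + 1) - D i) ≤ ENNReal.ofReal (E * b ^ i))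
    (k : ℕ) : energyNorm t (F k - z) (D k - z') ≤
      ENNReal.ofReal ((1 + 1 / (b - 1)) * E * b ^ k) := by
  have hb' : 0 < b - 1 := by linarith
  induction k with
  | zero =>
    refine h0.trans (ENNReal.ofReal_le_ofReal ?_)
    have : 0 ≤ 1 / (b - 1) * E := by positivity
    rw [pow_zero]; linarith
  | succ k ih =>
    have e1 : F (k + 1) - z = (F (k + 1) - F k) + (F k - z) := by abel
    have e2 : D (k + 1) - z' = (D (k + 1) - D k) + (D k - z') := by abel
    rw [e1, e2]
    refine (energyNorm_add_le ((hF _).sub (hF _)) ((hF _).sub hz)).trans ?_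
    refine (add_le_add (hs k) ih).trans ?_
    rw [← ENNReal.ofReal_add (by positivity) (by positivity)]
    refine ENNReal.ofReal_le_ofReal ?_
    have e3 : (1 + 1 / (b - 1)) * b = (1 + 1 / (b - 1)) + b := by field_simp; ring
    calc E * b ^ k + (1 + 1 / (b - 1)) * E * b ^ k
        = E * b ^ k * ((1 + 1 / (b - 1)) + 1) := by ring
      _ ≤ E * b ^ k * ((1 + 1 / (b - 1)) + b) := by gcongr
      _ = _ := by rw [← e3, pow_succ]; ring

/-- The case `1/2 < r < 1`: the interpolant of the dyadic approximation at scale `1 / p`; at the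
smaller scales the dyadic approximations split the K-functional. -/
lemma exists_approximation_of_gagliardo (σ : ℝ) (hσ : 1 / 2 < σ) (hσ1 : σ ≤ 1) (t : ℝ)
    (ht : 1 / 2 < t) (ht1 : t ≤ 1) :
    ∃ C : ℝ, 0 < C ∧ ∀ f : ℝ → ℝ, MemLp f 2 μI → gagliardoSq σ f ≠ ⊤ →
      ∃ g : ℝ → ℝ, ContinuousOn g (Icc (-1) 1) ∧ f =ᵐ[μI] g ∧
        ∀ p : ℕ, 1 ≤ p → ∃ q : ℝ[X], q.natDegree ≤ p ∧ q.eval (-1) = g (-1) ∧ q.eval 1 = g 1 ∧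
          tildeNorm t (1 / 2) (fun x => f x - q.eval x) ≤
            ENNReal.ofReal (C * (p : ℝ) ^ (-(σ - 1 / 2)) * gagliardo σ f) := by
  have ht0 : 0 < t := by linarith
  obtain ⟨C, hC, hA⟩ := exists_dyadic_approximation σ hσ hσ1
  obtain ⟨A, hA0, hN⟩ := exists_energyNorm_le ht0 ht1
  -- an exponent `s` with `1/2 < s < t` and `s ≤ σ`
  obtain ⟨s, hs, hst, hsσ⟩ : ∃ s, 1 / 2 < s ∧ s < t ∧ s ≤ σ :=
    ⟨min σ ((t + 1 / 2) / 2), lt_min hσ (by linarith), (min_le_right _ _).trans_lt (by linarith),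
      min_le_left _ _⟩
  obtain ⟨b, hb⟩ : ∃ b, b = (2 : ℝ) ^ (t - s) := ⟨_, rfl⟩
  have hb1 : 1 < b := by rw [hb]; exact Real.one_lt_rpow (by norm_num) (by linarith)
  have hb' : 0 < b - 1 := by linarith
  obtain ⟨K, hK⟩ : ∃ K, K = 1 + 1 / (b - 1) := ⟨_, rfl⟩
  have hK0 : 0 < K := by rw [hK]; positivity
  have hθ : 1 / (2 * t) < s / t := by rw [div_lt_div_iff₀ (by positivity) ht0]; nlinarith
  have hθ' : 0 < 2 * (s / t) - 1 / t := by
    have : 1 / (2 * t) = 1 / t / 2 := by field_simp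
    linarith
  refine ⟨√(1 / (2 * (s / t) - 1 / t) + t) * (4 * (2 * C + 5 * A * C * K)), by positivity,
    fun f hf hG => ?_⟩
  obtain ⟨g, hgc, hfg, F, D, hFD⟩ := hA f hf hG
  refine ⟨g, hgc, hfg, fun p hp => ?_⟩
  have hp' : (1 : ℝ) ≤ p := by exact_mod_cast hp
  have hp0 : (0 : ℝ) < p := by linarith
  have hgn := gagliardo_nonneg σ f
  obtain ⟨Q, hQ⟩ : ∃ Q, Q = C * gagliardo σ f := ⟨_, rfl⟩
  have hQ0 : 0 ≤ Q := by rw [hQ]; positivity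
  obtain ⟨h, hh⟩ : ∃ h : ℕ → ℝ, h = fun j => (1 / 2 : ℝ) ^ j := ⟨_, rfl⟩
  have h0 : ∀ j, 0 < h j := fun j => by rw [hh]; positivity
  have h1 : ∀ j, h j ≤ 1 := fun j => by rw [hh]; exact pow_le_one₀ (by norm_num) (by norm_num)
  have hadd : ∀ i j, h (i + j) = h i * h j := fun i j => by rw [hh]; exact pow_add _ _ _
  have hF : ∀ j, HasL2Deriv (F j) (D j) := fun j => (hFD j).1
  have hFf : ∀ j, l2Norm (f - F j) ≤ Q * h j ^ σ := fun j => by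
    rw [hQ, hh]; exact (hFD j).2.2.2.1
  have hD : ∀ j, l2Norm (D j) ≤ Q * h j ^ (σ - 1) := fun j => by
    rw [hQ, hh]; exact (hFD j).2.2.2.2
  -- the dyadic scale just above `1 / p`
  obtain ⟨J, hJ1, hJ2⟩ : ∃ J, h J * p ≥ 1 ∧ h J * p ≤ 2 := by
    refine ⟨Nat.log 2 p, ?_, ?_⟩
    · have : ((2 ^ Nat.log 2 p : ℕ) : ℝ) ≤ p := by exact_mod_cast Nat.pow_log_le_self 2 (by omega)
      rw [hh]
      simp only [one_div, inv_pow]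
      rw [ge_iff_le, ← div_eq_inv_mul, le_div_iff₀ (by positivity), one_mul]
      exact_mod_cast this
    · have : (p : ℝ) ≤ ((2 ^ (Nat.log 2 p + 1) : ℕ) : ℝ) := by
        exact_mod_cast (Nat.lt_pow_succ_log_self (by norm_num) p).le
      rw [hh]
      simp only [one_div, inv_pow]
      rw [← div_eq_inv_mul, div_le_iff₀ (by positivity)]
      push_cast at this
      rw [pow_succ] at this
      linarith
  have hhJ := h0 J
  obtain ⟨q, hqd, hq1, hq2, -, hopt, hle⟩ := (hF J).exists_interpolant hp
  refine ⟨q, hqd, hq1.trans (hFD J).2.1, hq2.trans (hFD J).2.2.1, ?_⟩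
  have hP := HasL2Deriv.of_polynomial q
  have hDq : l2Norm (D J - fun x => (derivative q).eval x) ≤ Q * h J ^ (σ - 1) := by
    refine le_trans ?_ (hD J)
    have := hopt 0 (by rw [degree_zero]; exact WithBot.bot_lt_coe p)
    simpa [Pi.sub_def] using this
  have hFq : l2Norm (F J - fun x => q.eval x) ≤ Q * h J ^ σ := by
    have e : h J ^ σ = h J * h J ^ (σ - 1) := by
      rw [← Real.rpow_one_add' hhJ.le (by linarith)]; congr 1; ring
    have h2 : p * l2Norm (F J - fun x => q.eval x) ≤ p * (Q * h J ^ σ) := by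
      refine (hle.trans hDq).trans ?_
      calc Q * h J ^ (σ - 1) ≤ h J * p * (Q * h J ^ (σ - 1)) :=
            le_mul_of_one_le_left (by positivity) hJ1
        _ = p * (Q * h J ^ σ) := by rw [e]; ring
    exact le_of_mul_le_mul_left h2 hp0
  have hu : MemLp (fun x => f x - q.eval x) 2 μI := hf.sub hP.memLp_left
  -- the `H^t` norms of the pieces
  have hsplit : ∀ j, h j ^ (-t) * h j ^ σ = h j ^ (σ - t) ∧
      h j ^ (1 - t) * h j ^ (σ - 1) = h j ^ (σ - t) := fun j => by
    rw [← Real.rpow_add (h0 j), ← Real.rpow_add (h0 j)]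
    constructor <;> (congr 1; ring)
  have hE0 : energyNorm t (F J - fun x => q.eval x) (D J - fun x => (derivative q).eval x) ≤
      ENNReal.ofReal (5 * A * Q * h J ^ (σ - t)) := by
    refine (hN _ _ ((hF J).sub hP) (h J) hhJ (h1 J)).trans (ENNReal.ofReal_le_ofReal ?_)
    calc _ ≤ A * (h J ^ (-t) * (Q * h J ^ σ) + h J ^ (1 - t) * (Q * h J ^ (σ - 1))) := by gcongr
      _ = A * Q * (h J ^ (-t) * h J ^ σ + h J ^ (1 - t) * h J ^ (σ - 1)) := by ring
      _ = 2 * (A * Q * h J ^ (σ - t)) := by rw [(hsplit J).1, (hsplit J).2]; ring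
      _ ≤ _ := by
        have : 0 ≤ A * Q * h J ^ (σ - t) := by positivity
        linarith
  have hEi : ∀ i, energyNorm t (F (J + (i + 1)) - F (J + i)) (D (J + (i + 1)) - D (J + i)) ≤
      ENNReal.ofReal (5 * A * Q * h J ^ (σ - t) * b ^ i) := by
    intro i
    refine (hN _ _ ((hF _).sub (hF _)) (h (J + i)) (h0 _) (h1 _)).trans
      (ENNReal.ofReal_le_ofReal ?_)
    have ha := (h0 (J + i)).le
    have a1 : l2Norm (F (J + (i + 1)) - F (J + i)) ≤ 2 * Q * h (J + i) ^ σ := by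
      have e : F (J + (i + 1)) - F (J + i) = (f - F (J + i)) - (f - F (J + (i + 1))) := by abel
      have e2 : h (J + (i + 1)) ^ σ ≤ h (J + i) ^ σ := by
        refine Real.rpow_le_rpow (h0 _).le ?_ (by linarith)
        rw [hh]
        exact pow_le_pow_of_le_one (by norm_num) (by norm_num) (by omega)
      rw [e]
      refine (l2Norm_sub_le (hf.sub (hF _).memLp_left) (hf.sub (hF _).memLp_left)).trans ?_
      have c1 := hFf (J + i)
      have c2 := hFf (J + (i + 1))
      have c3 := mul_le_mul_of_nonneg_left e2 hQ0
      linarith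
    have a2 : l2Norm (D (J + (i + 1)) - D (J + i)) ≤ 3 * Q * h (J + i) ^ (σ - 1) := by
      have e2 : h (J + (i + 1)) ^ (σ - 1) ≤ 2 * h (J + i) ^ (σ - 1) := by
        rw [hh]; exact half_pow_rpow_succ_le (J + i) (by linarith)
      refine (l2Norm_sub_le (hF _).memLp (hF _).memLp).trans ?_
      have c1 := hD (J + i)
      have c2 := hD (J + (i + 1))
      have c3 := mul_le_mul_of_nonneg_left e2 hQ0
      linarith
    calc _ ≤ A * (h (J + i) ^ (-t) * (2 * Q * h (J + i) ^ σ)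
          + h (J + i) ^ (1 - t) * (3 * Q * h (J + i) ^ (σ - 1))) := by gcongr
      _ = A * Q * (2 * (h (J + i) ^ (-t) * h (J + i) ^ σ)
          + 3 * (h (J + i) ^ (1 - t) * h (J + i) ^ (σ - 1))) := by ring
      _ = 5 * A * Q * (h J ^ (σ - t) * h i ^ (σ - t)) := by
        rw [(hsplit _).1, (hsplit _).2, hadd, Real.mul_rpow hhJ.le (h0 i).le]; ring
      _ ≤ 5 * A * Q * (h J ^ (σ - t) * b ^ i) := by
        gcongr
        rw [hh, hb]
        simp only
        rw [half_pow_rpow]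
        gcongr
        rw [one_div, Real.inv_rpow (by norm_num), ← Real.rpow_neg (by norm_num)]
        exact Real.rpow_le_rpow_of_exponent_le (by norm_num) (by linarith)
      _ = _ := by ring
  have hE := energyNorm_telescope_le (t := t) (F := fun i => F (J + i)) (D := fun i => D (J + i))
    hb1 (by positivity) (fun i => hF (J + i)) hP hE0 hEi
  -- from the scale `h J` to `1 / p`
  have hJσ : h J ^ σ ≤ 2 * (p : ℝ) ^ (-σ) := by
    have e : h J ≤ 2 * (p : ℝ)⁻¹ := by
      rw [← div_eq_mul_inv, le_div_iff₀ hp0]; exact hJ2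
    calc h J ^ σ ≤ (2 * (p : ℝ)⁻¹) ^ σ := Real.rpow_le_rpow hhJ.le e (by linarith)
      _ = 2 ^ σ * (p : ℝ) ^ (-σ) := by
        rw [Real.mul_rpow (by norm_num) (by positivity), Real.inv_rpow hp0.le, Real.rpow_neg hp0.le]
      _ ≤ 2 * (p : ℝ) ^ (-σ) := by
        gcongr
        calc (2 : ℝ) ^ σ ≤ 2 ^ (1 : ℝ) := Real.rpow_le_rpow_of_exponent_le (by norm_num) hσ1
          _ = 2 := Real.rpow_one 2
  have hpσ : (0 : ℝ) < (p : ℝ) ^ (-σ) := by positivity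
  have hB0 : 0 ≤ 4 * (2 + 5 * A * K) * Q * (p : ℝ) ^ (-σ) := by positivity
  have hfin := tildeNorm_le (u := fun x => f x - q.eval x) (P := (p : ℝ) ^ t) ht0 hθ hB0
    (by positivity) (fun τ hτ => ?_) (fun τ hτ hτP => ?_)
  · refine hfin.trans (ENNReal.ofReal_le_ofReal (le_of_eq ?_))
    rw [← rpow_mul_rpow_half hp0 ht0, hQ]
    ring
  · refine (kFunctional_le_eLpNorm ht0 ht1 hu).trans ?_
    rw [← ofReal_l2Norm hu]
    refine ENNReal.ofReal_le_ofReal ?_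
    have e : (fun x => f x - q.eval x) = (f - F J) + (F J - fun x => q.eval x) := by
      ext x; simp
    rw [e]
    refine (l2Norm_add_le (hf.sub (hF J).memLp_left) ((hF J).sub hP).memLp_left).trans ?_
    have a1 := hFf J
    have a2 := mul_le_mul_of_nonneg_left hJσ hQ0
    have a3 : 0 ≤ A * K * Q * (p : ℝ) ^ (-σ) := by positivity
    have a4 : 0 ≤ Q * (p : ℝ) ^ (-σ) := by positivity
    linarith
  · -- the dyadic scale just above `τ^(1/t)`
    obtain ⟨y, hy⟩ : ∃ y, y = τ ^ (1 / t) := ⟨_, rfl⟩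
    have hy0 : 0 < y := by rw [hy]; positivity
    have hyt : y ^ t = τ := by
      rw [hy, ← Real.rpow_mul hτ.le, one_div_mul_cancel ht0.ne', Real.rpow_one]
    have hyp : y * p < 1 := by
      by_contra hge
      push Not at hge
      have := Real.one_le_rpow hge ht0.le
      rw [Real.mul_rpow hy0.le hp0.le, hyt] at this
      linarith
    have hy1 : y ≤ 1 := (le_mul_of_one_le_right hy0.le hp').trans hyp.le
    obtain ⟨j, hj1, hj2⟩ := exists_nat_pow_near_of_lt_one hy0 hy1
      (show (0 : ℝ) < 1 / 2 by norm_num) (by norm_num)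
    have hJj : J ≤ j := by
      by_contra hlt
      push Not at hlt
      have e1 : h J ≤ (1 / 2 : ℝ) ^ (j + 1) := by
        rw [hh]; exact pow_le_pow_of_le_one (by norm_num) (by norm_num) hlt
      have e2 : h J * p ≤ y * p := by gcongr; exact e1.trans hj1.le
      linarith
    obtain ⟨k, rfl⟩ := Nat.exists_eq_add_of_le hJj
    have hyj : y ≤ h (J + k) := by rw [hh]; exact hj2
    have hyj2 : h (J + k) ≤ 2 * y := by
      rw [hh]
      rw [pow_succ] at hj1
      simp only
      linarith
    refine (kFunctional_le ht0 ht1 hu ((hF (J + k)).sub hP)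
      (by simp only [Pi.sub_apply]; rw [hq1, (hFD J).2.1, (hFD (J + k)).2.1, sub_self])
      (by simp only [Pi.sub_apply]; rw [hq2, (hFD J).2.2.1, (hFD (J + k)).2.2.1,
        sub_self])).trans ?_
    have e : (fun x => f x - q.eval x) - (F (J + k) - fun x => q.eval x) = f - F (J + k) := by
      ext x; simp
    rw [e, ← ofReal_l2Norm (hf.sub (hF (J + k)).memLp_left)]
    refine (add_le_add le_rfl (mul_le_mul_right (hE k) _)).trans ?_
    rw [← ENNReal.ofReal_mul hτ.le, ← ENNReal.ofReal_add (l2Norm_nonneg _) (by positivity), ← hK]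
    refine ENNReal.ofReal_le_ofReal ?_
    have hk0 := h0 k
    -- both parts of the splitting are of the order of `h J ^ σ * h k ^ s`
    have b1 : h (J + k) ^ σ ≤ h J ^ σ * h k ^ s := by
      rw [hadd, Real.mul_rpow hhJ.le hk0.le]
      gcongr ?_ * ?_
      exact Real.rpow_le_rpow_of_exponent_ge hk0 (h1 k) hsσ
    have b2 : τ * (h J ^ (σ - t) * b ^ k) ≤ h J ^ σ * h k ^ s := by
      have c1 : τ ≤ h J ^ t * h k ^ t := by
        rw [← hyt, ← Real.mul_rpow hhJ.le hk0.le, ← hadd]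
        exact Real.rpow_le_rpow hy0.le hyj ht0.le
      have c2 : b ^ k = h k ^ (s - t) := by
        rw [hh, hb]
        simp only
        rw [half_pow_rpow, one_div, Real.inv_rpow (by norm_num), ← Real.rpow_neg (by norm_num),
          neg_sub]
      calc τ * (h J ^ (σ - t) * b ^ k) ≤ h J ^ t * h k ^ t * (h J ^ (σ - t) * b ^ k) := by gcongr
        _ = (h J ^ t * h J ^ (σ - t)) * (h k ^ t * h k ^ (s - t)) := by rw [c2]; ring
        _ = _ := by
          rw [← Real.rpow_add hhJ, ← Real.rpow_add hk0]
          congr 2 <;> ring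
    have b3 : h k ^ s ≤ 2 * (τ * (p : ℝ) ^ t) ^ (s / t) := by
      have c1 : (τ * (p : ℝ) ^ t) ^ (s / t) = (y * p) ^ s := by
        rw [← hyt, ← Real.mul_rpow hy0.le hp0.le, ← Real.rpow_mul (by positivity)]
        congr 1
        field_simp
      have c2 : h k ≤ 2 * (y * p) := by
        have c3 : h k ≤ h (J + k) * p := by
          calc h k ≤ h J * p * h k := le_mul_of_one_le_left hk0.le hJ1
            _ = h (J + k) * p := by rw [hadd]; ring
        have c4 : h (J + k) * p ≤ 2 * y * p := by gcongr
        linarith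
      rw [c1]
      calc h k ^ s ≤ (2 * (y * p)) ^ s := Real.rpow_le_rpow hk0.le c2 (by linarith)
        _ = 2 ^ s * (y * p) ^ s := Real.mul_rpow (by norm_num) (by positivity)
        _ ≤ 2 * (y * p) ^ s := by
          gcongr
          calc (2 : ℝ) ^ s ≤ 2 ^ (1 : ℝ) :=
                Real.rpow_le_rpow_of_exponent_le (by norm_num) (by linarith)
            _ = 2 := Real.rpow_one 2
    have b4 : h J ^ σ * h k ^ s ≤ 4 * ((p : ℝ) ^ (-σ) * (τ * (p : ℝ) ^ t) ^ (s / t)) := by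
      calc h J ^ σ * h k ^ s ≤ (2 * (p : ℝ) ^ (-σ)) * (2 * (τ * (p : ℝ) ^ t) ^ (s / t)) := by
            gcongr
        _ = _ := by ring
    calc l2Norm (f - F (J + k)) + τ * (K * (5 * A * Q * h J ^ (σ - t)) * b ^ k)
        ≤ Q * (h J ^ σ * h k ^ s) + 5 * A * K * Q * (h J ^ σ * h k ^ s) := by
          refine add_le_add ((hFf _).trans (by gcongr)) ?_
          calc _ = 5 * A * K * Q * (τ * (h J ^ (σ - t) * b ^ k)) := by ring
            _ ≤ _ := by gcongr
      _ = (1 + 5 * A * K) * Q * (h J ^ σ * h k ^ s) := by ring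
      _ ≤ (2 + 5 * A * K) * Q * (4 * ((p : ℝ) ^ (-σ) * (τ * (p : ℝ) ^ t) ^ (s / t))) := by
          gcongr
          norm_num
      _ = _ := by ring

/-! ### Functions in `H^r` -/

/-- The expression of which the norm of `H^r(I)` is the infimum. -/
noncomputable def sobolevValue (r : ℝ) (V : ℕ → ℝ → ℝ) : ℝ≥0∞ :=
  ((∑ k ∈ Finset.range (⌊r⌋₊ + 1), eLpNorm (V k) 2 μI ^ 2) +
    (if Int.fract r = 0 then 0 else gagliardoSq (Int.fract r) (V ⌊r⌋₊))) ^ (1 / 2 : ℝ)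

lemma gagliardoSq_congr {σ : ℝ} {u v : ℝ → ℝ} (h : u =ᵐ[μI] v) :
    gagliardoSq σ u = gagliardoSq σ v := by
  refine lintegral_congr_ae ?_
  filter_upwards [h] with x hx
  refine lintegral_congr_ae ?_
  filter_upwards [h] with y hy
  rw [hx, hy]

/-- Weak derivatives are unique, so the infimum in the norm of `H^r(I)` is attained by any choice
of them. -/
lemma sobolevNorm_eq_sobolevValue {r : ℝ} {f : ℝ → ℝ} {V : ℕ → ℝ → ℝ}
    (hV : ∀ k ≤ ⌊r⌋₊, HasWeakDeriv k f (V k)) : sobolevNorm r f = sobolevValue r V := by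
  refine le_antisymm (iInf₂_le V hV) (le_iInf₂ fun W hW => le_of_eq ?_)
  have h := fun k hk => (hV k hk).unique (hW k hk)
  unfold sobolevValue
  rw [gagliardoSq_congr (h _ le_rfl), Finset.sum_congr rfl fun k hk => by
    rw [eLpNorm_congr_ae (h k (Nat.lt_succ_iff.1 (Finset.mem_range.1 hk)))]]

lemma le_rpow_half {a b : ℝ≥0∞} (h : a ^ 2 ≤ b) : a ≤ b ^ (1 / 2 : ℝ) := by
  calc a = (a ^ 2) ^ (1 / 2 : ℝ) := by
        rw [← ENNReal.rpow_natCast, ← ENNReal.rpow_mul]; norm_num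
    _ ≤ _ := ENNReal.rpow_le_rpow h (by norm_num)

lemma exists_sobolevData {r : ℝ} {f : ℝ → ℝ} (hf : MemSobolev r f) :
    ∃ V, SobolevData r f V (sobolevNorm r f).toReal := by
  obtain ⟨V, hV⟩ : ∃ V : ℕ → ℝ → ℝ, ∀ k ≤ ⌊r⌋₊, HasWeakDeriv k f (V k) := by
    by_contra hne
    push Not at hne
    refine hf.ne ?_
    refine iInf_eq_top.2 fun V => iInf_eq_top.2 fun hV => ?_
    obtain ⟨k, hk, hk'⟩ := hne V
    exact absurd (hV k hk) hk'
  have hval := sobolevNorm_eq_sobolevValue hV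
  have htop : sobolevNorm r f ≠ ⊤ := hf.ne
  have h1 : ∀ k ≤ ⌊r⌋₊, eLpNorm (V k) 2 μI ≤ sobolevNorm r f := fun k hk => by
    rw [hval]
    refine le_rpow_half (le_add_right ?_)
    exact Finset.single_le_sum (f := fun k => eLpNorm (V k) 2 μI ^ 2) (fun _ _ => zero_le)
      (Finset.mem_range.2 (Nat.lt_succ_of_le hk))
  have h2 : Int.fract r ≠ 0 →
      gagliardoSq (Int.fract r) (V ⌊r⌋₊) ^ (1 / 2 : ℝ) ≤ sobolevNorm r f := fun h0 => by
    rw [hval, sobolevValue, if_neg h0]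
    exact ENNReal.rpow_le_rpow le_add_self (by norm_num)
  refine ⟨V, hV, fun k hk => ⟨?_, (h1 k hk).trans_lt hf⟩,
    fun k hk => ENNReal.toReal_mono htop (h1 k hk), fun h0 hG => ?_,
    fun h0 => ENNReal.toReal_mono htop (h2 h0)⟩
  · exact (hV k hk).2.1.aestronglyMeasurable
  · have := h2 h0
    rw [hG, ENNReal.top_rpow_of_pos (by norm_num)] at this
    exact htop (top_le_iff.1 this)

end

end PApprox

theorem lemma2p1 (r : ℝ) (hr : 1 / 2 < r) (t : ℝ) (ht : 1 / 2 < t) (ht1 : t ≤ 1) :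
    ∃ C : ℝ, 0 < C ∧
      ∀ f : ℝ → ℝ, PApprox.MemSobolev r f →
        ∃ g : ℝ → ℝ, ContinuousOn g (Set.Icc (-1) 1) ∧ f =ᵐ[PApprox.μI] g ∧
          ∀ p : ℕ, 1 ≤ p →
            ∃ q : Polynomial ℝ, q.natDegree ≤ p ∧ q.eval (-1) = g (-1) ∧ q.eval 1 = g 1 ∧
              PApprox.tildeNorm t (1 / 2) (fun x => f x - q.eval x) ≤
                ENNReal.ofReal (C * (p : ℝ) ^ (-(r - 1 / 2))) * PApprox.sobolevNorm r f := by
  have hfin : ∀ (C : ℝ) (p : ℕ) (f : ℝ → ℝ), 0 < C → PApprox.MemSobolev r f →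
      ENNReal.ofReal (C * (p : ℝ) ^ (-(r - 1 / 2)) * (PApprox.sobolevNorm r f).toReal) =
        ENNReal.ofReal (C * (p : ℝ) ^ (-(r - 1 / 2))) * PApprox.sobolevNorm r f := by
    intro C p f hC hf
    rw [ENNReal.ofReal_mul (by positivity), ENNReal.ofReal_toReal hf.ne]
  rcases le_or_gt 1 r with h1 | h1
  · obtain ⟨C, hC, hA⟩ := PApprox.exists_approximation_of_one_le r h1 t ht ht1
    refine ⟨C, hC, fun f hf => ?_⟩
    obtain ⟨V, hV⟩ := PApprox.exists_sobolevData hf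
    obtain ⟨g, hg, hfg, hq⟩ := hA f V _ hV
    refine ⟨g, hg, hfg, fun p hp => ?_⟩
    rw [← hfin C p f hC hf]
    exact hq p hp
  · obtain ⟨C, hC, hA⟩ := PApprox.exists_approximation_of_gagliardo r hr h1.le t ht ht1
    refine ⟨C, hC, fun f hf => ?_⟩
    obtain ⟨V, hV⟩ := PApprox.exists_sobolevData hf
    have hfl : ⌊r⌋₊ = 0 := Nat.floor_eq_zero.2 h1
    have hfr : Int.fract r = r := Int.fract_eq_self.2 ⟨by linarith, h1⟩
    have h0 : Int.fract r ≠ 0 := by rw [hfr]; linarith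
    have hG := hV.gagliardoSq_ne_top h0
    have hS := hV.gagliardo_le h0
    rw [hfl, hfr] at hG hS
    obtain ⟨g, hg, hfg, hq⟩ := hA (V 0) (hV.memLp 0 (Nat.zero_le _)) hG
    refine ⟨g, hg, hV.ae_eq_zero.trans hfg, fun p hp => ?_⟩
    obtain ⟨q, hqd, hq1, hq2, hle⟩ := hq p hp
    refine ⟨q, hqd, hq1, hq2, ?_⟩
    have e : (fun x => f x - q.eval x) =ᵐ[PApprox.μI] fun x => V 0 x - q.eval x := by
      filter_upwards [hV.ae_eq_zero] with x hx
      rw [hx]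
    rw [PApprox.tildeNorm_congr e, ← hfin C p f hC hf]
    refine hle.trans (ENNReal.ofReal_le_ofReal ?_)
    gcongr
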